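/- **Theorem 1.1.** Let $\Sigma$ be a finite alphabet and let $\mathrm{RegE}(\Sigma)$ be the set of terms generated by $$e,f ::= a\in\Sigma \mid 0 \mid 1 \mid \top \mid e\sqcup f \mid e\sqcap f\mid e\star f\mid e^\diamond .$$ For all $e,f\in \mathrm{RegE}(\Sigma)$ the following are equivalent: 1. $e\le f$ is derivable from the axioms of $\mathsf{SRKAM}$; 2. $e\le f$ is valid in the extended Weihrauch degrees, i.e. $[\![e]\!]_\rho\le_{\mathrm W}[\![f]\!]_\rho$ for every map $\rho$ from $\Sigma$ to extended Weihrauch problems; 3. Duplicator has a winning strategy in the game $\mathcal G(\emptyset\mid\{e\}\dashv f)$. The notions involved are as follows. *Axioms.* $\mathsf{SRKAM}$ has the following axioms and rules, for all terms $a,a',b,b',c$ (an equation stands for two inequations): $a\le b\wedge b\le c\Rightarrow a\le c$; $0\le a\le\top$; $a\le a\sqcup b$; $b\le a\sqcup b$; $b\le a\wedge c\le a\Rightarrow b\sqcup c\le a$; $a\sqcap b\le a$; $a\sqcap b\le b$; $a\le b\wedge a\le c\Rightarrow a\le b\sqcap c$; $a\sqcap(b\sqcup c)\le(a\sqcap b)\sqcup(a\sqcap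 c)$; $a\star1=a=1\star a$; $a\star(b\star c)=(a\star b)\star c$; $a\le a'\wedge b\le b'\Rightarrow a\star b\le a'\star b'$; $a\star0\le0$; $\top\le a\star\top$; $a\star(b\sqcup c)\le(a\star b)\sqcup(a\star c)$; $(a\star b)\sqcap(a\star c)\le a\star(b\sqcap c)$; $(a\star b)\sqcap c\le(a\sqcap c)\star b$; $1\le a^\diamond$; $a^\diamond\star a\le a^\diamond$; $a\sqcap(b\star c)\le b\Rightarrow a\sqcap(b\star c^\diamond)\le b$. *Weihrauch problems.* An extended Weihrauch problem $P$ is a set $\mathrm{dom}(P)\subseteq\mathbb N^{\mathbb N}$ together with a (possibly empty) set $P(u)\subseteq\mathbb N^{\mathbb N}$ for each $u\in\mathrm{dom}(P)$. $P\le_{\mathrm W}Q$ means that there are computable partial maps $\varphi,\psi$ such that for all $u\in\mathrm{dom}(P)$: $\varphi(u)$ is defined, $\varphi(u)\in\mathrm{dom}(Q)$, and for all $y\in Q(\varphi(u))$, $\psi(u,y)$ is defined and belongs to $P(u)$. Let $c\cdot x$ be the partial application of Kleene's second algebra, $\langle\ \rangle$ and $\langle u,v\rangle$ a standard coding of tuples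 in $\mathbb N^{\mathbb N}$, and $\mathsf{in}_1,\mathsf{in}_2$ the injections of a standard coding of tagged unions. The interpretation $[\![-]\!]_\rho$ extends $\rho$ homomorphically, using: - $\mathrm{dom}(0)=\emptyset$; $\mathrm{dom}(1)=\{\langle\ \rangle\}$ with $1(\langle\ \rangle)=\{\langle\ \rangle\}$; $\mathrm{dom}(\top)=\{\langle\ \rangle\}$ with $\top(\langle\ \rangle)=\emptyset$; - $\mathrm{dom}(P\sqcup Q)=\mathsf{in}_1(\mathrm{dom}(P))\cup\mathsf{in}_2(\mathrm{dom}(Q))$, $(P\sqcup Q)(\mathsf{in}_1(u))=P(u)$, $(P\sqcup Q)(\mathsf{in}_2(v))=Q(v)$; - $\mathrm{dom}(P\sqcap Q)=\{\langle u,v\rangle\mid u\in\mathrm{dom}(P),v\in\mathrm{dom}(Q)\}$, $(P\sqcap Q)(\langle u,v\rangle)=\mathsf{in}_1(P(u))\cup\mathsf{in}_2(Q(v))$; - $\mathrm{dom}(P\star Q)=\{\langle u,c\rangle\mid u\in\mathrm{dom}(Q),\ \forall x\in Q(u).\ c\cdot x\in\mathrm{dom}(P)\}$, $(P\star Q)(\langle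 u,c\rangle)=\{\langle x,y\rangle\mid x\in Q(u),\ y\in P(c\cdot x)\}$; - $\mathrm{dom}(P^\diamond)$ is the least set containing $\langle\ \rangle$ and every $\langle u,c\rangle$ with $u\in\mathrm{dom}(P)$ and $c\cdot x\in\mathrm{dom}(P^\diamond)$ for all $x\in P(u)$; $P^\diamond(\langle\ \rangle)=\{\langle\ \rangle\}$, $P^\diamond(\langle u,c\rangle)=\{\langle x,y\rangle\mid x\in P(u),\ y\in P^\diamond(c\cdot x)\}$. *Transitions and polarities.* The relation $\to$ on terms is the least one with $e\sqcup f\to e$, $e\sqcup f\to f$, $e\sqcap f\to e$, $e\sqcap f\to f$, $a\to1$ for $a\in\Sigma$, $e\star1\to e$, $e^\diamond\to1$, $e^\diamond\to e^\diamond\star e$, and $g\star e\to g\star f$ whenever $e\to f$. Polarities are $\mathrm{pol}(e\sqcup f)=\mathrm{pol}(0)=\mathrm{pol}(1)=\mathrm{pol}(e^\diamond)=\exists$, $\mathrm{pol}(e\sqcap f)=\mathrm{pol}(\top)=\forall$, $\mathrm{pol}(a)={?}a$ for $a\in\Sigma$, and $\mathrm{pol}(e\star f)=\mathrm{pol}(f)$.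 Call a term active if its polarity is $\exists$ or $\forall$. *The game.* Positions are triples $(\Gamma\mid X\dashv e)$ with $\Gamma\subseteq\Sigma$, $X\subseteq\mathrm{RegE}(\Sigma)$ finite and $e\in\mathrm{RegE}(\Sigma)$. A position has polarity $\forall$ (Spoiler moves) if some $t\in X\setminus\{1\}$ is active, or if $e=1$ and $1\in X$, or if $\mathrm{pol}(e)=\forall$; otherwise it has polarity $\exists$ (Duplicator moves). The moves are: - explore: $(\Gamma\mid X\uplus\{t\}\dashv e)\to(\Gamma\mid X\cup\{t'\}\dashv e)$ if $\mathrm{pol}(t)=\exists$ and $t\to t'$; - fork: $(\Gamma\mid X\uplus\{t\}\dashv e)\to(\Gamma\mid X\cup\{t'\mid t\to t'\}\dashv e)$ if $\mathrm{pol}(t)=\forall$; - alea: $(\Gamma\mid X\dashv e)\to(\Gamma\mid X\dashv e')$ if $\mathrm{pol}(e)=\forall$, no element of $X\setminus\{1\}$ is active, and $e\to e'$; - choose: $(\Gamma\mid X\dashv e)\to(\Gamma\mid X\dashv e')$ if the position has polarity $\exists$, $\mathrm{pol}(e)=\exists$ and $e\to e'$; - junk: $(\Gamma\mid X\dashv e)\to(\Gamma\mid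 X\dashv e')$ if the position has polarity $\exists$, $\mathrm{pol}(e)={?}a$ with $a\in\Gamma$, and $e\to e'$; - fill: $(\Gamma\mid X\uplus\{t\}\dashv e)\to(\Gamma\cup\{a\}\mid X\cup\{t'\}\dashv e')$ if the position has polarity $\exists$, $\mathrm{pol}(e)=\mathrm{pol}(t)={?}a$, $e\to e'$ and $t\to t'$. The winning positions are those of polarity $\forall$ at which no alea move can be played. Duplicator wins a finite maximal play if its last position is winning, and an infinite play if it visits winning positions infinitely often. A winning strategy for Duplicator is a non-empty prefix-closed set of plays from the initial position that contains every continuation by a move at its positions of polarity $\forall$ and exactly one at its positions of polarity $\exists$, and all of whose maximal plays (finite or infinite) are won by Duplicator. -/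

import Mathlib

namespace Weih

/-! ## Terms -/

/-- Expressions over the alphabet `α`, generated by the letters, the constants `0`, `1`, `⊤`
and the operators `⊔`, `⊓`, `⋆` and `(-)^⋄`. -/
inductive Term (α : Type*) where
  | letter (a : α)
  | zero
  | one
  | top
  | sup (e f : Term α)
  | inf (e f : Term α)
  | comp (e f : Term α)
  | diamond (e : Term α)

/-! ## The axiom system -/

/-- `Derives e f`: the inequation `e ≤ f` is derivable from the axioms of right-skewed Kleene
algebras with distributive meets. Every equation among the axioms is given as two inequations.
Reflexivity is derivable from the unit laws and transitivity. -/
inductive Derives {α : Type*} : Term α → Term α → Prop where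
  | trans {a b c : Term α} : Derives a b → Derives b c → Derives a c
  | zero_le (a : Term α) : Derives .zero a
  | le_top (a : Term α) : Derives a .top
  | le_sup_left (a b : Term α) : Derives a (.sup a b)
  | le_sup_right (a b : Term α) : Derives b (.sup a b)
  | sup_le {a b c : Term α} : Derives b a → Derives c a → Derives (.sup b c) a
  | inf_le_left (a b : Term α) : Derives (.inf a b) a
  | inf_le_right (a b : Term α) : Derives (.inf a b) b
  | le_inf {a b c : Term α} : Derives a b → Derives a c → Derives a (.inf b c)
  | inf_sup_distrib (a b c : Term α) :
      Derives (.inf a (.sup b c)) (.sup (.inf a b) (.inf a c))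
  | comp_one_le (a : Term α) : Derives (.comp a .one) a
  | le_comp_one (a : Term α) : Derives a (.comp a .one)
  | one_comp_le (a : Term α) : Derives (.comp .one a) a
  | le_one_comp (a : Term α) : Derives a (.comp .one a)
  | assoc_le (a b c : Term α) :
      Derives (.comp a (.comp b c)) (.comp (.comp a b) c)
  | le_assoc (a b c : Term α) :
      Derives (.comp (.comp a b) c) (.comp a (.comp b c))
  | comp_mono {a a' b b' : Term α} :
      Derives a a' → Derives b b' → Derives (.comp a b) (.comp a' b')
  | comp_zero_le (a : Term α) : Derives (.comp a .zero) .zero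
  | top_le_comp_top (a : Term α) : Derives .top (.comp a .top)
  | comp_sup_distrib (a b c : Term α) :
      Derives (.comp a (.sup b c)) (.sup (.comp a b) (.comp a c))
  | comp_inf_distrib (a b c : Term α) :
      Derives (.inf (.comp a b) (.comp a c)) (.comp a (.inf b c))
  | half_distrib (a b c : Term α) :
      Derives (.inf (.comp a b) c) (.comp (.inf a c) b)
  | one_le_diamond (a : Term α) : Derives .one (.diamond a)
  | diamond_comp_le (a : Term α) : Derives (.comp (.diamond a) a) (.diamond a)
  | diamond_induction {a b c : Term α} :
      Derives (.inf a (.comp b c)) b → Derives (.inf a (.comp b (.diamond c))) b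

/-! ## Baire space, Kleene's second algebra, and codings -/

/-- Baire space. -/
abbrev Baire := ℕ → ℕ

/-- The code of the finite sequence `n, p 0, …, p (k - 1)`. -/
def prefixCode (n : ℕ) (p : Baire) (k : ℕ) : ℕ :=
  Encodable.encode (n :: (List.range k).map p)

/-- The partial application `c · p` of Kleene's second algebra: its value at `n` is `m` when
`c` takes the value `m + 1` at the code of `n, p 0, …, p (k - 1)`, where `k` is the least number
for which this value of `c` is not zero. It is defined when such a `k` exists for every `n`.
A partial function on Baire space that is computable (by a Type-2 machine) is one that is
realised by a computable `c`, i.e. contained in `p ↦ c · p`. -/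
noncomputable def app (c p : Baire) : Part Baire where
  Dom := ∀ n, ∃ k, c (prefixCode n p k) ≠ 0
  get h := fun n => c (prefixCode n p (Nat.find (h n))) - 1

/-- The distinguished point `⟨⟩` of Baire space. In the codings below the first entry records
the length of a tuple, or the side of a tagged union. -/
def unitElt : Baire := fun _ => 0

/-- Prepend a number. -/
def cons (k : ℕ) (p : Baire) : Baire
  | 0 => k
  | n + 1 => p n

/-- The pair `⟨p, q⟩`. -/
def pair (p q : Baire) : Baire :=
  cons 2 (fun n => if n % 2 = 0 then p (n / 2) else q (n / 2))

/-- The left injection of tagged unions. -/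
def in₁ (p : Baire) : Baire := cons 0 p

/-- The right injection of tagged unions. -/
def in₂ (p : Baire) : Baire := cons 1 p

/-! ## Extended Weihrauch problems -/

/-- An extended Weihrauch problem: a set of instances, and a possibly empty set of solutions for
every instance. The value of `sol` outside of `dom` is irrelevant and never used. -/
structure Problem where
  dom : Set Baire
  sol : Baire → Set Baire

/-- Weihrauch reducibility. The forward and backward maps are realised by the computable
codes `φ` and `ψ`. -/
def Reduces (P Q : Problem) : Prop :=
  ∃ φ ψ : Baire, Computable φ ∧ Computable ψ ∧
    ∀ u ∈ P.dom, ∃ v ∈ app φ u, v ∈ Q.dom ∧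
      ∀ y ∈ Q.sol v, ∃ z ∈ app ψ (pair u y), z ∈ P.sol u

namespace Problem

def zero : Problem where
  dom := ∅
  sol _ := ∅

def one : Problem where
  dom := {unitElt}
  sol _ := {unitElt}

def top : Problem where
  dom := {unitElt}
  sol _ := ∅

def sup (P Q : Problem) : Problem where
  dom := {w | (∃ u ∈ P.dom, w = in₁ u) ∨ ∃ v ∈ Q.dom, w = in₂ v}
  sol w := {z | (∃ u ∈ P.dom, w = in₁ u ∧ z ∈ P.sol u) ∨
    ∃ v ∈ Q.dom, w = in₂ v ∧ z ∈ Q.sol v}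

def inf (P Q : Problem) : Problem where
  dom := {w | ∃ u ∈ P.dom, ∃ v ∈ Q.dom, w = pair u v}
  sol w := {z | ∃ u ∈ P.dom, ∃ v ∈ Q.dom, w = pair u v ∧
    ((∃ x ∈ P.sol u, z = in₁ x) ∨ ∃ y ∈ Q.sol v, z = in₂ y)}

/-- The composition `P ⋆ Q`: first a call to `Q`, then a call to `P`. -/
def comp (P Q : Problem) : Problem where
  dom := {w | ∃ u ∈ Q.dom, ∃ c, w = pair u c ∧ ∀ x ∈ Q.sol u, ∃ v ∈ app c x, v ∈ P.dom}
  sol w := {z | ∃ u ∈ Q.dom, ∃ c, w = pair u c ∧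
    ∃ x ∈ Q.sol u, ∃ v ∈ app c x, ∃ y ∈ P.sol v, z = pair x y}

/-- The instances of `P^⋄`: the least set containing `⟨⟩` and the pairs `⟨u, c⟩` with `u` an
instance of `P` and `c · x` (defined and) in that set for all solutions `x` of `u`. -/
inductive DiamondDom (P : Problem) : Baire → Prop where
  | unit : DiamondDom P unitElt
  | step (u c : Baire) : u ∈ P.dom → (∀ x ∈ P.sol u, (app c x).Dom) →
      (∀ x ∈ P.sol u, ∀ v ∈ app c x, DiamondDom P v) → DiamondDom P (pair u c)

/-- `DiamondSol P w z`: `z` is a solution of the instance `w` of `P^⋄`. -/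
inductive DiamondSol (P : Problem) : Baire → Baire → Prop where
  | unit : DiamondSol P unitElt unitElt
  | step (u c x v y : Baire) : u ∈ P.dom → x ∈ P.sol u → v ∈ app c x →
      DiamondSol P v y → DiamondSol P (pair u c) (pair x y)

/-- Iterated composition `P^⋄`. -/
def diamond (P : Problem) : Problem where
  dom := {w | DiamondDom P w}
  sol w := {z | DiamondSol P w z}

end Problem

/-- The interpretation of a term, given an interpretation `ρ` of the letters. -/
def Term.interp {α : Type*} (ρ : α → Problem) : Term α → Problem
  | .letter a => ρ a
  | .zero => Problem.zero
  | .one => Problem.one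
  | .top => Problem.top
  | .sup e f => Problem.sup (e.interp ρ) (f.interp ρ)
  | .inf e f => Problem.inf (e.interp ρ) (f.interp ρ)
  | .comp e f => Problem.comp (e.interp ρ) (f.interp ρ)
  | .diamond e => Problem.diamond (e.interp ρ)

/-- `e ≤ f` is universally valid in the extended Weihrauch degrees. -/
def Valid {α : Type*} (e f : Term α) : Prop :=
  ∀ ρ : α → Problem, Reduces (e.interp ρ) (f.interp ρ)

/-! ## Büchi games -/

inductive Player where
  | duplicator
  | spoiler

/-- A Büchi arena with set of positions `V`. Positions of polarity `∃` belong to Duplicator and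
those of polarity `∀` to Spoiler; `win` is the set of winning positions for Duplicator. -/
structure BuchiArena (V : Type*) where
  Move : V → V → Prop
  pol : V → Player
  win : Set V

namespace BuchiArena

variable {V : Type*}

/-- The list `p` of positions, in chronological order, is a finite partial play from `v`. -/
def IsPartialPlay (A : BuchiArena V) (v : V) (p : List V) : Prop :=
  p.head? = some v ∧ p.IsChain A.Move

/-- Strategies for Duplicator from `v`, given by their finite partial plays. The infinite plays
of a strategy are the sequences all of whose non-empty finite prefixes belong to it. -/
structure IsStrategy (A : BuchiArena V) (v : V) (s : Set (List V)) : Prop where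
  plays : ∀ p ∈ s, A.IsPartialPlay v p
  nonempty : s.Nonempty
  prefix_closed : ∀ p ∈ s, ∀ q, q ≠ [] → q <+: p → q ∈ s
  spoiler : ∀ p ∈ s, ∀ x, p.getLast? = some x → A.pol x = .spoiler →
    ∀ m, A.Move x m → p ++ [m] ∈ s
  duplicator : ∀ p ∈ s, ∀ x, p.getLast? = some x → A.pol x = .duplicator →
    ∃! m, A.Move x m ∧ p ++ [m] ∈ s

/-- All maximal plays of the strategy `s` are won by Duplicator: the finite ones end in a winning
position, the infinite ones visit winning positions infinitely often. -/
structure IsWinning (A : BuchiArena V) (s : Set (List V)) : Prop where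
  finite : ∀ p ∈ s, ∀ x, p.getLast? = some x → (∀ m, ¬ A.Move x m) → x ∈ A.win
  infinite : ∀ π : ℕ → V, (∀ n, (List.range (n + 1)).map π ∈ s) →
    {i | π i ∈ A.win}.Infinite

/-- Duplicator has a winning strategy from the position `v`. -/
def DuplicatorWins (A : BuchiArena V) (v : V) : Prop :=
  ∃ s, A.IsStrategy v s ∧ A.IsWinning s

end BuchiArena

/-! ## The simulation game -/

/-- The transition relation between terms. -/
inductive Step {α : Type*} : Term α → Term α → Prop where
  | sup_left (e f : Term α) : Step (.sup e f) e
  | sup_right (e f : Term α) : Step (.sup e f) f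
  | inf_left (e f : Term α) : Step (.inf e f) e
  | inf_right (e f : Term α) : Step (.inf e f) f
  | letter (a : α) : Step (.letter a) .one
  | comp_one (e : Term α) : Step (.comp e .one) e
  | diamond_one (e : Term α) : Step (.diamond e) .one
  | diamond_unfold (e : Term α) : Step (.diamond e) (.comp (.diamond e) e)
  | comp (g : Term α) {e f : Term α} : Step e f → Step (.comp g e) (.comp g f)

/-- Polarities of terms: `∃`, `∀`, or a call to the oracle `a`. -/
inductive Polarity (α : Type*) where
  | ex
  | all
  | oracle (a : α)

def Term.pol {α : Type*} : Term α → Polarity α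
  | .letter a => .oracle a
  | .zero => .ex
  | .one => .ex
  | .top => .all
  | .sup _ _ => .ex
  | .inf _ _ => .all
  | .comp _ f => f.pol
  | .diamond _ => .ex

/-- `t` has polarity `∃` or `∀`. -/
def Term.Active {α : Type*} (t : Term α) : Prop := t.pol = .ex ∨ t.pol = .all

/-- Positions `(Γ ∣ X ⊣ e)` of the simulation game. -/
structure Position (α : Type*) where
  seen : Set α
  goals : Finset (Term α)
  sim : Term α

open Classical in
/-- The polarity of a position. It is Spoiler's turn if some goal other than `1` can be decomposed,
or if the simulation is completed, or if the simulator has polarity `∀`. -/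
noncomputable def Position.pol {α : Type*} (p : Position α) : Player :=
  if ∃ t ∈ p.goals, t ≠ .one ∧ t.Active then .spoiler
  else if p.sim = .one ∧ .one ∈ p.goals then .spoiler
  else if p.sim.pol = .all then .spoiler
  else .duplicator

/-- The moves `alea`: the simulator has polarity `∀`, and no goal but `1` can be decomposed. -/
inductive AleaMove {α : Type*} : Position α → Position α → Prop where
  | intro {Γ : Set α} {X : Finset (Term α)} {e e' : Term α} :
      e.pol = .all → (∀ t ∈ X, t.Active → t = .one) → Step e e' →
      AleaMove ⟨Γ, X, e⟩ ⟨Γ, X, e'⟩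

open Classical in
/-- The moves of the simulation game. -/
inductive SimMove {α : Type*} : Position α → Position α → Prop where
  | explore {Γ : Set α} {X : Finset (Term α)} {e t t' : Term α} :
      t ∈ X → t.pol = .ex → Step t t' →
      SimMove ⟨Γ, X, e⟩ ⟨Γ, insert t' (X.erase t), e⟩
  | fork {Γ : Set α} {X X' : Finset (Term α)} {e t : Term α} :
      t ∈ X → t.pol = .all → (∀ s, s ∈ X' ↔ s ∈ X.erase t ∨ Step t s) →
      SimMove ⟨Γ, X, e⟩ ⟨Γ, X', e⟩
  | alea {p q : Position α} : AleaMove p q → SimMove p q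
  | choose {Γ : Set α} {X : Finset (Term α)} {e e' : Term α} :
      Position.pol ⟨Γ, X, e⟩ = .duplicator → e.pol = .ex → Step e e' →
      SimMove ⟨Γ, X, e⟩ ⟨Γ, X, e'⟩
  | junk {Γ : Set α} {X : Finset (Term α)} {e e' : Term α} {a : α} :
      Position.pol ⟨Γ, X, e⟩ = .duplicator → e.pol = .oracle a → a ∈ Γ → Step e e' →
      SimMove ⟨Γ, X, e⟩ ⟨Γ, X, e'⟩
  | fill {Γ : Set α} {X : Finset (Term α)} {e e' t t' : Term α} {a : α} :
      Position.pol ⟨Γ, X, e⟩ = .duplicator → t ∈ X → e.pol = .oracle a → t.pol = .oracle a →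
      Step e e' → Step t t' →
      SimMove ⟨Γ, X, e⟩ ⟨insert a Γ, insert t' (X.erase t), e'⟩

/-- The simulation arena. The winning positions are those of polarity `∀` where no move `alea`
can be played. -/
noncomputable def simArena (α : Type*) : BuchiArena (Position α) where
  Move := SimMove
  pol := Position.pol
  win := {p | p.pol = .spoiler ∧ ¬ ∃ q, AleaMove p q}

end Weih

/-! The proof goes round the cycle derivable ⇒ valid ⇒ won ⇒ derivable.

On the game side, `Winning` is the largest set each of whose positions lets Duplicator force, in a
well-founded way, a visit to a winning position all of whose successors lie in the set again. Only
finitely many positions are reachable from the initial one. Hence membership in `Winning` agrees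
with the existence of a strategy (`DuplicatorWins.winning`, `Winning.duplicatorWins`), and a lost
position already fails a finite approximation `Stage k` (`exists_notMem_stage`).

Derivable ⇒ valid: every axiom is realised by computable codes that do not depend on the
interpretation of the letters (`Derives.reduces`). The induction rule for the diamond uses the
recursion theorem. The uniformity in the interpretation is needed again in the next implication.

Valid ⇒ won: suppose that Duplicator loses within `k` visits. The letters are interpreted with a
generic family of points, none computable from finitely many others. Some points name questions,
others name answers, and each question carries a budget that bounds the visits still available.
Spoiler's decomposition of `e` yields a canonical instance of `e`, and validity turns it into an
instance of `f`. Evaluating `f` on it follows a play along lost positions (`Losing.continues`): by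
genericity an oracle can only be called on a question already asked, so each call is a fill or a
junk move. The evaluation ends with simulator `1` while `1` is not among the goals. The reduction
would then compute a solution of the canonical instance, which `notMem_sol_meetInst` excludes.

Won ⇒ derivable: the winning region is turned into a derivation (`derives_of_threads`). Goals become
threads whose values lie above the left-hand side. The only obstacle to termination is unfolding
`c^⋄`, which is closed off by the induction rule. The invariant given to that rule is `b ⋆ c^⋄`
together with, for each context `(Γ, X)` in which the iteration has been unfolded, the meet of all
simulators that win in that context. Meeting a context again finishes the branch, and there are
finitely many contexts. -/

namespace Weih

/-! ### Büchi games: the winning region as a greatest fixpoint -/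

namespace BuchiArena

variable {V : Type*}

/-- Positions from which Duplicator can force a visit to a winning position all of whose
successors lie in `W`. -/
inductive Prog (A : BuchiArena V) (W : Set V) : V → Prop where
  | visit {p : V} : A.pol p = .spoiler → p ∈ A.win → (∀ q, A.Move p q → q ∈ W) → Prog A W p
  | spoiler {p : V} : A.pol p = .spoiler → p ∉ A.win → (∃ q, A.Move p q) →
      (∀ q, A.Move p q → Prog A W q) → Prog A W p
  | duplicator {p q : V} : A.pol p = .duplicator → A.Move p q → Prog A W q → Prog A W p

theorem Prog.mono {A : BuchiArena V} {W W' : Set V} (h : W ⊆ W') {p : V} (hp : A.Prog W p) :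
    A.Prog W' p := by
  induction hp with
  | visit h1 h2 h3 => exact .visit h1 h2 fun q hq => h (h3 q hq)
  | spoiler h1 h2 h3 _ ih => exact .spoiler h1 h2 h3 ih
  | duplicator h1 h2 _ ih => exact .duplicator h1 h2 ih

/-- The greatest set of positions contained in its own `Prog`. -/
def Winning (A : BuchiArena V) : Set V := {p | ∃ W : Set V, (∀ q ∈ W, A.Prog W q) ∧ p ∈ W}

theorem subset_winning {A : BuchiArena V} {W : Set V} (h : ∀ q ∈ W, A.Prog W q) :
    W ⊆ A.Winning := fun _ hp => ⟨W, h, hp⟩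

theorem Winning.prog {A : BuchiArena V} {p : V} (hp : p ∈ A.Winning) : A.Prog A.Winning p := by
  obtain ⟨W, hW, hp⟩ := hp
  exact (hW p hp).mono (subset_winning hW)

theorem Prog.winning {A : BuchiArena V} {p : V} (hp : A.Prog A.Winning p) : p ∈ A.Winning := by
  refine ⟨{q | A.Prog A.Winning q}, fun q hq => ?_, hp⟩
  exact Prog.mono (fun r hr => Winning.prog hr) hq

/-- A play of the strategy `s` that ends outside of `Prog` for the set of endpoints of `s`. -/
def BadPlay (A : BuchiArena V) (s : Set (List V)) (p : List V) : Prop :=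
  p ∈ s ∧ ∃ x, p.getLast? = some x ∧ ¬ A.Prog {y | ∃ q ∈ s, q.getLast? = some y} x

/-- Failure of `Prog` propagates along a play: through the strategy's own move for Duplicator,
through some move for Spoiler. The endpoint cannot be a winning position of Spoiler, because all its
successors are endpoints of `s` and `Prog.visit` would apply. -/
theorem BadPlay.extend {A : BuchiArena V} {v : V} {s : Set (List V)}
    (hs : A.IsStrategy v s) (hw : A.IsWinning s) {p : List V} (hp : A.BadPlay s p) :
    (∀ x, p.getLast? = some x → x ∉ A.win ∨ A.pol x = .duplicator) ∧
      ∃ m, A.BadPlay s (p ++ [m]) := by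
  obtain ⟨hps, x, hx, hbad⟩ := hp
  cases hpol : A.pol x with
  | duplicator =>
    refine ⟨fun y hy => ?_, ?_⟩
    · obtain rfl : x = y := by simpa [hx] using hy
      exact .inr hpol
    obtain ⟨m, ⟨hm, hms⟩, -⟩ := hs.duplicator p hps x hx hpol
    exact ⟨m, hms, m, by simp, fun h => hbad (.duplicator hpol hm h)⟩
  | spoiler =>
    have hsp := hs.spoiler p hps x hx hpol
    have hnw : x ∉ A.win := fun hxw =>
      hbad (.visit hpol hxw fun q hq => ⟨p ++ [q], hsp q hq, by simp⟩)
    refine ⟨fun y hy => ?_, ?_⟩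
    · obtain rfl : x = y := by simpa [hx] using hy
      exact .inl hnw
    by_contra hno
    push Not at hno
    refine hbad (.spoiler hpol hnw ?_ fun q hq => ?_)
    · by_contra hstuck
      push Not at hstuck
      exact hnw (hw.finite p hps x hx hstuck)
    · by_contra hq'
      exact hno q ⟨hsp q hq, q, by simp, hq'⟩

/-- The endpoints of plays of a winning strategy form a set contained in its own `Prog`. Otherwise a
bad play extends forever by bad plays, giving an infinite play of the strategy with only finitely
many visits. -/
theorem DuplicatorWins.winning {A : BuchiArena V} (hA : ∀ p ∈ A.win, A.pol p = .spoiler) {v : V}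
    (h : A.DuplicatorWins v) : v ∈ A.Winning := by
  classical
  obtain ⟨s, hs, hw⟩ := h
  have hv : [v] ∈ s := by
    obtain ⟨p, hp⟩ := hs.nonempty
    have hp1 := (hs.plays p hp).1
    cases p with
    | nil => simp at hp1
    | cons x p =>
      obtain rfl : x = v := by simpa using hp1
      exact hs.prefix_closed _ hp [x] (by simp) ⟨p, by simp⟩
  refine subset_winning (W := {y | ∃ q ∈ s, q.getLast? = some y}) ?_ ⟨[v], hv, by simp⟩
  rintro x ⟨p, hp, hx⟩
  by_contra hbad
  have hp0 : A.BadPlay s p := ⟨hp, x, hx, hbad⟩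
  have : Nonempty V := ⟨v⟩
  choose! next hnext using fun (q : List V) (hq : A.BadPlay s q) => (hq.extend hs hw).2
  obtain ⟨P, hP0, hPs⟩ : ∃ P : ℕ → List V, P 0 = p ∧ ∀ n, P (n + 1) = P n ++ [next (P n)] :=
    ⟨fun n => Nat.rec p (fun _ q => q ++ [next q]) n, rfl, fun _ => rfl⟩
  have hP : ∀ n, A.BadPlay s (P n) := by
    intro n
    induction n with
    | zero => rw [hP0]; exact hp0
    | succ n ih => rw [hPs]; exact hnext _ ih
  have hlen : ∀ n, (P n).length = p.length + n := by
    intro n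
    induction n with
    | zero => rw [hP0]; rfl
    | succ n ih => rw [hPs]; simp [ih]; omega
  have hpre : ∀ n k, P n <+: P (n + k) := by
    intro n k
    induction k with
    | zero => exact List.prefix_rfl
    | succ k ih => exact ih.trans ⟨[next (P (n + k))], (hPs (n + k)).symm⟩
  have hpos : 0 < p.length := by
    cases p with
    | nil => simp at hx
    | cons => simp
  -- The plays `P n` extend one another, so their diagonal is the infinite play they approximate.
  let π : ℕ → V := fun i => (P i)[i]'(by rw [hlen]; omega)
  have hπ : ∀ n i (h : i < (P n).length), (P n)[i] = π i := by
    intro n i h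
    rcases le_total n i with hni | hni
    · obtain ⟨k, rfl⟩ := Nat.exists_eq_add_of_le hni
      exact ((hpre n k).getElem h)
    · obtain ⟨k, rfl⟩ := Nat.exists_eq_add_of_le hni
      exact ((hpre i k).getElem _).symm
  have htake : ∀ n, (List.range (n + 1)).map π = (P n).take (n + 1) := by
    intro n
    apply List.ext_getElem
    · simp [hlen]; omega
    · intro i h1 h2
      simp only [List.getElem_map, List.getElem_range, List.getElem_take]
      rw [hπ]
  have hinf := hw.infinite π fun n => by
    rw [htake]
    refine hs.prefix_closed _ (hP n).1 _ ?_ (List.take_prefix _ _)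
    rw [Ne, List.take_eq_nil_iff]
    rintro (h | h)
    · omega
    · have := hlen n
      rw [h] at this
      simp at this
      omega
  -- A visit at an index from `p.length` on would be the last position of some bad play `P (k + 1)`.
  refine hinf ((Set.finite_lt_nat p.length).subset fun i hi => ?_)
  by_contra hlt
  simp only [Set.mem_ofPred_eq, not_lt] at hlt hi
  obtain ⟨k, rfl⟩ := Nat.exists_eq_add_of_le hlt
  have hl : (P (k + 1)).getLast? = some (π (p.length + k)) := by
    rw [List.getLast?_eq_getElem?, hlen, List.getElem?_eq_getElem (by rw [hlen]; omega)]
    simp only [Option.some.injEq]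
    rw [hπ]
    congr 1
  rcases ((hP (k + 1)).extend hs hw).1 _ hl with h | h
  · exact h hi
  · rw [hA _ hi] at h
    cases h

/-! ### Positional strategies from finite ranks -/

/-- `Prog` with a bound on the height of the derivation. -/
def ProgN (A : BuchiArena V) (W : Set V) : ℕ → V → Prop
  | 0, _ => False
  | n + 1, p => (A.pol p = .spoiler ∧ p ∈ A.win ∧ ∀ q, A.Move p q → q ∈ W) ∨
      (A.pol p = .spoiler ∧ p ∉ A.win ∧ (∃ q, A.Move p q) ∧ ∀ q, A.Move p q → ProgN A W n q) ∨
      (A.pol p = .duplicator ∧ ∃ q, A.Move p q ∧ ProgN A W n q)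

theorem ProgN.succ {A : BuchiArena V} {W : Set V} {n : ℕ} {p : V} (h : A.ProgN W n p) :
    A.ProgN W (n + 1) p := by
  induction n generalizing p with
  | zero => exact h.elim
  | succ n ih =>
    rcases h with h | ⟨h1, h2, h3, h4⟩ | ⟨h1, q, h2, h3⟩
    · exact .inl h
    · exact .inr (.inl ⟨h1, h2, h3, fun q hq => ih (h4 q hq)⟩)
    · exact .inr (.inr ⟨h1, q, h2, ih h3⟩)

theorem ProgN.mono {A : BuchiArena V} {W : Set V} {m n : ℕ} (hmn : m ≤ n) {p : V}
    (h : A.ProgN W m p) : A.ProgN W n p := by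
  induction hmn with
  | refl => exact h
  | step _ ih => exact ih.succ

/-- Within a finite closed set Spoiler has finitely many moves, so the heights of the subderivations
have a maximum. -/
theorem Prog.exists_progN {A : BuchiArena V} {W R : Set V} (hR : R.Finite)
    (hcl : ∀ p ∈ R, ∀ q, A.Move p q → q ∈ R) {p : V} (h : A.Prog W p) (hp : p ∈ R) :
    ∃ n, A.ProgN W n p := by
  induction h with
  | visit h1 h2 h3 => exact ⟨1, .inl ⟨h1, h2, h3⟩⟩
  | @spoiler p h1 h2 h3 _ ih =>
    choose! N hN using fun q hq => ih q hq (hcl p hp q hq)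
    have hfin : {q | A.Move p q}.Finite := hR.subset fun q hq => hcl p hp q hq
    refine ⟨hfin.toFinset.sup N + 1, .inr (.inl ⟨h1, h2, h3, fun q hq => ?_⟩)⟩
    exact (hN q hq).mono (Finset.le_sup (f := N) (by simpa using hq))
  | duplicator h1 h2 _ ih =>
    obtain ⟨n, hn⟩ := ih (hcl _ hp _ h2)
    exact ⟨n + 1, .inr (.inr ⟨h1, _, h2, hn⟩)⟩

/-- Duplicator always moves to a position of smaller rank. Ranks also drop under Spoiler's moves
except at visits, where the rank may be reset, so visits recur forever. -/
theorem Winning.duplicatorWins {A : BuchiArena V} {R : Set V} (hR : R.Finite)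
    (hcl : ∀ p ∈ R, ∀ q, A.Move p q → q ∈ R) {v : V} (hvR : v ∈ R) (hv : v ∈ A.Winning) :
    A.DuplicatorWins v := by
  classical
  let W := A.Winning
  have hrank : ∀ p, p ∈ R ∧ p ∈ W → ∃ n, A.ProgN W n p := fun p hp =>
    (Winning.prog hp.2).exists_progN hR hcl hp.1
  let rk : V → ℕ := fun p => sInf {n | A.ProgN W n p}
  have hrk : ∀ p, p ∈ R ∧ p ∈ W → A.ProgN W (rk p) p := fun p hp => Nat.sInf_mem (hrank p hp)
  have hle : ∀ p n, A.ProgN W n p → rk p ≤ n := fun p n h => Nat.sInf_le h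
  have hprog : ∀ n p, A.ProgN W n p → A.Prog W p := by
    intro n
    induction n with
    | zero => exact fun p h => h.elim
    | succ n ih =>
      rintro p (⟨h1, h2, h3⟩ | ⟨h1, h2, h3, h4⟩ | ⟨h1, q, h2, h3⟩)
      · exact .visit h1 h2 h3
      · exact .spoiler h1 h2 h3 fun q hq => ih q (h4 q hq)
      · exact .duplicator h1 h2 (ih q h3)
  have hdup : ∀ p, p ∈ R ∧ p ∈ W ∧ A.pol p = .duplicator →
      ∃ q, A.Move p q ∧ q ∈ W ∧ rk q < rk p := by
    rintro p ⟨hpR, hpW, hpol⟩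
    have h := hrk p ⟨hpR, hpW⟩
    rcases hn : rk p with _ | n
    · rw [hn] at h; exact h.elim
    rw [hn] at h
    rcases h with ⟨h1, -⟩ | ⟨h1, -⟩ | ⟨-, q, h2, h3⟩
    · rw [hpol] at h1; cases h1
    · rw [hpol] at h1; cases h1
    · exact ⟨q, h2, Prog.winning (hprog n q h3), Nat.lt_succ_of_le (hle q n h3)⟩
  choose! σ hσ using hdup
  -- The plays of the strategy are the chains of this relation: Spoiler is free and Duplicator
  -- follows `σ`.
  let rel : V → V → Prop := fun p q => A.Move p q ∧ (A.pol p = .duplicator → q = σ p)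
  have hstep : ∀ p q, p ∈ R ∧ p ∈ W → rel p q → (q ∈ R ∧ q ∈ W) ∧ (p ∉ A.win → rk q < rk p) := by
    rintro p q ⟨hpR, hpW⟩ ⟨hm, hd⟩
    have hqR := hcl p hpR q hm
    cases hpol : A.pol p with
    | duplicator =>
      obtain rfl := hd hpol
      exact ⟨⟨hqR, (hσ p ⟨hpR, hpW, hpol⟩).2.1⟩, fun _ => (hσ p ⟨hpR, hpW, hpol⟩).2.2⟩
    | spoiler =>
      have h := hrk p ⟨hpR, hpW⟩
      rcases hn : rk p with _ | n
      · rw [hn] at h; exact h.elim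
      rw [hn] at h
      rcases h with ⟨h1, h2, h3⟩ | ⟨-, h2, -, h4⟩ | ⟨h1, -⟩
      · exact ⟨⟨hqR, h3 q hm⟩, fun h => (h h2).elim⟩
      · exact ⟨⟨hqR, Prog.winning (hprog n q (h4 q hm))⟩,
          fun _ => Nat.lt_succ_of_le (hle q n (h4 q hm))⟩
      · rw [hpol] at h1; cases h1
  let s : Set (List V) := {p | p.head? = some v ∧ p.IsChain rel}
  have hsub : ∀ p : List V, ∀ a, p.head? = some a → (a ∈ R ∧ a ∈ W) → p.IsChain rel →
      ∀ x ∈ p, x ∈ R ∧ x ∈ W := by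
    intro p
    induction p with
    | nil => simp
    | cons a p ih =>
      intro b hb hbW hch x hx
      obtain rfl : a = b := by simpa using hb
      rcases List.mem_cons.1 hx with rfl | hx
      · exact hbW
      cases p with
      | nil => simp at hx
      | cons c p =>
        rw [List.isChain_cons_cons] at hch
        exact ih c rfl (hstep a c hbW hch.1).1 hch.2 x hx
  have hmem : ∀ p ∈ s, ∀ x ∈ p, x ∈ R ∧ x ∈ W := fun p hp =>
    hsub p v hp.1 ⟨hvR, hv⟩ hp.2
  have happ : ∀ p ∈ s, ∀ x, p.getLast? = some x → ∀ m, p ++ [m] ∈ s ↔ rel x m := by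
    rintro p ⟨h1, h2⟩ x hx m
    have hne : p ≠ [] := by rintro rfl; simp at hx
    constructor
    · rintro ⟨-, h⟩
      rw [List.isChain_append] at h
      exact h.2.2 x hx m rfl
    · intro h
      refine ⟨by rw [List.head?_append_of_ne_nil _ hne]; exact h1, ?_⟩
      rw [List.isChain_append]
      refine ⟨h2, List.isChain_singleton m, ?_⟩
      intro y hy z hz
      obtain rfl : x = y := by simpa [hx] using hy
      obtain rfl : m = z := by simpa using hz
      exact h
  refine ⟨s, ⟨?_, ⟨[v], rfl, List.isChain_singleton v⟩, ?_, ?_, ?_⟩, ⟨?_, ?_⟩⟩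
  · exact fun p hp => ⟨hp.1, hp.2.imp fun _ _ h => h.1⟩
  · rintro p ⟨h1, h2⟩ q hq ⟨r, rfl⟩
    exact ⟨by rw [← h1, List.head?_append_of_ne_nil _ hq], (List.isChain_append.1 h2).1⟩
  · intro p hp x hx hpol m hm
    exact (happ p hp x hx m).2 ⟨hm, fun h => by rw [hpol] at h; cases h⟩
  · intro p hp x hx hpol
    have hxp := hmem p hp x (List.mem_of_getLast? hx)
    have h := hσ x ⟨hxp.1, hxp.2, hpol⟩
    refine ⟨σ x, ⟨h.1, (happ p hp x hx _).2 ⟨h.1, fun _ => rfl⟩⟩, ?_⟩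
    rintro m ⟨-, hms⟩
    exact ((happ p hp x hx m).1 hms).2 hpol
  · intro p hp x hx hstuck
    have hxp := hmem p hp x (List.mem_of_getLast? hx)
    cases Winning.prog hxp.2 with
    | visit _ h _ => exact h
    | spoiler _ _ h _ => exact (hstuck _ h.choose_spec).elim
    | duplicator _ h _ => exact (hstuck _ h).elim
  · intro π hπ
    have hrel : ∀ n, rel (π n) (π (n + 1)) := by
      intro n
      have h := (hπ (n + 1)).2
      rw [List.range_succ, List.map_append, List.isChain_append] at h
      refine h.2.2 (π n) ?_ (π (n + 1)) rfl
      rw [List.range_succ]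
      simp
    have hgood : ∀ n, π n ∈ R ∧ π n ∈ W := fun n =>
      hmem _ (hπ n) _ (by simp only [List.mem_map, List.mem_range]; exact ⟨n, by omega, rfl⟩)
    by_contra hfin
    rw [Set.not_infinite] at hfin
    obtain ⟨N, hN⟩ := hfin.bddAbove
    -- After the last visit the rank would decrease forever.
    have hdec : ∀ k, rk (π (N + 1 + k)) + k ≤ rk (π (N + 1)) := by
      intro k
      induction k with
      | zero => simp
      | succ k ih =>
        have := (hstep _ _ (hgood (N + 1 + k)) (hrel _)).2 fun h => by
          have := hN h
          omega
        change rk (π (N + 1 + k + 1)) + (k + 1) ≤ _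
        omega
    have := hdec (rk (π (N + 1)) + 1)
    omega

/-! ### Finite approximation of the winning region -/

/-- The decreasing approximations of the set of winning positions. -/
def Stage (A : BuchiArena V) : ℕ → Set V
  | 0 => Set.univ
  | n + 1 => {p | A.Prog (Stage A n) p}

theorem stage_succ_subset (A : BuchiArena V) (n : ℕ) : A.Stage (n + 1) ⊆ A.Stage n := by
  induction n with
  | zero => exact Set.subset_univ _
  | succ n ih => exact fun p hp => Prog.mono ih hp

theorem Prog.inter {A : BuchiArena V} {W R : Set V} (hcl : ∀ p ∈ R, ∀ q, A.Move p q → q ∈ R)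
    {p : V} (hp : p ∈ R) (h : A.Prog W p) : A.Prog (W ∩ R) p := by
  induction h with
  | visit h1 h2 h3 => exact .visit h1 h2 fun q hq => ⟨h3 q hq, hcl _ hp q hq⟩
  | spoiler h1 h2 h3 _ ih => exact .spoiler h1 h2 h3 fun q hq => ih q hq (hcl _ hp q hq)
  | duplicator h1 h2 _ ih => exact .duplicator h1 h2 (ih (hcl _ hp _ h2))

/-- The traces of the stages on a finite closed set must stabilise, and a stable trace is contained
in its own `Prog`, hence in `Winning`. -/
theorem exists_notMem_stage {A : BuchiArena V} {R : Set V} (hR : R.Finite)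
    (hcl : ∀ p ∈ R, ∀ q, A.Move p q → q ∈ R) {v : V} (hvR : v ∈ R) (hv : v ∉ A.Winning) :
    ∃ k, v ∉ A.Stage k := by
  classical
  by_contra hall
  push Not at hall
  have hanti : Antitone A.Stage := antitone_nat_of_succ_le A.stage_succ_subset
  have hex : ∃ k, A.Stage k ∩ R ⊆ A.Stage (k + 1) := by
    by_contra hno
    push Not at hno
    have hlt : ∀ k, (hR.inter_of_right (A.Stage (k + 1))).toFinset.card + (k + 1) ≤
        hR.toFinset.card := by
      intro k
      have hss : ∀ k, (hR.inter_of_right (A.Stage (k + 1))).toFinset.card <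
          (hR.inter_of_right (A.Stage k)).toFinset.card := by
        intro k
        apply Finset.card_lt_card
        rw [Set.Finite.toFinset_ssubset_toFinset]
        refine ⟨Set.inter_subset_inter_left _ (A.stage_succ_subset k), fun h => hno k ?_⟩
        exact h.trans Set.inter_subset_left
      induction k with
      | zero =>
        have h0 : (hR.inter_of_right (A.Stage 0)).toFinset.card ≤ hR.toFinset.card :=
          Finset.card_le_card (by
            rw [Set.Finite.toFinset_subset_toFinset]; exact Set.inter_subset_right)
        have := hss 0
        omega
      | succ k ih =>
        have := hss (k + 1)
        omega
    have := hlt (hR.toFinset.card)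
    omega
  obtain ⟨k, hk⟩ := hex
  refine hv (subset_winning (W := A.Stage k ∩ R) (fun q hq => ?_) ⟨hall k, hvR⟩)
  exact Prog.inter hcl hq.2 (hk hq)

end BuchiArena

end Weih

namespace Weih

variable {α : Type*}

/-! ## Transitions and positions -/

theorem step_one {t : Term α} : ¬ Step .one t := by rintro ⟨⟩

/-- The set of terms reachable from a term by transitions. -/
def Term.reach : Term α → Set (Term α)
  | .letter a => {.letter a, .one}
  | .zero => {.zero}
  | .one => {.one}
  | .top => {.top}
  | .sup e f => insert (.sup e f) (e.reach ∪ f.reach)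
  | .inf e f => insert (.inf e f) (e.reach ∪ f.reach)
  | .comp g e => Term.comp g '' e.reach ∪ g.reach
  | .diamond e => {.diamond e, .one} ∪ Term.comp (.diamond e) '' e.reach

theorem Term.reach_finite (e : Term α) : e.reach.Finite := by
  induction e with
  | letter | zero | one | top => simp [Term.reach]
  | sup e f ihe ihf => exact (ihe.union ihf).insert _
  | inf e f ihe ihf => exact (ihe.union ihf).insert _
  | comp g e ihg ihe => exact (ihe.image _).union ihg
  | diamond e ihe => exact (Set.toFinite _).union (ihe.image _)

theorem Term.mem_reach_self (e : Term α) : e ∈ e.reach := by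
  induction e with
  | letter | zero | one | top | sup | inf | diamond => simp [Term.reach]
  | comp g e _ ihe => exact .inl ⟨e, ihe, rfl⟩

/-- Transitions act on the right factor of a composition. When that factor has become `1` it is
dropped, so unfolding `e^⋄` comes back to `e^⋄` and never piles up factors. -/
theorem Step.mem_reach {e t t' : Term α} (h : Step t t') (ht : t ∈ e.reach) : t' ∈ e.reach := by
  induction e generalizing t t' with
  | letter a =>
    rcases ht with rfl | rfl
    · cases h; exact .inr rfl
    · exact (step_one h).elim
  | zero => cases ht; cases h
  | one => cases ht; cases h
  | top => cases ht; cases h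
  | sup e f ihe ihf =>
    rcases ht with rfl | ht | ht
    · cases h
      · exact .inr (.inl e.mem_reach_self)
      · exact .inr (.inr f.mem_reach_self)
    · exact .inr (.inl (ihe h ht))
    · exact .inr (.inr (ihf h ht))
  | inf e f ihe ihf =>
    rcases ht with rfl | ht | ht
    · cases h
      · exact .inr (.inl e.mem_reach_self)
      · exact .inr (.inr f.mem_reach_self)
    · exact .inr (.inl (ihe h ht))
    · exact .inr (.inr (ihf h ht))
  | comp g e ihg ihe =>
    rcases ht with ⟨d, hd, rfl⟩ | ht
    · cases h with
      | comp_one => exact .inr g.mem_reach_self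
      | comp _ h => exact .inl ⟨_, ihe h hd, rfl⟩
    · exact .inr (ihg h ht)
  | diamond e ihe =>
    rcases ht with (rfl | rfl) | ⟨d, hd, rfl⟩
    · cases h
      · exact .inl (.inr rfl)
      · exact .inr ⟨e, e.mem_reach_self, rfl⟩
    · exact (step_one h).elim
    · cases h with
      | comp_one => exact .inl (.inl rfl)
      | comp _ h => exact .inr ⟨_, ihe h hd, rfl⟩

/-- Positions in which all goals are reachable from `e` and the simulator is reachable
from `f`. -/
def reachPos (e f : Term α) : Set (Position α) :=
  {p | (p.goals : Set (Term α)) ⊆ e.reach ∧ p.sim ∈ f.reach}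

/-- The letters seen are unrestricted in `reachPos`; finiteness of the alphabet takes care of them.
-/
theorem reachPos_finite [Finite α] (e f : Term α) : (reachPos e f).Finite := by
  classical
  have h1 : ({X : Finset (Term α) | (X : Set (Term α)) ⊆ e.reach}).Finite := by
    refine (e.reach_finite.toFinset.powerset.finite_toSet).subset fun X hX => ?_
    simp only [Finset.coe_powerset, Set.Finite.coe_toFinset, Set.mem_preimage, Set.mem_powerset_iff]
    exact hX
  have h2 := ((Set.finite_univ (α := Set α)).prod (h1.prod f.reach_finite)).image
    fun x => (⟨x.1, x.2.1, x.2.2⟩ : Position α)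
  refine h2.subset ?_
  rintro ⟨Γ, X, s⟩ ⟨hX, hs⟩
  exact ⟨(Γ, X, s), ⟨trivial, hX, hs⟩, rfl⟩

open Classical in
theorem reachPos_move {e f : Term α} {p : Position α} (hp : p ∈ reachPos e f) {q : Position α}
    (h : SimMove p q) : q ∈ reachPos e f := by
  cases h with
  | explore ht _ hst =>
    refine ⟨fun s hs => ?_, hp.2⟩
    simp only [Finset.coe_insert, Finset.coe_erase, Set.mem_insert_iff] at hs
    rcases hs with rfl | hs
    · exact hst.mem_reach (hp.1 ht)
    · exact hp.1 hs.1
  | fork ht _ hX =>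
    refine ⟨fun s hs => ?_, hp.2⟩
    rcases (hX s).1 hs with hs | hs
    · exact hp.1 (Finset.mem_of_mem_erase hs)
    · exact hs.mem_reach (hp.1 ht)
  | alea h =>
    cases h with
    | intro _ _ hst => exact ⟨hp.1, hst.mem_reach hp.2⟩
  | choose _ _ hst => exact ⟨hp.1, hst.mem_reach hp.2⟩
  | junk _ _ _ hst => exact ⟨hp.1, hst.mem_reach hp.2⟩
  | fill _ ht _ _ hst hst' =>
    refine ⟨fun s hs => ?_, hst.mem_reach hp.2⟩
    simp only [Finset.coe_insert, Finset.coe_erase, Set.mem_insert_iff] at hs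
    rcases hs with rfl | hs
    · exact hst'.mem_reach (hp.1 ht)
    · exact hp.1 hs.1

theorem win_spoiler (p : Position α) (hp : p ∈ (simArena α).win) :
    (simArena α).pol p = .spoiler := hp.1

/-- No goal but `1` can be decomposed. -/
def Stuck (X : Finset (Term α)) : Prop := ∀ t ∈ X, t.Active → t = .one

theorem pol_of_active {Γ : Set α} {X : Finset (Term α)} {e t : Term α} (ht : t ∈ X)
    (h1 : t ≠ .one) (ha : t.Active) : Position.pol ⟨Γ, X, e⟩ = .spoiler := by
  classical
  rw [Position.pol, if_pos ⟨t, ht, h1, ha⟩]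

theorem not_stuck_iff {X : Finset (Term α)} :
    ¬ Stuck X ↔ ∃ t ∈ X, t ≠ .one ∧ t.Active := by
  unfold Stuck
  push Not
  exact ⟨fun ⟨t, h1, h2, h3⟩ => ⟨t, h1, h3, h2⟩, fun ⟨t, h1, h2, h3⟩ => ⟨t, h1, h3, h2⟩⟩

theorem pol_eq_spoiler_iff {Γ : Set α} {X : Finset (Term α)} {e : Term α} :
    Position.pol ⟨Γ, X, e⟩ = .spoiler ↔
      ¬ Stuck X ∨ (e = .one ∧ .one ∈ X) ∨ e.pol = .all := by
  classical
  rw [not_stuck_iff, Position.pol]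
  split_ifs with h1 h2 h3 <;> simp_all

theorem pol_eq_duplicator_iff {Γ : Set α} {X : Finset (Term α)} {e : Term α} :
    Position.pol ⟨Γ, X, e⟩ = .duplicator ↔
      Stuck X ∧ ¬ (e = .one ∧ .one ∈ X) ∧ e.pol ≠ .all := by
  have h := pol_eq_spoiler_iff (Γ := Γ) (X := X) (e := e)
  cases hp : Position.pol ⟨Γ, X, e⟩ with
  | duplicator => rw [hp] at h; simp at h; tauto
  | spoiler => rw [hp] at h; simp at h; tauto

/-- An alea move is forbidden while a goal can be decomposed, so every decomposition by Spoiler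
counts as a visit. -/
theorem win_of_not_stuck {Γ : Set α} {X : Finset (Term α)} {e : Term α} (h : ¬ Stuck X) :
    (⟨Γ, X, e⟩ : Position α) ∈ (simArena α).win := by
  refine ⟨pol_eq_spoiler_iff.2 (.inl h), ?_⟩
  rintro ⟨q, ⟨_, h', _⟩⟩
  exact h h'

/-- The terms that are neither `1` nor active call an oracle. -/
theorem Term.exists_oracle {t : Term α} (h : ¬ t.Active) : ∃ a, t.pol = .oracle a := by
  cases ht : t.pol with
  | ex => exact (h (.inl ht)).elim
  | all => exact (h (.inr ht)).elim
  | oracle a => exact ⟨a, rfl⟩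

theorem Term.not_active_of_oracle {t : Term α} {a : α} (h : t.pol = .oracle a) : ¬ t.Active := by
  rintro (h' | h') <;> rw [h] at h' <;> cases h'

/-- The term obtained from a term that calls an oracle once the call is answered. -/
def Term.residual : Term α → Term α
  | .comp g e => .comp g e.residual
  | _ => .one

/-- Following right factors leads to a letter, whose only transition is to `1`; a right factor `1`
is excluded because its polarity is `∃`. -/
theorem step_iff_residual {t t' : Term α} {a : α} (h : t.pol = .oracle a) :
    Step t t' ↔ t' = t.residual := by
  induction t generalizing t' with
  | letter b =>
    constructor
    · rintro ⟨⟩; rfl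
    · rintro rfl; exact .letter b
  | zero => cases h
  | one => cases h
  | top => cases h
  | sup => cases h
  | inf => cases h
  | diamond => cases h
  | comp g e _ ih =>
    constructor
    · intro hs
      cases hs with
      | comp_one => cases h
      | comp _ hs => rw [(ih h).1 hs]; rfl
    · rintro rfl
      exact .comp g ((ih h).2 rfl)

/-! ## Derived inequations -/

instance : Trans (Derives (α := α)) Derives Derives := ⟨Derives.trans⟩

namespace Derives

theorem refl (a : Term α) : Derives a a := (le_comp_one a).trans (comp_one_le a)

theorem inf_mono {a a' b b' : Term α} (h : Derives a a') (h' : Derives b b') :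
    Derives (.inf a b) (.inf a' b') :=
  le_inf ((inf_le_left a b).trans h) ((inf_le_right a b).trans h')

theorem le_of_inf_left {a b c : Term α} (h : Derives a c) : Derives (.inf a b) c :=
  (inf_le_left a b).trans h

theorem le_of_inf_right {a b c : Term α} (h : Derives b c) : Derives (.inf a b) c :=
  (inf_le_right a b).trans h

theorem comp_mono_left {a a' : Term α} (b : Term α) (h : Derives a a') :
    Derives (.comp a b) (.comp a' b) := comp_mono h (refl b)

theorem comp_mono_right (a : Term α) {b b' : Term α} (h : Derives b b') :
    Derives (.comp a b) (.comp a b') := comp_mono (refl a) h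

/-- Case distinction on a join below which an element lies. -/
theorem sup_cases {a b c d : Term α} (h : Derives a (.sup b c)) (hb : Derives (.inf a b) d)
    (hc : Derives (.inf a c) d) : Derives a d :=
  ((le_inf (refl a) h).trans (inf_sup_distrib a b c)).trans (sup_le hb hc)

end Derives

/-- Finite meets. -/
def meet : List (Term α) → Term α := List.foldr Term.inf .top

theorem meet_le {l : List (Term α)} {x : Term α} (h : x ∈ l) : Derives (meet l) x := by
  induction l with
  | nil => simp at h
  | cons y l ih =>
    rcases List.mem_cons.1 h with rfl | h
    · exact Derives.inf_le_left _ _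
    · exact Derives.le_of_inf_right (ih h)

theorem le_meet {l : List (Term α)} {a : Term α} (h : ∀ x ∈ l, Derives a x) :
    Derives a (meet l) := by
  induction l with
  | nil => exact Derives.le_top a
  | cons y l ih =>
    exact Derives.le_inf (h y (by simp)) (ih fun x hx => h x (by simp [hx]))

/-- Every transition of polarity `∃` is an axiom in a context on the left. This justifies
Duplicator's choose moves as well as Spoiler's explorations. -/
theorem Step.le_of_ex {t t' : Term α} (h : Step t t') (hp : t.pol = .ex) : Derives t' t := by
  induction h with
  | sup_left e f => exact .le_sup_left e f
  | sup_right e f => exact .le_sup_right e f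
  | inf_left => cases hp
  | inf_right => cases hp
  | letter => cases hp
  | comp_one e => exact .le_comp_one e
  | diamond_one e => exact .one_le_diamond e
  | diamond_unfold e => exact .diamond_comp_le e
  | comp g _ ih => exact .comp_mono_right g (ih hp)

/-- A term of polarity `∀` is the meet of its successors. -/
theorem le_of_forall_step {a f : Term α} (hp : f.pol = .all)
    (h : ∀ f', Step f f' → Derives a f') : Derives a f := by
  -- A left factor `g` is carried along so that the induction passes through compositions by
  -- reassociation; at the end `g = 1`.
  have key : ∀ (f g : Term α), f.pol = .all → (∀ f', Step f f' → Derives a (.comp g f')) →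
      Derives a (.comp g f) := by
    intro f
    induction f with
    | letter => intro g hp; cases hp
    | zero => intro g hp; cases hp
    | one => intro g hp; cases hp
    | sup => intro g hp; cases hp
    | diamond => intro g hp; cases hp
    | top => exact fun g _ _ => (Derives.le_top a).trans (.top_le_comp_top g)
    | inf x y =>
      intro g _ h
      exact (Derives.le_inf (h _ (.inf_left x y)) (h _ (.inf_right x y))).trans
        (.comp_inf_distrib g x y)
    | comp k e _ ih =>
      intro g hp h
      refine (ih (.comp g k) hp fun e' he => ?_).trans (.le_assoc g k e)
      exact (h _ (.comp k he)).trans (.assoc_le g k e')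
  refine (key f .one hp fun f' hf => (h f' hf).trans (.le_one_comp f')).trans (.one_comp_le f)

/-- A term that calls an oracle is the composition of its residual with the call. -/
theorem residual_comp_le {t : Term α} {a : α} (hp : t.pol = .oracle a) :
    Derives (.comp t.residual (.letter a)) t := by
  induction t with
  | letter b => cases hp; exact .one_comp_le _
  | zero => cases hp
  | one => cases hp
  | top => cases hp
  | sup => cases hp
  | inf => cases hp
  | diamond => cases hp
  | comp g e _ ih => exact (Derives.le_assoc _ _ _).trans (.comp_mono_right g (ih hp))

end Weih

namespace Weih

variable {α κ : Type*}

/-! ## Threads -/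

/-- Frames of the stack of pending compositions of a goal. A frame `star c G` stems from an
unfolding of `c^⋄`, and is annotated with the contexts in which it has been unfolded. -/
inductive Frame (α κ : Type*) where
  | plain (g : Term α)
  | star (c : Term α) (G : Finset κ)

def Frame.term : Frame α κ → Term α
  | .plain g => g
  | .star c _ => .diamond c

/-- The head of the list is the frame nearest to the running term, that is, the first one to be
resumed. -/
def plug : List (Frame α κ) → Term α → Term α
  | [], d => d
  | fr :: E, d => plug E (.comp fr.term d)

theorem pol_plug (E : List (Frame α κ)) (d : Term α) : (plug E d).pol = d.pol := by
  induction E generalizing d with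
  | nil => rfl
  | cons fr E ih => rw [plug, ih]; rfl

/-- The running term moves on its own unless it is `1`, in which case the top frame may be resumed.
-/
theorem step_plug_iff {E : List (Frame α κ)} {d s : Term α} (hd : d ≠ .one) :
    Step (plug E d) s ↔ ∃ d', Step d d' ∧ s = plug E d' := by
  induction E generalizing d with
  | nil => simp [plug]
  | cons fr E ih =>
    rw [plug, ih (by simp)]
    constructor
    · rintro ⟨d', h, rfl⟩
      cases h with
      | comp_one => exact (hd rfl).elim
      | comp _ h => exact ⟨_, h, rfl⟩
    · rintro ⟨d', h, rfl⟩
      exact ⟨_, .comp _ h, rfl⟩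

theorem Step.plug (E : List (Frame α κ)) {d d' : Term α} (h : Step d d') :
    Step (plug E d) (plug E d') :=
  (step_plug_iff (by rintro rfl; exact step_one h)).2 ⟨d', h, rfl⟩

theorem plug_eq_one {E : List (Frame α κ)} {d : Term α} (h : plug E d = .one) :
    E = [] ∧ d = .one := by
  induction E generalizing d with
  | nil => exact ⟨rfl, h⟩
  | cons fr E ih => cases (ih h).2

/-- The value of `c^⋄` on top of a stack of value `b`, strengthened by the contexts in `G`. -/
noncomputable def guardVal (B : κ → Term α) (b c : Term α) (G : Finset κ) : Term α :=
  .inf (.comp b (.diamond c)) (meet (G.toList.map B))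

theorem guardVal_le {B : κ → Term α} {b c : Term α} {G : Finset κ} {Y : κ} (hY : Y ∈ G) :
    Derives (guardVal B b c G) (B Y) :=
  Derives.le_of_inf_right (meet_le (List.mem_map_of_mem (by simpa using hY)))

theorem le_guardVal {B : κ → Term α} {b c a : Term α} {G : Finset κ}
    (h1 : Derives a (.comp b (.diamond c))) (h2 : ∀ Y ∈ G, Derives a (B Y)) :
    Derives a (guardVal B b c G) := by
  refine Derives.le_inf h1 (le_meet fun x hx => ?_)
  obtain ⟨Y, hY, rfl⟩ := List.mem_map.1 hx
  exact h2 Y (by simpa using hY)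

/-- This is the composition of the frames, except that each `star` frame is strengthened by its
guard. The guard is what the induction rule for the diamond provides as hypothesis. -/
noncomputable def stackVal (B : κ → Term α) : List (Frame α κ) → Term α
  | [] => .one
  | .plain g :: E => .comp (stackVal B E) g
  | .star c G :: E => guardVal B (stackVal B E) c G

/-- The obligations attached to the unfoldings of `c^⋄` in the contexts `G`: they are met by
the first alternative, and by the second one as soon as `G` is properly extended. -/
def Promise [Fintype κ] (B : κ → Term α) (b c : Term α) (G : Finset κ) (a : Term α) : Prop :=
  (∀ Y ∈ G, Derives (.inf a b) (B Y)) ∧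
    -- When more contexts join the guard, the inductive step for the old contexts is needed with the
    -- new guard, and for a left-hand side strengthened in the meantime. The recursion ends because
    -- `κ` is finite.
    ∀ G', G ⊂ G' → ∀ a', Derives a' a → Promise B b c G' a' →
      ∀ Y ∈ G, Derives (.inf a' (.comp (guardVal B b c G') c)) (B Y)
termination_by Fintype.card κ - G.card
decreasing_by
  have h1 := Finset.card_lt_card ‹G ⊂ G'›
  have h2 := Finset.card_le_univ G'
  omega

section

variable [Fintype κ] {B : κ → Term α}

theorem promise_iff {b c : Term α} {G : Finset κ} {a : Term α} :
    Promise B b c G a ↔ (∀ Y ∈ G, Derives (.inf a b) (B Y)) ∧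
    ∀ G', G ⊂ G' → ∀ a', Derives a' a → Promise B b c G' a' →
      ∀ Y ∈ G, Derives (.inf a' (.comp (guardVal B b c G') c)) (B Y) := by
  rw [Promise]

theorem Promise.mono {b c : Term α} {G : Finset κ} {a a' : Term α} (h : Promise B b c G a)
    (ha : Derives a' a) : Promise B b c G a' := by
  rw [promise_iff] at h ⊢
  exact ⟨fun Y hY => (Derives.inf_mono ha (.refl b)).trans (h.1 Y hY),
    fun G' hG a'' ha' => h.2 G' hG a'' (ha'.trans ha)⟩

theorem promise_empty (b c a : Term α) : Promise B b c ∅ a := by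
  rw [promise_iff]
  exact ⟨by simp, by simp⟩

def StackValid (B : κ → Term α) (a : Term α) : List (Frame α κ) → Prop
  | [] => True
  | .plain _ :: E => StackValid B a E
  | .star c G :: E => Promise B (stackVal B E) c G a ∧ StackValid B a E

theorem StackValid.mono {a a' : Term α} {E : List (Frame α κ)} (h : StackValid B a E)
    (ha : Derives a' a) : StackValid B a' E := by
  induction E with
  | nil => trivial
  | cons fr E ih =>
    cases fr with
    | plain g => exact ih h
    | star c G => exact ⟨h.1.mono ha, ih h.2⟩

/-- A goal with its history: `run E d` is the goal `d` on top of the stack `E`, and `ret E c G`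
is the goal `c^⋄` when it has already been unfolded in the contexts `G`. -/
inductive Thread (α κ : Type*) where
  | run (E : List (Frame α κ)) (d : Term α)
  | ret (E : List (Frame α κ)) (c : Term α) (G : Finset κ)

namespace Thread

def term : Thread α κ → Term α
  | .run E d => plug E d
  | .ret E c _ => plug E (.diamond c)

noncomputable def val (B : κ → Term α) : Thread α κ → Term α
  | .run E d => .comp (stackVal B E) d
  | .ret E c G => guardVal B (stackVal B E) c G

def Valid (B : κ → Term α) (a : Term α) : Thread α κ → Prop
  | .run E _ => StackValid B a E
  | .ret E c G => Promise B (stackVal B E) c G a ∧ StackValid B a E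

theorem Valid.mono {a a' : Term α} {τ : Thread α κ} (h : τ.Valid B a) (ha : Derives a' a) :
    τ.Valid B a' := by
  cases τ with
  | run E d => exact StackValid.mono h ha
  | ret E c G => exact ⟨h.1.mono ha, h.2.mono ha⟩

end Thread

end

/-! ## A measure on threads -/

/-- Cost of an iteration with body of cost `m` that has been unfolded in `k` of `N` contexts. Each
new context releases `m + 2`, enough for one more copy of the body; the constant keeps the cost
above that of the goal `1`. -/
def starCost (N m k : ℕ) : ℕ := (N - k) * (m + 2) + 3

theorem starCost_lt {N m k k' : ℕ} (h : k < k') (hN : k' ≤ N) :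
    starCost N m k' + m + 2 ≤ starCost N m k := by
  unfold starCost
  obtain ⟨j, rfl⟩ := Nat.exists_eq_add_of_le hN
  obtain ⟨i, rfl⟩ := Nat.exists_eq_add_of_lt h
  have h1 : k + i + 1 + j - (k + i + 1) = j := by omega
  have h2 : k + i + 1 + j - k = (i + 1 + j) := by omega
  rw [h1, h2]
  nlinarith [Nat.zero_le (i * (m + 2))]

/-- The constants make each treatment of a thread strictly decreasing: a letter is dearer than `1`,
a composition dearer than a frame plus the running term, a fresh iteration dearer than its `ret`
form. -/
def Term.cost (N : ℕ) : Term α → ℕ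
  | .letter _ => 2
  | .zero => 1
  | .one => 1
  | .top => 1
  | .sup e f => e.cost N + f.cost N + 1
  | .inf e f => e.cost N + f.cost N + 1
  | .comp g e => g.cost N + e.cost N + 2
  | .diamond c => starCost N (c.cost N) 0 + 1

def stackCost (N : ℕ) : List (Frame α κ) → ℕ
  | [] => 0
  | .plain g :: E => g.cost N + 1 + stackCost N E
  | .star c G :: E => starCost N (c.cost N) G.card + stackCost N E

def Thread.cost (N : ℕ) : Thread α κ → ℕ
  | .run E d => stackCost N E + d.cost N
  | .ret E c G => stackCost N E + starCost N (c.cost N) G.card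

def weight (N : ℕ) (L : List (Thread α κ)) : ℕ := (L.map fun τ => 3 ^ τ.cost N).sum

open Classical in
/-- Replace the threads of a given term. -/
noncomputable def replace (L : List (Thread α κ)) (t : Term α) (M : List (Thread α κ)) :
    List (Thread α κ) := L.filter (fun τ => τ.term ≠ t) ++ M

theorem mem_replace {L M : List (Thread α κ)} {t : Term α} {τ : Thread α κ} :
    τ ∈ replace L t M ↔ (τ ∈ L ∧ τ.term ≠ t) ∨ τ ∈ M := by
  simp [replace]

/-- At most two threads of smaller cost come in, and `2 * 3 ^ (c - 1) < 3 ^ c`. All threads with the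
same term go at once, because goals form a set and several threads may stand for one goal. -/
theorem weight_replace_lt {N : ℕ} {L M : List (Thread α κ)} {τ : Thread α κ} (hτ : τ ∈ L)
    (hlen : M.length ≤ 2) (hM : ∀ μ ∈ M, μ.cost N < τ.cost N) :
    weight N (replace L τ.term M) < weight N L := by
  classical
  have h1 : weight N M < 3 ^ τ.cost N := by
    have hb : ∀ μ ∈ M, 3 ^ μ.cost N ≤ 3 ^ (τ.cost N - 1) := fun μ hμ =>
      Nat.pow_le_pow_right (by norm_num) (by have := hM μ hμ; omega)
    have h2 : weight N M ≤ M.length * 3 ^ (τ.cost N - 1) := by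
      have := List.sum_le_card_nsmul (M.map fun τ => 3 ^ τ.cost N) (3 ^ (τ.cost N - 1)) (by
        simpa using hb)
      simpa [weight] using this
    cases M with
    | nil => simp [weight]
    | cons μ M =>
      have hc := hM μ (by simp)
      obtain ⟨k, hk⟩ : ∃ k, τ.cost N = k + 1 := ⟨τ.cost N - 1, by omega⟩
      rw [hk] at h2 ⊢
      have h3 : 0 < 3 ^ k := by positivity
      rw [pow_succ]
      simp only [Nat.add_sub_cancel] at h2
      nlinarith
  have h2 : weight N (L.filter fun μ => μ.term ≠ τ.term) + 3 ^ τ.cost N ≤ weight N L := by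
    clear hM hlen h1
    induction L with
    | nil => simp at hτ
    | cons μ L ih =>
      rcases List.mem_cons.1 hτ with rfl | hτ
      · have : weight N (L.filter fun μ => μ.term ≠ τ.term) ≤ weight N L := by
          clear ih hτ
          induction L with
          | nil => simp [weight]
          | cons ν L ih =>
            have hpos : 0 < 3 ^ ν.cost N := by positivity
            by_cases h : ν.term = τ.term
            · simp only [weight, List.map_cons, List.sum_cons] at ih ⊢
              simp [h] at ih ⊢
              omega
            · simp only [weight, List.map_cons, List.sum_cons] at ih ⊢
              simp [h] at ih ⊢
              omega
        simp only [weight, List.map_cons, List.sum_cons] at this ⊢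
        simp at this ⊢
        omega
      · have := ih hτ
        have hpos : 0 < 3 ^ μ.cost N := by positivity
        by_cases h : μ.term = τ.term
        · simp only [weight, List.map_cons, List.sum_cons] at this ⊢
          simp [h] at this ⊢
          omega
        · simp only [weight, List.map_cons, List.sum_cons] at this ⊢
          simp [h] at this ⊢
          omega
  have h3 : weight N (replace L τ.term M) =
      weight N (L.filter fun μ => μ.term ≠ τ.term) + weight N M := by
    simp [weight, replace]
  omega

end Weih

/-! ### Completeness: derivations from winning positions -/

namespace Weih

variable {α κ : Type*}

/-- Threads whose current term is not a composition nor a fresh iteration. -/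
def Thread.Normal : Thread α κ → Prop
  | .run _ (.comp _ _) => False
  | .run _ (.diamond _) => False
  | _ => True

/-- No move of the game is involved: a composition pushes its left factor on the stack, and a fresh
iteration starts with the empty set of contexts, for which the promise is void. -/
theorem Thread.exists_normalize [Fintype κ] {B : κ → Term α} {τ : Thread α κ} (h : ¬ τ.Normal) :
    ∃ μ : Thread α κ, μ.term = τ.term ∧ μ.cost (Fintype.card κ) < τ.cost (Fintype.card κ) ∧
      Derives (τ.val B) (μ.val B) ∧ ∀ a, τ.Valid B a → μ.Valid B a := by
  cases τ with
  | ret E c G => exact (h trivial).elim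
  | run E d =>
    cases d with
    | comp g d =>
      refine ⟨.run (.plain g :: E) d, rfl, ?_, .assoc_le _ _ _, fun a ha => ha⟩
      simp only [Thread.cost, stackCost, Term.cost]
      omega
    | diamond c =>
      refine ⟨.ret E c ∅, rfl, ?_, le_guardVal (.refl _) (by simp), fun a ha =>
        ⟨promise_empty _ _ _, ha⟩⟩
      simp only [Thread.cost, Term.cost, Finset.card_empty]
      omega
    | _ => exact (h trivial).elim

open Classical in
/-- The threads `L` account for all goals of a winning position, and `a` lies below their values.
Then `a` lies below the simulator. -/
theorem derives_of_threads [Fintype κ] {B : κ → Term α} {ctx : κ → Set α × Finset (Term α)}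
    {R : Set (Position α)} (hcl : ∀ p ∈ R, ∀ q, SimMove p q → q ∈ R)
    (hctx : ∀ Γ X f, ⟨Γ, X, f⟩ ∈ R → ⟨Γ, X, f⟩ ∈ (simArena α).Winning → ∃ Y, ctx Y = (Γ, X))
    (hB : ∀ Y f, ⟨(ctx Y).1, (ctx Y).2, f⟩ ∈ R →
      ⟨(ctx Y).1, (ctx Y).2, f⟩ ∈ (simArena α).Winning → Derives (B Y) f)
    (hB' : ∀ Y a, (∀ f, ⟨(ctx Y).1, (ctx Y).2, f⟩ ∈ R →
      ⟨(ctx Y).1, (ctx Y).2, f⟩ ∈ (simArena α).Winning → Derives a f) → Derives a (B Y))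
    (n : ℕ) : ∀ (L : List (Thread α κ)), weight (Fintype.card κ) L < n →
      ∀ (a : Term α) (Γ : Set α) (X : Finset (Term α)) (f : Term α),
      (∀ x, x ∈ X ↔ ∃ τ ∈ L, τ.term = x) → (∀ τ ∈ L, Derives a (τ.val B) ∧ τ.Valid B a) →
      (∀ x ∈ Γ, Derives a (.comp .top (.letter x))) → ⟨Γ, X, f⟩ ∈ R →
      ⟨Γ, X, f⟩ ∈ (simArena α).Winning → Derives a f := by
  induction n with
  | zero => exact fun L h => (Nat.not_lt_zero _ h).elim
  | succ n ih =>
  intro L hL a Γ X f hX ha hΓ hR hwin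
  -- the induction hypothesis for the replacement of a thread
  have step : ∀ τ ∈ L, ∀ M : List (Thread α κ), M.length ≤ 2 →
      (∀ μ ∈ M, μ.cost (Fintype.card κ) < τ.cost (Fintype.card κ)) →
      ∀ (a' : Term α) (Γ' : Set α) (X' : Finset (Term α)) (f' : Term α), Derives a' a →
      (∀ x, x ∈ X' ↔ (x ≠ τ.term ∧ x ∈ X) ∨ ∃ μ ∈ M, μ.term = x) →
      (∀ μ ∈ M, Derives a' (μ.val B) ∧ μ.Valid B a') →
      (∀ x ∈ Γ', Derives a' (.comp .top (.letter x))) → ⟨Γ', X', f'⟩ ∈ R →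
      ⟨Γ', X', f'⟩ ∈ (simArena α).Winning → Derives a' f' := by
    intro τ hτ M hlen hM a' Γ' X' f' ha' hX' hval hΓ' hR' hwin'
    refine ih (replace L τ.term M) ?_ a' Γ' X' f' ?_ ?_ hΓ' hR' hwin'
    · exact (weight_replace_lt hτ hlen hM).trans_le (Nat.lt_succ_iff.1 hL)
    · intro x
      rw [hX', hX]
      constructor
      · rintro (⟨h1, μ, h2, rfl⟩ | ⟨μ, h1, h2⟩)
        · exact ⟨μ, mem_replace.2 (.inl ⟨h2, h1⟩), rfl⟩
        · exact ⟨μ, mem_replace.2 (.inr h1), h2⟩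
      · rintro ⟨μ, h1, rfl⟩
        rcases mem_replace.1 h1 with h1 | h1
        · exact .inl ⟨h1.2, μ, h1.1, rfl⟩
        · exact .inr ⟨μ, h1, rfl⟩
    · intro μ hμ
      rcases mem_replace.1 hμ with h1 | h1
      · exact ⟨ha'.trans (ha μ h1.1).1, (ha μ h1.1).2.mono ha'⟩
      · exact hval μ h1
  by_cases hnorm : ∀ τ ∈ L, τ.Normal
  swap
  · push Not at hnorm
    obtain ⟨τ, hτ, hn⟩ := hnorm
    obtain ⟨μ, h1, h2, h3, h4⟩ := Thread.exists_normalize (B := B) hn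
    refine step τ hτ [μ] (by simp) (by simpa using h2) a Γ X f (.refl a) ?_ ?_ hΓ hR hwin
    · intro x
      have hτX : τ.term ∈ X := (hX _).2 ⟨τ, hτ, rfl⟩
      by_cases hx : x = τ.term
      · subst hx; simp [hτX, h1]
      · simp only [ne_eq, hx, not_false_eq_true, true_and, List.mem_singleton, exists_eq_left, h1]
        exact ⟨.inl, fun h => h.elim id fun h => (hx h.symm).elim⟩
    · intro ν hν
      obtain rfl := List.mem_singleton.1 hν
      exact ⟨(ha τ hτ).1.trans h3, h4 a (ha τ hτ).2⟩
  have hins : ∀ (t t' : Term α) (E : List (Frame α κ)) (d : Term α) (x : Term α),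
      plug E d = t' → (x ∈ insert t' (X.erase t) ↔
        (x ≠ t ∧ x ∈ X) ∨ ∃ μ ∈ [Thread.run E d], μ.term = x) := by
    rintro t t' E d x rfl
    simp only [Finset.mem_insert, Finset.mem_erase, List.mem_singleton, exists_eq_left,
      Thread.term]
    rw [or_comm, eq_comm (a := x)]
  -- Moves that change only the simulator do not decrease the weight, and Duplicator may unfold
  -- iterations there. They are handled by induction on `Prog`; as soon as the goals change, the
  -- induction on the weight takes over.
  have main : ∀ p, (simArena α).Prog (simArena α).Winning p → p.seen = Γ → p.goals = X → p ∈ R →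
      Derives a p.sim := by
    intro p hp
    induction hp with
    | @visit p hpol hw hall =>
      obtain ⟨Γ', X', f⟩ := p
      rintro rfl rfl hR
      dsimp only at hX hΓ hR ⊢
      have hwinf : ⟨Γ', X', f⟩ ∈ (simArena α).Winning :=
        BuchiArena.Prog.winning (.visit hpol hw hall)
      -- Without a decomposable goal, a winning position is either completed, with `1` among the
      -- goals, or has a simulator of polarity `∀` without transitions, which is an empty meet.
      by_cases hst : Stuck X'
      · rcases pol_eq_spoiler_iff.1 hpol with h | ⟨h1, h2⟩ | h
        · exact (h hst).elim
        · obtain ⟨τ, hτ, h⟩ := (hX _).1 h2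
          cases τ with
          | ret E c G => cases (plug_eq_one h).2
          | run E d =>
            obtain ⟨rfl, rfl⟩ := plug_eq_one h
            rw [h1]
            exact (ha _ hτ).1.trans (.comp_one_le _)
        · refine le_of_forall_step h fun f' hf => ?_
          exact (hw.2 ⟨_, .intro h hst hf⟩).elim
      obtain ⟨t, htX, ht1, hact⟩ := not_stuck_iff.1 hst
      obtain ⟨τ, hτ, rfl⟩ := (hX _).1 htX
      -- This is stated for all simulators `f'`, not only `f`, since bounds by `B Y` concern every
      -- simulator that wins in the current context.
      have hexp : ∀ f' t', ⟨Γ', X', f'⟩ ∈ R → ⟨Γ', X', f'⟩ ∈ (simArena α).Winning →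
          τ.term.pol = .ex → Step τ.term t' →
          (⟨Γ', insert t' (X'.erase τ.term), f'⟩ ∈ R ∧
            ⟨Γ', insert t' (X'.erase τ.term), f'⟩ ∈ (simArena α).Winning) := by
        intro f' t' hR' hwin' hpol' hst'
        have hm : SimMove ⟨Γ', X', f'⟩ ⟨Γ', insert t' (X'.erase τ.term), f'⟩ :=
          .explore htX hpol' hst'
        refine ⟨hcl _ hR' _ hm, ?_⟩
        cases BuchiArena.Winning.prog hwin' with
        | visit _ _ h => exact h _ hm
        | spoiler _ h => exact (h (win_of_not_stuck hst)).elim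
        | duplicator h =>
          have h' := pol_of_active (Γ := Γ') (e := f') htX ht1 hact
          change Position.pol _ = _ at h
          rw [h'] at h; cases h
      have haτ := ha τ hτ
      have hΓle : ∀ a', Derives a' a → ∀ x ∈ Γ', Derives a' (.comp .top (.letter x)) :=
        fun a' ha' x hx => ha'.trans (hΓ x hx)
      cases τ with
      | run E d =>
        cases d with
        | letter x =>
          refine (Term.not_active_of_oracle (a := x) ?_ hact).elim
          exact pol_plug E _
        | zero => exact (haτ.1.trans (.comp_zero_le _)).trans (.zero_le f)
        | one =>
          cases E with
          | nil => exact (ht1 rfl).elim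
          | cons fr E =>
            have hs : Step (plug (fr :: E) .one) (plug E fr.term) := Step.plug E (.comp_one _)
            have hR' := hexp f _ hR hwinf (pol_plug _ _) hs
            cases fr with
            | plain g =>
              refine step _ hτ [.run E g] (by simp) ?_ a _ _ f (.refl a)
                (fun x => hins _ _ E g x rfl) ?_ (hΓle a (.refl a)) hR'.1 hR'.2
              · simp only [List.mem_singleton, forall_eq, Thread.cost, stackCost, Term.cost]
                omega
              · rintro μ hμ
                obtain rfl := List.mem_singleton.1 hμ
                exact ⟨haτ.1.trans (.comp_one_le _), haτ.2⟩
            | star c G =>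
              refine step _ hτ [.ret E c G] (by simp) ?_ a _ _ f (.refl a)
                ?_ ?_ (hΓle a (.refl a)) hR'.1 hR'.2
              · simp only [List.mem_singleton, forall_eq, Thread.cost, stackCost, Term.cost]
                omega
              · intro x
                have h := hins (plug (.star c G :: E) .one) _ E (.diamond c) x rfl
                simp only [List.mem_singleton, exists_eq_left] at h ⊢
                exact h
              · rintro μ hμ
                obtain rfl := List.mem_singleton.1 hμ
                exact ⟨haτ.1.trans (.comp_one_le _), haτ.2⟩
        | top =>
          have hm : SimMove ⟨Γ', X', f⟩ ⟨Γ', X'.erase (plug E .top), f⟩ := by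
            refine .fork htX (pol_plug _ _) fun s => ?_
            refine ⟨.inl, fun h => h.elim id fun h => ?_⟩
            obtain ⟨d', h, -⟩ := (step_plug_iff (by simp)).1 h
            cases h
          refine step _ hτ [] (by simp) (by simp) a Γ' _ f (.refl a) ?_ (by simp)
            (hΓle a (.refl a)) (hcl _ hR _ hm) (hall _ hm)
          intro x
          simp [Thread.term]
        | sup x y =>
          have hx := hexp f _ hR hwinf (pol_plug _ _) (Step.plug E (.sup_left x y))
          have hy := hexp f _ hR hwinf (pol_plug _ _) (Step.plug E (.sup_right x y))
          refine Derives.sup_cases (haτ.1.trans (.comp_sup_distrib _ x y)) ?_ ?_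
          · have hle : Derives (.inf a (.comp (stackVal B E) x)) a := .inf_le_left _ _
            refine step _ hτ [.run E x] (by simp) ?_ _ _ _ f hle
              (fun z => hins _ _ E x z rfl) ?_ (hΓle _ hle) hx.1 hx.2
            · simp only [List.mem_singleton, forall_eq, Thread.cost, Term.cost]
              omega
            · rintro μ hμ
              obtain rfl := List.mem_singleton.1 hμ
              exact ⟨.inf_le_right _ _, Thread.Valid.mono (τ := .run E x) haτ.2 hle⟩
          · have hle : Derives (.inf a (.comp (stackVal B E) y)) a := .inf_le_left _ _
            refine step _ hτ [.run E y] (by simp) ?_ _ _ _ f hle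
              (fun z => hins _ _ E y z rfl) ?_ (hΓle _ hle) hy.1 hy.2
            · simp only [List.mem_singleton, forall_eq, Thread.cost, Term.cost]
              omega
            · rintro μ hμ
              obtain rfl := List.mem_singleton.1 hμ
              exact ⟨.inf_le_right _ _, Thread.Valid.mono (τ := .run E y) haτ.2 hle⟩
        | inf x y =>
          have hm : SimMove ⟨Γ', X', f⟩
              ⟨Γ', insert (plug E x) (insert (plug E y) (X'.erase (plug E (.inf x y)))), f⟩ := by
            refine .fork htX (pol_plug _ _) fun s => ?_
            simp only [Thread.term]
            rw [step_plug_iff (by simp), Finset.mem_insert, Finset.mem_insert]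
            constructor
            · rintro (rfl | rfl | h)
              · exact .inr ⟨x, .inf_left x y, rfl⟩
              · exact .inr ⟨y, .inf_right x y, rfl⟩
              · exact .inl h
            · rintro (h | ⟨d', h, rfl⟩)
              · exact .inr (.inr h)
              · cases h
                · exact .inl rfl
                · exact .inr (.inl rfl)
          refine step _ hτ [.run E x, .run E y] (by simp) ?_ a Γ' _ f (.refl a) ?_ ?_
            (hΓle a (.refl a)) (hcl _ hR _ hm) (hall _ hm)
          · simp only [List.mem_cons, List.not_mem_nil, or_false, forall_eq_or_imp, forall_eq,
              Thread.cost, Term.cost]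
            omega
          · intro z
            simp only [Thread.term, Finset.mem_insert, Finset.mem_erase, List.mem_cons,
              List.not_mem_nil, or_false, exists_eq_or_imp, exists_eq_left]
            constructor
            · rintro (rfl | rfl | h)
              · exact .inr (.inl rfl)
              · exact .inr (.inr rfl)
              · exact .inl h
            · rintro (h | rfl | rfl)
              · exact .inr (.inr h)
              · exact .inl rfl
              · exact .inr (.inl rfl)
          · simp only [List.mem_cons, List.not_mem_nil, or_false, forall_eq_or_imp, forall_eq]
            exact ⟨⟨haτ.1.trans (.comp_mono_right _ (.inf_le_left _ _)), haτ.2⟩,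
              haτ.1.trans (.comp_mono_right _ (.inf_le_right _ _)), haτ.2⟩
        | comp g d => exact (hnorm _ hτ).elim
        | diamond c => exact (hnorm _ hτ).elim
      | ret E c G =>
        obtain ⟨Y, hY⟩ := hctx _ _ _ hR hwinf
        have hBf : Derives (B Y) f := hB Y f (by rw [hY]; exact hR) (by rw [hY]; exact hwinf)
        obtain ⟨hle, hprom, hval⟩ := haτ
        change Derives a (guardVal B (stackVal B E) c G) at hle
        -- If the iteration has been unfolded in this context before, the guard contains `B Y ≤ f`
        -- and the branch is closed. Otherwise `Y` is added to the guard and the induction rule is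
        -- applied with the extended guard.
        by_cases hYG : Y ∈ G
        · exact (hle.trans (guardVal_le hYG)).trans hBf
        set b := stackVal B E with hb
        -- Spoiler leaves the iteration: the goal `c^⋄` is replaced by `1` on the same stack.
        have hexit : Derives (.inf a b) (B Y) := by
          refine hB' Y _ fun f' hR' hwin' => ?_
          rw [hY] at hR' hwin'
          have hR'' := hexp f' (plug E .one) hR' hwin' (pol_plug _ _)
            (Step.plug E (.diamond_one c))
          have hle' : Derives (.inf a b) a := .inf_le_left _ _
          refine step _ hτ [.run E .one] (by simp) ?_ _ _ _ f' hle'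
            (fun z => hins _ _ E _ z rfl) ?_ (hΓle _ hle') hR''.1 hR''.2
          · simp only [List.mem_singleton, forall_eq, Thread.cost, Term.cost, starCost]
            omega
          · rintro μ hμ
            obtain rfl := List.mem_singleton.1 hμ
            exact ⟨(Derives.inf_le_right _ _).trans (.le_comp_one _), hval.mono hle'⟩
        -- Spoiler unfolds once more: `c` runs on top of a `star` frame that remembers the larger
        -- set `G'`, whose cost is lower by `starCost_lt`.
        have hunfold : ∀ G', G ⊂ G' → ∀ a', Derives a' a → Promise B b c G' a' →
            Derives (.inf a' (.comp (guardVal B b c G') c)) (B Y) := by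
          intro G' hG a' ha' hp
          refine hB' Y _ fun f' hR' hwin' => ?_
          rw [hY] at hR' hwin'
          have hR'' := hexp f' (plug E (.comp (.diamond c) c)) hR' hwin' (pol_plug _ _)
            (Step.plug E (.diamond_unfold c))
          have hle' : Derives (.inf a' (.comp (guardVal B b c G') c)) a' := .inf_le_left _ _
          refine step _ hτ [.run (.star c G' :: E) c] (by simp) ?_ _ _ _ f' (hle'.trans ha')
            (fun z => hins _ _ (.star c G' :: E) c z rfl) ?_ (hΓle _ (hle'.trans ha')) hR''.1 hR''.2
          · have := starCost_lt (m := c.cost (Fintype.card κ)) (Finset.card_lt_card hG)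
              (Finset.card_le_univ G')
            simp only [List.mem_singleton, forall_eq, Thread.cost, stackCost]
            omega
          · rintro μ hμ
            obtain rfl := List.mem_singleton.1 hμ
            exact ⟨.inf_le_right _ _, hp.mono hle', hval.mono (hle'.trans ha')⟩
        rw [promise_iff] at hprom
        have hss : G ⊂ insert Y G := Finset.ssubset_insert hYG
        have hprom' : Promise B b c (insert Y G) a := by
          rw [promise_iff]
          refine ⟨fun Z hZ => ?_, fun G' hG a' ha' hp Z hZ => ?_⟩
          · rcases Finset.mem_insert.1 hZ with rfl | hZ
            · exact hexit
            · exact hprom.1 Z hZ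
          · rcases Finset.mem_insert.1 hZ with rfl | hZ
            · exact hunfold G' (hss.trans hG) a' ha' hp
            · exact hprom.2 G' (hss.trans hG) a' ha' hp Z hZ
        -- The extended guard is preserved by one more `c`: for `Y` by `hunfold`, for older contexts
        -- by the promise carried by the thread.
        have hind : Derives (.inf a (.comp (guardVal B b c (insert Y G)) c))
            (guardVal B b c (insert Y G)) := by
          refine le_guardVal ?_ fun Z hZ => ?_
          · refine Derives.le_of_inf_right ?_
            refine (Derives.comp_mono_left c (.inf_le_left _ _)).trans ?_
            exact (Derives.le_assoc _ _ _).trans (.comp_mono_right _ (.diamond_comp_le c))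
          · rcases Finset.mem_insert.1 hZ with rfl | hZ
            · exact hunfold _ hss a (.refl a) hprom'
            · exact hprom.2 _ hss a (.refl a) hprom' Z hZ
        have hbase : Derives (.inf b a) (guardVal B b c (insert Y G)) := by
          refine le_guardVal ?_ fun Z hZ => ?_
          · refine Derives.le_of_inf_left ?_
            exact (Derives.le_comp_one b).trans (.comp_mono_right _ (.one_le_diamond c))
          · refine (Derives.le_inf (.inf_le_right _ _) (.inf_le_left _ _)).trans ?_
            exact (promise_iff.1 hprom').1 Z hZ
        have h1 : Derives a (.comp b (.diamond c)) := hle.trans (.inf_le_left _ _)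
        -- Half distributivity moves `a` under the iteration, where `hbase` puts `b ⊓ a` below the
        -- guard; the induction rule then contracts the guard followed by `c^⋄`.
        have h2 : Derives a (.comp (guardVal B b c (insert Y G)) (.diamond c)) :=
          ((Derives.le_inf h1 (.refl a)).trans (.half_distrib _ _ _)).trans
            (.comp_mono_left _ hbase)
        have h3 := (Derives.le_inf (.refl a) h2).trans (.diamond_induction hind)
        exact (h3.trans (guardVal_le (Finset.mem_insert_self Y G))).trans hBf
    | @spoiler p hpol hw _ hall ih' =>
      obtain ⟨Γ', X', f⟩ := p
      rintro rfl rfl hR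
      have halea : ∃ q, AleaMove ⟨Γ', X', f⟩ q := by
        by_contra h
        exact hw ⟨hpol, h⟩
      obtain ⟨q, h⟩ := halea
      cases h with
      | intro hf hst _ =>
        refine le_of_forall_step hf fun f' hf' => ?_
        have hm : SimMove ⟨Γ', X', f⟩ ⟨Γ', X', f'⟩ := .alea (.intro hf hst hf')
        exact ih' _ hm rfl rfl (hcl _ hR _ hm)
    | @duplicator p q hpol hm hq ih' =>
      obtain ⟨Γ', X', f⟩ := p
      rintro rfl rfl hR
      obtain ⟨hst, -, hall⟩ := pol_eq_duplicator_iff.1 hpol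
      have hRq := hcl _ hR _ hm
      cases hm with
      | explore ht hp hs =>
        obtain rfl := hst _ ht (.inl hp)
        exact (step_one hs).elim
      | fork ht hp _ =>
        obtain rfl := hst _ ht (.inr hp)
        cases hp
      | alea h =>
        cases h with
        | intro h _ _ => exact (hall h).elim
      | choose _ hp hs => exact (ih' rfl rfl hRq).trans (hs.le_of_ex hp)
      | @junk _ _ _ e' x _ hp hx hs =>
        have h1 := ih' rfl rfl hRq
        obtain rfl := (step_iff_residual hp).1 hs
        -- A letter seen before is available as `⊤ ⋆ x` above `a`. Half distributivity yields `(⊤ ⊓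
        -- a) ⋆ x`, and the continuation only needs `a`.
        refine Derives.trans ?_ (residual_comp_le hp)
        refine (Derives.le_inf (hΓ x hx) (.refl a)).trans ?_
        refine (Derives.half_distrib _ _ _).trans (.comp_mono_left _ ?_)
        exact (Derives.inf_le_right _ _).trans h1
      | @fill _ _ _ e' t t' x _ ht hp htp hs hst' =>
        obtain rfl := (step_iff_residual hp).1 hs
        refine Derives.trans ?_ (residual_comp_le hp)
        obtain ⟨τ, hτ, rfl⟩ := (hX _).1 ht
        have hn := hnorm τ hτ
        cases τ with
        | ret E c G =>
          rw [Thread.term, pol_plug] at htp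
          cases htp
        | run E d =>
          rw [Thread.term, pol_plug] at htp
          cases d with
          | letter y =>
            cases htp
            have haτ := ha _ hτ
            -- The call of the goal serves as the call of the simulator: half distributivity puts
            -- `a` next to the stack before the letter, so what is known about the other threads
            -- survives the call.
            refine (Derives.le_inf haτ.1 (.refl a)).trans ?_
            refine (Derives.half_distrib _ _ _).trans (.comp_mono_left _ ?_)
            have hle : Derives (.inf (stackVal B E) a) a := .inf_le_right _ _
            have ht' : plug E .one = t' := by
              obtain ⟨d', hd', rfl⟩ := (step_plug_iff (by simp)).1 hst'
              cases hd'
              rfl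
            refine step _ hτ [.run E .one] (by simp) ?_ _ _ _ _ hle
              (fun z => hins _ _ E _ z ht') ?_ ?_ hRq (BuchiArena.Prog.winning hq)
            · simp only [List.mem_singleton, forall_eq, Thread.cost, Term.cost]
              omega
            · rintro μ hμ
              obtain rfl := List.mem_singleton.1 hμ
              exact ⟨(Derives.inf_le_left _ _).trans (.le_comp_one _),
                StackValid.mono haτ.2 hle⟩
            · intro z hz
              refine hle.trans ?_
              rcases Set.mem_insert_iff.1 hz with rfl | hz
              · exact haτ.1.trans (.comp_mono_left _ (.le_top _))
              · exact hΓ z hz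
          | comp g d => exact hn.elim
          | diamond c => exact hn.elim
          | _ => cases htp
  exact main _ (BuchiArena.Winning.prog hwin) rfl rfl hR

/-- The axioms derive all inequations for which Duplicator wins the simulation game. -/
theorem Derives.of_winning [Finite α] {e f : Term α}
    (h : ⟨∅, {e}, f⟩ ∈ (simArena α).Winning) : Derives e f := by
  classical
  let R := reachPos e f
  have hfin : (R ∩ (simArena α).Winning).Finite := (reachPos_finite e f).inter_of_left _
  -- Contexts are the pairs `(Γ, X)` of reachable winning positions. The list `l Y` collects all
  -- simulators that win in the context `Y`, and `B Y` is its meet.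
  let C : Finset (Set α × Finset (Term α)) := hfin.toFinset.image fun p => (p.seen, p.goals)
  let l : C → List (Term α) := fun Y =>
    (hfin.toFinset.filter fun p => (p.seen, p.goals) = Y.1).toList.map Position.sim
  have hl : ∀ (Y : C) (f' : Term α), f' ∈ l Y ↔
      ⟨Y.1.1, Y.1.2, f'⟩ ∈ R ∧ ⟨Y.1.1, Y.1.2, f'⟩ ∈ (simArena α).Winning := by
    intro Y f'
    simp only [l, List.mem_map, Finset.mem_toList, Finset.mem_filter, Set.Finite.mem_toFinset]
    constructor
    · rintro ⟨p, ⟨hp, h1⟩, rfl⟩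
      rw [← h1]
      exact hp
    · exact fun h => ⟨_, ⟨h, rfl⟩, rfl⟩
  have hR : ⟨∅, {e}, f⟩ ∈ R := ⟨by simpa using e.mem_reach_self, f.mem_reach_self⟩
  refine derives_of_threads (κ := C) (B := fun Y => meet (l Y)) (ctx := fun Y => Y.1) (R := R)
    (fun p hp q => reachPos_move hp) ?_ ?_ ?_ _ [.run [] e] (Nat.lt_succ_self _) e ∅ {e} f ?_ ?_
    (by simp) hR h
  · intro Γ X f' h1 h2
    exact ⟨⟨(Γ, X), Finset.mem_image.2 ⟨⟨Γ, X, f'⟩, hfin.mem_toFinset.2 ⟨h1, h2⟩, rfl⟩⟩, rfl⟩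
  · exact fun Y f' h1 h2 => meet_le ((hl Y f').2 ⟨h1, h2⟩)
  · exact fun Y a ha => le_meet fun f' hf' => ha f' ((hl Y f').1 hf').1 ((hl Y f').1 hf').2
  · intro x
    simp [Thread.term, plug, eq_comm]
  · intro τ hτ
    obtain rfl := List.mem_singleton.1 hτ
    exact ⟨.le_one_comp e, trivial⟩

end Weih

namespace Weih

/-! ## Effective functionals on Baire space -/

/-- The first `k` values of `p`. -/
def initSeg (p : Baire) (k : ℕ) : List ℕ := (List.range k).map p

@[simp] theorem length_initSeg (p : Baire) (k : ℕ) : (initSeg p k).length = k := by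
  simp [initSeg]

theorem getElem?_initSeg {p : Baire} {k i : ℕ} (h : i < k) : (initSeg p k)[i]? = some (p i) := by
  simp [initSeg, h]

theorem getD_initSeg {p : Baire} {k i : ℕ} (h : i < k) : (initSeg p k).getD i 0 = p i := by
  rw [List.getD_eq_getElem?_getD, getElem?_initSeg h]
  rfl

theorem take_initSeg {p : Baire} {k i : ℕ} (h : i ≤ k) : (initSeg p k).take i = initSeg p i := by
  simp [initSeg, ← List.map_take, List.take_range, Nat.min_eq_left h]

theorem initSeg_congr {p q : Baire} {k : ℕ} (h : ∀ i < k, p i = q i) :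
    initSeg p k = initSeg q k := by
  apply List.map_congr_left
  simpa using h

theorem initSeg_prefix {p : Baire} {k k' : ℕ} (h : k ≤ k') : initSeg p k <+: initSeg p k' := by
  rw [← take_initSeg h]
  exact List.take_prefix _ _

/-- The first non-zero value of `T` below a bound, if there is one. -/
def search (T : ℕ → ℕ) : ℕ → ℕ
  | 0 => 0
  | k + 1 => Nat.casesOn (search T k) (T k) Nat.succ

theorem search_eq_succ_iff {T : ℕ → ℕ} {K r : ℕ} :
    search T K = r + 1 ↔ ∃ k < K, T k = r + 1 ∧ ∀ j < k, T j = 0 := by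
  have hzero : ∀ K, search T K = 0 ↔ ∀ k < K, T k = 0 := by
    intro K
    induction K with
    | zero => simp [search]
    | succ K ih =>
      rw [search]
      cases h : search T K with
      | zero =>
        have := ih.1 h
        simp only
        constructor
        · intro hK k hk
          rcases Nat.lt_succ_iff_lt_or_eq.1 hk with hk | rfl
          · exact this k hk
          · exact hK
        · exact fun h => h K (Nat.lt_succ_self K)
      | succ r =>
        simp only [Nat.succ_ne_zero, false_iff]
        intro hall
        rw [ih.2 fun k hk => hall k (hk.trans (Nat.lt_succ_self K))] at h
        cases h
  induction K with
  | zero => simp [search]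
  | succ K ih =>
    rw [search]
    cases h : search T K with
    | zero =>
      have hz := (hzero K).1 h
      simp only
      constructor
      · exact fun hK => ⟨K, Nat.lt_succ_self K, hK, hz⟩
      · rintro ⟨k, hk, h1, -⟩
        rcases Nat.lt_succ_iff_lt_or_eq.1 hk with hk | rfl
        · rw [hz k hk] at h1; cases h1
        · exact h1
    | succ s =>
      rw [h] at ih
      refine Iff.trans ih ?_
      constructor
      · rintro ⟨k, hk, h1⟩
        exact ⟨k, hk.trans (Nat.lt_succ_self K), h1⟩
      · rintro ⟨k, hk, h1, h2⟩
        rcases Nat.lt_succ_iff_lt_or_eq.1 hk with hk | rfl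
        · exact ⟨k, hk, h1, h2⟩
        · rw [(hzero k).2 h2] at h
          cases h

theorem computable_search {β : Type*} [Primcodable β] {T : β → ℕ → ℕ} {K : β → ℕ}
    (hT : Computable₂ T) (hK : Computable K) : Computable fun x => search (T x) (K x) := by
  have : Computable fun x => (Nat.rec 0 (fun k s => Nat.casesOn s (T x k) Nat.succ) (K x) : ℕ) := by
    refine Computable.nat_rec (h := fun x (ks : ℕ × ℕ) => Nat.casesOn ks.2 (T x ks.1) Nat.succ)
      hK (Computable.const 0) ?_
    refine Computable.nat_casesOn (Computable.snd.comp Computable.snd) ?_ ?_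
    · exact hT.comp Computable.fst (Computable.fst.comp Computable.snd)
    · exact Computable.succ.comp Computable.snd
  refine this.of_eq fun x => ?_
  generalize K x = k
  induction k with
  | zero => rfl
  | succ k ih => rw [search, ← ih]

/-- A result `r` is represented by `r + 2` and failure by `1`. -/
def found (s : ℕ) : Option ℕ := Nat.casesOn s none fun s => Nat.casesOn s none some

theorem found_eq_some {s r : ℕ} : found s = some r ↔ s = r + 1 + 1 := by
  rcases s with _ | _ | s <;> simp [found]

theorem computable_found : Computable found := by
  refine Computable.nat_casesOn Computable.id (Computable.const none) ?_
  refine Computable.nat_casesOn Computable.snd (Computable.const none) ?_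
  exact Computable.option_some.comp Computable.snd

/-- Approximations are monotone in the known part of the argument. -/
def MonoApprox (A : ℕ → List ℕ → Option ℕ) : Prop :=
  ∀ n l l' m, l <+: l' → A n l = some m → A n l' = some m

/-- `v` is the limit of the approximations `A` at `p`. -/
def Approximates (A : ℕ → List ℕ → Option ℕ) (p v : Baire) : Prop :=
  ∀ n, ∃ k, A n (initSeg p k) = some (v n)

theorem mem_app_iff {c p v : Baire} : v ∈ app c p ↔
    ∀ n, ∃ k, c (prefixCode n p k) = v n + 1 ∧ ∀ j < k, c (prefixCode n p j) = 0 := by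
  constructor
  · rintro ⟨h, rfl⟩ n
    refine ⟨Nat.find (h n), ?_, fun j hj => by simpa using Nat.find_min (h n) hj⟩
    have := Nat.find_spec (h n)
    change _ = c (prefixCode n p (Nat.find (h n))) - 1 + 1
    omega
  · intro h
    have hd : ∀ n, ∃ k, c (prefixCode n p k) ≠ 0 := fun n => by
      obtain ⟨k, hk, -⟩ := h n
      exact ⟨k, by omega⟩
    refine ⟨hd, funext fun n => ?_⟩
    obtain ⟨k, hk, hj⟩ := h n
    have : Nat.find (hd n) = k := by
      rw [Nat.find_eq_iff]
      exact ⟨by omega, fun j hjk => by simpa using hj j hjk⟩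
    change c (prefixCode n p (Nat.find (hd n))) - 1 = v n
    rw [this, hk]
    rfl

/-- The test at stage `k` for the value of `c · p` at `n`. -/
def codeTest (c : Baire) (n : ℕ) (l : List ℕ) (k : ℕ) : ℕ :=
  Nat.casesOn (c (Encodable.encode (n :: l.take k))) 0 fun r => r + 2

/-- The approximations given by a code. -/
def codeApprox (c : Baire) (n : ℕ) (l : List ℕ) : Option ℕ :=
  found (search (codeTest c n l) (l.length + 1))

theorem codeApprox_eq_some {c : Baire} {n : ℕ} {l : List ℕ} {m : ℕ} :
    codeApprox c n l = some m ↔ ∃ k ≤ l.length, c (Encodable.encode (n :: l.take k)) = m + 1 ∧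
      ∀ j < k, c (Encodable.encode (n :: l.take j)) = 0 := by
  have h0 : ∀ k, codeTest c n l k = 0 ↔ c (Encodable.encode (n :: l.take k)) = 0 := by
    intro k
    unfold codeTest
    cases c (Encodable.encode (n :: l.take k)) <;> simp
  have h1 : ∀ k, codeTest c n l k = m + 1 + 1 ↔
      c (Encodable.encode (n :: l.take k)) = m + 1 := by
    intro k
    unfold codeTest
    cases c (Encodable.encode (n :: l.take k)) <;> simp
  rw [codeApprox, found_eq_some, search_eq_succ_iff]
  simp only [h0, h1, Nat.lt_succ_iff]

theorem monoApprox_code (c : Baire) : MonoApprox (codeApprox c) := by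
  intro n l l' m hl h
  rw [codeApprox_eq_some] at h ⊢
  obtain ⟨k, hk, h1, h2⟩ := h
  have htake : ∀ j ≤ k, l'.take j = l.take j := by
    intro j hj
    obtain ⟨r, rfl⟩ := hl
    rw [List.take_append_of_le_length (hj.trans hk)]
  refine ⟨k, hk.trans hl.length_le, by rw [htake k le_rfl]; exact h1, fun j hj => ?_⟩
  rw [htake j hj.le]
  exact h2 j hj

theorem mem_app_iff_approximates {c p v : Baire} :
    v ∈ app c p ↔ Approximates (codeApprox c) p v := by
  rw [mem_app_iff]
  refine forall_congr' fun n => ?_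
  constructor
  · rintro ⟨k, h1, h2⟩
    refine ⟨k, codeApprox_eq_some.2 ⟨k, by simp, ?_, fun j hj => ?_⟩⟩
    · rw [take_initSeg le_rfl]; exact h1
    · rw [take_initSeg hj.le]; exact h2 j hj
  · rintro ⟨K, h⟩
    obtain ⟨k, hk, h1, h2⟩ := codeApprox_eq_some.1 h
    rw [length_initSeg] at hk
    refine ⟨k, ?_, fun j hj => ?_⟩
    · rw [take_initSeg hk] at h1; exact h1
    · have := h2 j hj
      rw [take_initSeg (hj.le.trans hk)] at this
      exact this

theorem computable_codeApprox_of {β : Type*} [Primcodable β] {c : β → ℕ → ℕ} {n : β → ℕ}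
    {l : β → List ℕ} (hc : Computable₂ c) (hn : Computable n) (hl : Computable l) :
    Computable fun x => codeApprox (c x) (n x) (l x) := by
  refine computable_found.comp (computable_search (T := fun x => codeTest (c x) (n x) (l x)) ?_ ?_)
  · refine Computable.nat_casesOn ?_ (Computable.const 0)
      (Computable.succ.comp (Computable.succ.comp Computable.snd))
    refine hc.comp Computable.fst (Computable.encode.comp (Computable.list_cons.comp
      (hn.comp Computable.fst) ?_))
    exact (Primrec.list_take.to_comp).comp Computable.snd (hl.comp Computable.fst)
  · exact Computable.succ.comp (Computable.list_length.comp hl)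

theorem computable_codeApprox {c : Baire} (hc : Computable c) :
    Computable₂ (codeApprox c) :=
  computable_codeApprox_of (c := fun _ : ℕ × List ℕ => c) (hc.comp Computable.snd).to₂
    Computable.fst Computable.snd

/-- The code of a family of approximations. -/
def codeOf (A : ℕ → List ℕ → Option ℕ) (i : ℕ) : ℕ :=
  match (Encodable.decode i : Option (List ℕ)) with
  | some (n :: l) => Option.casesOn (A n l) 0 Nat.succ
  | _ => 0

theorem codeOf_encode (A : ℕ → List ℕ → Option ℕ) (n : ℕ) (l : List ℕ) :
    codeOf A (Encodable.encode (n :: l)) = Option.casesOn (A n l) 0 Nat.succ := by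
  rw [codeOf, Encodable.encodek]

/-- Application reads off the first stage with an answer; by monotonicity this answer agrees with
the limit. -/
theorem mem_app_codeOf {A : ℕ → List ℕ → Option ℕ} (hA : MonoApprox A) {p v : Baire}
    (h : Approximates A p v) : v ∈ app (codeOf A) p := by
  classical
  rw [mem_app_iff]
  intro n
  have hex : ∃ k, (A n (initSeg p k)).isSome := by
    obtain ⟨k, hk⟩ := h n
    exact ⟨k, by rw [hk]; rfl⟩
  refine ⟨Nat.find hex, ?_, fun j hj => ?_⟩
  · obtain ⟨k, hk⟩ := h n
    have hle : Nat.find hex ≤ k := Nat.find_min' hex (by rw [hk]; rfl)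
    obtain ⟨m, hm⟩ := Option.isSome_iff_exists.1 (Nat.find_spec hex)
    have := hA n _ _ m (initSeg_prefix hle) hm
    rw [hk] at this
    obtain rfl : v n = m := by simpa using this
    change codeOf A (Encodable.encode (n :: initSeg p _)) = _
    rw [codeOf_encode, hm]
  · change codeOf A (Encodable.encode (n :: initSeg p _)) = _
    rw [codeOf_encode]
    have := Nat.find_min hex hj
    rw [Option.not_isSome_iff_eq_none] at this
    rw [this]

theorem computable_codeOf_of {β : Type*} [Primcodable β] {A : β → ℕ → List ℕ → Option ℕ}
    {i : β → ℕ} (hA : Computable fun x : β × ℕ × List ℕ => A x.1 x.2.1 x.2.2)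
    (hi : Computable i) : Computable fun x => codeOf (A x) (i x) := by
  have : Computable fun x : β => (Option.casesOn (Encodable.decode (i x) : Option (List ℕ)) 0
      fun L => Option.casesOn L[0]? 0 fun n => Option.casesOn (A x n L.tail) 0 Nat.succ : ℕ) := by
    refine Computable.option_casesOn (Computable.decode.comp hi) (Computable.const 0) ?_
    refine Computable.option_casesOn
      (Computable.list_getElem?.comp Computable.snd (Computable.const 0)) (Computable.const 0) ?_
    refine Computable.option_casesOn ?_ (Computable.const 0) (Computable.succ.comp Computable.snd)
    refine hA.comp (Computable.pair (Computable.fst.comp Computable.fst)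
      (Computable.pair Computable.snd ?_))
    exact (Primrec.list_tail.to_comp).comp (Computable.snd.comp Computable.fst)
  refine this.of_eq fun x => ?_
  unfold codeOf
  rcases (Encodable.decode (i x) : Option (List ℕ)) with _ | (_ | ⟨n, l⟩) <;> rfl

theorem computable_codeOf {A : ℕ → List ℕ → Option ℕ} (hA : Computable₂ A) :
    Computable (codeOf A) :=
  computable_codeOf_of (A := fun _ : ℕ => A) (i := id)
    (hA.comp (Computable.fst.comp Computable.snd) (Computable.snd.comp Computable.snd)) Computable.id

/-- Functionals that are realised by a computable code. -/
def Eff (F : Baire → Part Baire) : Prop :=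
  ∃ c : Baire, Computable c ∧ ∀ p, ∀ v ∈ F p, v ∈ app c p

theorem Eff.of_approx {F : Baire → Part Baire} (A : ℕ → List ℕ → Option ℕ) (hA : Computable₂ A)
    (hm : MonoApprox A) (h : ∀ p, ∀ v ∈ F p, Approximates A p v) : Eff F :=
  ⟨codeOf A, computable_codeOf hA, fun p v hv => mem_app_codeOf hm (h p v hv)⟩

theorem Eff.exists_approx {F : Baire → Part Baire} (h : Eff F) :
    ∃ A : ℕ → List ℕ → Option ℕ, Computable₂ A ∧ MonoApprox A ∧
      ∀ p, ∀ v ∈ F p, Approximates A p v := by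
  obtain ⟨c, hc, h⟩ := h
  exact ⟨codeApprox c, computable_codeApprox hc, monoApprox_code c, fun p v hv =>
    mem_app_iff_approximates.1 (h p v hv)⟩

theorem Eff.of_code {c : Baire} (hc : Computable c) : Eff fun p => app c p :=
  ⟨c, hc, fun _ _ h => h⟩

theorem Eff.mono {F G : Baire → Part Baire} (hG : Eff G) (h : ∀ p, ∀ v ∈ F p, v ∈ G p) :
    Eff F := by
  obtain ⟨c, hc, hc'⟩ := hG
  exact ⟨c, hc, fun p v hv => hc' p v (h p v hv)⟩

/-- Total functionals with a computable modulus of continuity. -/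
theorem Eff.of_modulus {F : Baire → Baire} {h : ℕ → ℕ} {g : ℕ → List ℕ → ℕ} (hh : Computable h)
    (hg : Computable₂ g) (hF : ∀ p n, F p n = g n (initSeg p (h n))) :
    Eff fun p => Part.some (F p) := by
  refine Eff.of_approx (fun n l => bif h n ≤ l.length then some (g n (l.take (h n))) else none)
    ?_ ?_ ?_
  · refine Computable.cond ?_ (Computable.option_some.comp ?_) (Computable.const none)
    · exact (Primrec.nat_le.decide.to_comp).comp (hh.comp Computable.fst)
        (Computable.list_length.comp Computable.snd)
    · exact hg.comp Computable.fst
        ((Primrec.list_take.to_comp).comp (hh.comp Computable.fst) Computable.snd)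
  · rintro n l l' m ⟨r, rfl⟩ hm
    by_cases hle : h n ≤ l.length
    · have hle' : h n ≤ l.length + r.length := by omega
      simp only [hle, decide_true, cond_true, List.length_append, hle'] at hm ⊢
      rwa [List.take_append_of_le_length hle]
    · simp [hle] at hm
  · intro p v hv n
    obtain rfl := Part.mem_some_iff.1 hv
    exact ⟨h n, by simp [hF, take_initSeg]⟩

theorem Eff.id : Eff fun p => Part.some p := by
  refine Eff.of_modulus (h := Nat.succ) (g := fun n l => l.getD n 0) Computable.succ
    ((Primrec.list_getD 0).to_comp.comp Computable.snd Computable.fst) fun p n => ?_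
  rw [getD_initSeg (Nat.lt_succ_self n)]

theorem Eff.const {v : Baire} (hv : Computable v) : Eff fun _ => Part.some v :=
  Eff.of_modulus (h := fun _ => 0) (g := fun n _ => v n) (Computable.const 0)
    (hv.comp Computable.fst) fun _ _ => rfl

/-- Projections of pairs. -/
def fst (p : Baire) : Baire := fun n => p (2 * n + 1)

def snd (p : Baire) : Baire := fun n => p (2 * n + 2)

/-- Removal of the tag of a tagged union. -/
def tail (p : Baire) : Baire := fun n => p (n + 1)

@[simp] theorem pair_zero (p q : Baire) : pair p q 0 = 2 := rfl

@[simp] theorem fst_pair (p q : Baire) : fst (pair p q) = p := by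
  funext n
  simp [fst, pair, cons]

@[simp] theorem snd_pair (p q : Baire) : snd (pair p q) = q := by
  funext n
  have h1 : (2 * n + 1) % 2 = 1 := by omega
  have h2 : (2 * n + 1) / 2 = n := by omega
  simp [snd, pair, cons, h1, h2]

theorem pair_inj {p q p' q' : Baire} : pair p q = pair p' q' ↔ p = p' ∧ q = q' := by
  constructor
  · intro h
    exact ⟨by rw [← fst_pair p q, h, fst_pair], by rw [← snd_pair p q, h, snd_pair]⟩
  · rintro ⟨rfl, rfl⟩; rfl

@[simp] theorem tail_in₁ (p : Baire) : tail (in₁ p) = p := rfl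

@[simp] theorem tail_in₂ (p : Baire) : tail (in₂ p) = p := rfl

@[simp] theorem in₁_zero (p : Baire) : in₁ p 0 = 0 := rfl

@[simp] theorem in₂_zero (p : Baire) : in₂ p 0 = 1 := rfl

theorem in₁_inj {p q : Baire} : in₁ p = in₁ q ↔ p = q :=
  ⟨fun h => by rw [← tail_in₁ p, h, tail_in₁], fun h => by rw [h]⟩

theorem in₂_inj {p q : Baire} : in₂ p = in₂ q ↔ p = q :=
  ⟨fun h => by rw [← tail_in₂ p, h, tail_in₂], fun h => by rw [h]⟩

theorem in₁_ne_in₂ {p q : Baire} : in₁ p ≠ in₂ q := fun h => by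
  have := congrFun h 0
  simp at this

theorem pair_ne_unitElt {p q : Baire} : pair p q ≠ unitElt := fun h => by
  have := congrFun h 0
  simp [unitElt] at this

theorem primrec_double_add (k : ℕ) : Primrec fun n : ℕ => 2 * n + k :=
  Primrec.nat_add.comp (Primrec.nat_mul.comp (Primrec.const 2) Primrec.id) (Primrec.const k)

theorem Eff.fst_id : Eff fun p => Part.some (fst p) := by
  refine Eff.of_modulus (h := fun n => 2 * n + 2) (g := fun n l => l.getD (2 * n + 1) 0)
    (primrec_double_add 2).to_comp ?_ fun p n => ?_
  · exact (Primrec.list_getD 0).to_comp.comp Computable.snd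
      ((primrec_double_add 1).to_comp.comp Computable.fst)
  · rw [getD_initSeg (by omega), fst]

theorem Eff.snd_id : Eff fun p => Part.some (snd p) := by
  refine Eff.of_modulus (h := fun n => 2 * n + 3) (g := fun n l => l.getD (2 * n + 2) 0)
    (primrec_double_add 3).to_comp ?_ fun p n => ?_
  · exact (Primrec.list_getD 0).to_comp.comp Computable.snd
      ((primrec_double_add 2).to_comp.comp Computable.fst)
  · rw [getD_initSeg (by omega), snd]

theorem Eff.tail_id : Eff fun p => Part.some (tail p) := by
  refine Eff.of_modulus (h := fun n => n + 2) (g := fun n l => l.getD (n + 1) 0)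
    (Computable.succ.comp Computable.succ) ?_ fun p n => ?_
  · exact (Primrec.list_getD 0).to_comp.comp Computable.snd (Computable.succ.comp Computable.fst)
  · rw [getD_initSeg (by omega), tail]

theorem Eff.cons_id (k : ℕ) : Eff fun p => Part.some (cons k p) := by
  refine Eff.of_modulus (h := fun n => n) (g := fun n l => Nat.casesOn n k fun m => l.getD m 0)
    Computable.id ?_ fun p n => ?_
  · refine Computable.nat_casesOn Computable.fst (Computable.const k) ?_
    exact (Primrec.list_getD 0).to_comp.comp (Computable.snd.comp Computable.fst) Computable.snd
  · cases n with
    | zero => rfl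
    | succ n => simp only [cons]; rw [getD_initSeg (by omega)]

end Weih

namespace Weih

/-! ## Closure properties of effective functionals -/

/-- The initial segment, of length at most `k`, of the output of the approximations `A` on the
input `l`. -/
def outs (A : ℕ → List ℕ → Option ℕ) (l : List ℕ) : ℕ → List ℕ
  | 0 => []
  | k + 1 => Option.casesOn (A (outs A l k).length l) (outs A l k) fun m => outs A l k ++ [m]

theorem computable_outs {A : ℕ → List ℕ → Option ℕ} (hA : Computable₂ A) :
    Computable fun l : List ℕ => outs A l l.length := by
  have : Computable fun l : List ℕ => (Nat.rec []
      (fun _ s => Option.casesOn (A s.length l) s fun m => s ++ [m]) l.length : List ℕ) := by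
    refine Computable.nat_rec (h := fun (l : List ℕ) (ks : ℕ × List ℕ) =>
      Option.casesOn (A ks.2.length l) ks.2 fun m => ks.2 ++ [m])
      Computable.list_length (Computable.const []) ?_
    refine Computable.option_casesOn ?_ (Computable.snd.comp Computable.snd) ?_
    · exact hA.comp (Computable.list_length.comp (Computable.snd.comp Computable.snd))
        Computable.fst
    · exact Computable.list_concat.comp
        (Computable.snd.comp (Computable.snd.comp Computable.fst)) Computable.snd
  refine this.of_eq fun l => ?_
  generalize l.length = k
  induction k with
  | zero => rfl
  | succ k ih => rw [outs, ← ih]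

theorem outs_spec (A : ℕ → List ℕ → Option ℕ) (l : List ℕ) (k i : ℕ) (m : ℕ)
    (h : (outs A l k)[i]? = some m) : A i l = some m := by
  induction k with
  | zero => simp [outs] at h
  | succ k ih =>
    rw [outs] at h
    cases hA : A (outs A l k).length l with
    | none => rw [hA] at h; exact ih h
    | some r =>
      rw [hA] at h
      rcases lt_trichotomy i (outs A l k).length with hi | rfl | hi
      · simp only at h
        rw [List.getElem?_append_left hi] at h
        exact ih h
      · simp only [List.getElem?_concat_length, Option.some.injEq] at h
        rw [hA, h]
      · simp only at h
        rw [List.getElem?_eq_none (by simpa using hi)] at h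
        cases h

theorem outs_prefix {A : ℕ → List ℕ → Option ℕ} (hA : MonoApprox A) {l l' : List ℕ}
    (hl : l <+: l') (k : ℕ) : outs A l k <+: outs A l' k := by
  have hlen : (outs A l k).length ≤ (outs A l' k).length := by
    induction k with
    | zero => rfl
    | succ k ih =>
      rw [outs, outs]
      cases h : A (outs A l k).length l with
      | none => cases A (outs A l' k).length l' <;> simp <;> omega
      | some m =>
        rcases ih.eq_or_lt with heq | hlt
        · rw [← heq, hA _ _ _ _ hl h]
          simpa using ih
        · cases A (outs A l' k).length l' <;> simp <;> omega
  rw [List.prefix_iff_getElem?]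
  intro i hi
  have h1 := hA _ _ _ _ hl (outs_spec A l k i _ (List.getElem?_eq_getElem hi))
  have h2 := outs_spec A l' k i _ (List.getElem?_eq_getElem (hi.trans_le hlen))
  rw [List.getElem?_eq_getElem (hi.trans_le hlen)]
  rw [h1] at h2
  exact h2.symm

theorem outs_prefix_succ (A : ℕ → List ℕ → Option ℕ) (l : List ℕ) {k k' : ℕ} (h : k ≤ k') :
    outs A l k <+: outs A l k' := by
  induction h with
  | refl => exact List.prefix_refl _
  | step _ ih =>
    refine ih.trans ?_
    rw [outs]
    cases A _ l with
    | none => exact List.prefix_refl _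
    | some m => exact List.prefix_append _ _

theorem exists_outs_eq {A : ℕ → List ℕ → Option ℕ} (hA : MonoApprox A) {p v : Baire}
    (h : Approximates A p v) (k : ℕ) : ∃ K, outs A (initSeg p K) k = initSeg v k := by
  induction k with
  | zero => exact ⟨0, rfl⟩
  | succ k ih =>
    obtain ⟨K, hK⟩ := ih
    obtain ⟨K', hK'⟩ := h k
    refine ⟨max K K', ?_⟩
    have h1 := outs_prefix hA (initSeg_prefix (p := p) (le_max_left K K')) k
    rw [hK] at h1
    have h2 : outs A (initSeg p (max K K')) k = initSeg v k := by
      refine (h1.eq_of_length_le ?_).symm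
      rw [length_initSeg]
      clear hK h1 hK'
      induction k with
      | zero => simp [outs]
      | succ k ih =>
        rw [outs]
        cases A _ _ <;> simp <;> omega
    rw [outs, h2, length_initSeg, hA _ _ _ _ (initSeg_prefix (le_max_right K K')) hK']
    simp [initSeg, List.range_succ]

/-- The approximations of `G` are run on the part of the output of `F` known so far. These parts
grow with the input and reach every finite length. -/
theorem Eff.comp {F G : Baire → Part Baire} (hG : Eff G) (hF : Eff F) :
    Eff fun p => (F p).bind G := by
  obtain ⟨A, hA, hAm, hAF⟩ := hF.exists_approx
  obtain ⟨B, hB, hBm, hBG⟩ := hG.exists_approx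
  refine Eff.of_approx (fun n l => B n (outs A l l.length)) ?_ ?_ ?_
  · exact hB.comp Computable.fst ((computable_outs hA).comp Computable.snd)
  · intro n l l' m hl h
    exact hBm _ _ _ _ ((outs_prefix hAm hl _).trans (outs_prefix_succ _ _ hl.length_le)) h
  · intro p v hv n
    obtain ⟨x, hx, hv⟩ := Part.mem_bind_iff.1 hv
    obtain ⟨k, hk⟩ := hBG x v hv n
    obtain ⟨K, hK⟩ := exists_outs_eq hAm (hAF p x hx) k
    refine ⟨max K k, hBm _ _ _ _ ?_ hk⟩
    rw [← hK, length_initSeg]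
    exact (outs_prefix hAm (initSeg_prefix (le_max_left K k)) k).trans
      (outs_prefix_succ _ _ (le_max_right K k))

theorem Eff.pairing {F G : Baire → Part Baire} (hF : Eff F) (hG : Eff G) :
    Eff fun p => (F p).bind fun x => (G p).map (pair x) := by
  obtain ⟨A, hA, hAm, hAF⟩ := hF.exists_approx
  obtain ⟨B, hB, hBm, hBG⟩ := hG.exists_approx
  refine Eff.of_approx (fun n l => Nat.casesOn n (some 2) fun j =>
    bif j % 2 == 0 then A (j / 2) l else B (j / 2) l) ?_ ?_ ?_
  · refine Computable.nat_casesOn Computable.fst (Computable.const _) ?_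
    have hdiv : Computable fun a : (ℕ × List ℕ) × ℕ => a.2 / 2 :=
      Primrec.to_comp (Primrec.nat_div.comp Primrec.snd (Primrec.const 2))
    refine Computable.cond (Primrec.to_comp ?_) ?_ ?_
    · exact Primrec.beq.comp (Primrec.nat_mod.comp Primrec.snd (Primrec.const 2)) (Primrec.const 0)
    · exact hA.comp hdiv (Computable.snd.comp Computable.fst)
    · exact hB.comp hdiv (Computable.snd.comp Computable.fst)
  · rintro (_ | j) l l' m hl h
    · exact h
    · by_cases hj : j % 2 = 0
      · simp only [hj] at h ⊢
        exact hAm _ _ _ _ hl h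
      · have : (j % 2 == 0) = false := by simpa using hj
        simp only [this] at h ⊢
        exact hBm _ _ _ _ hl h
  · intro p v hv n
    obtain ⟨x, hx, hv⟩ := Part.mem_bind_iff.1 hv
    obtain ⟨y, hy, rfl⟩ := (Part.mem_map_iff _).1 hv
    rcases n with _ | j
    · exact ⟨0, rfl⟩
    · by_cases hj : j % 2 = 0
      · obtain ⟨k, hk⟩ := hAF p x hx (j / 2)
        refine ⟨k, ?_⟩
        simp [hj, hk, pair, cons]
      · obtain ⟨k, hk⟩ := hBG p y hy (j / 2)
        refine ⟨k, ?_⟩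
        have : (j % 2 == 0) = false := by simpa using hj
        simp only [this, cond_false, hk, Weih.pair, cons, if_neg hj]

/-- Total effective functionals. -/
def EffFun (f : Baire → Baire) : Prop := Eff fun p => Part.some (f p)

theorem EffFun.of_eff {F : Baire → Part Baire} {f : Baire → Baire} (hF : Eff F)
    (h : ∀ p, f p ∈ F p) : EffFun f :=
  hF.mono fun p v hv => by rw [Part.mem_some_iff.1 hv]; exact h p

theorem EffFun.id : EffFun fun p => p := Eff.id

theorem EffFun.comp {f g : Baire → Baire} (hg : EffFun g) (hf : EffFun f) :
    EffFun fun p => g (f p) :=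
  .of_eff (Eff.comp hg hf) fun p => by simp

theorem Eff.comp_fun {F : Baire → Part Baire} {f : Baire → Baire} (hF : Eff F) (hf : EffFun f) :
    Eff fun p => F (f p) :=
  (Eff.comp hF hf).mono fun p v hv => by simpa using hv

theorem Eff.map {F : Baire → Part Baire} {f : Baire → Baire} (hf : EffFun f) (hF : Eff F) :
    Eff fun p => (F p).map f :=
  (Eff.comp hf hF).mono fun p v hv => by rwa [Part.bind_some_eq_map]

theorem EffFun.fst {f : Baire → Baire} (hf : EffFun f) : EffFun fun p => fst (f p) :=
  EffFun.comp Eff.fst_id hf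

theorem EffFun.snd {f : Baire → Baire} (hf : EffFun f) : EffFun fun p => snd (f p) :=
  EffFun.comp Eff.snd_id hf

theorem EffFun.tail {f : Baire → Baire} (hf : EffFun f) : EffFun fun p => tail (f p) :=
  EffFun.comp Eff.tail_id hf

theorem EffFun.in₁ {f : Baire → Baire} (hf : EffFun f) : EffFun fun p => in₁ (f p) :=
  EffFun.comp (Eff.cons_id 0) hf

theorem EffFun.in₂ {f : Baire → Baire} (hf : EffFun f) : EffFun fun p => in₂ (f p) :=
  EffFun.comp (Eff.cons_id 1) hf

theorem computable_unitElt : Computable unitElt := Computable.const 0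

theorem EffFun.unitElt : EffFun fun _ => unitElt := Eff.const computable_unitElt

theorem EffFun.const {c : Baire} (hc : Computable c) : EffFun fun _ => c := Eff.const hc

theorem EffFun.pair {f g : Baire → Baire} (hf : EffFun f) (hg : EffFun g) :
    EffFun fun p => pair (f p) (g p) :=
  .of_eff (Eff.pairing hf hg) fun p => by simp

/-- The parameter `p` is passed on to `G` inside a pair, which reduces the claim to composition. -/
theorem Eff.bind {F : Baire → Part Baire} {G : Baire → Baire → Part Baire} (hF : Eff F)
    (hG : Eff fun q => G (Weih.fst q) (Weih.snd q)) : Eff fun p => (F p).bind (G p) := by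
  refine (Eff.comp hG (Eff.pairing EffFun.id hF)).mono fun p v hv => ?_
  obtain ⟨x, hx, hv⟩ := Part.mem_bind_iff.1 hv
  refine Part.mem_bind_iff.2 ⟨Weih.pair p x, ?_, by simpa using hv⟩
  simpa using ⟨x, hx, rfl⟩

/-- Case distinction on the first value of `t p`. -/
theorem Eff.ite {F G : Baire → Part Baire} {t : Baire → Baire} (ht : EffFun t) (hF : Eff F)
    (hG : Eff G) : Eff fun p => if t p 0 = 0 then F p else G p := by
  obtain ⟨A, hA, hAm, hAF⟩ := hF.exists_approx
  obtain ⟨B, hB, hBm, hBG⟩ := hG.exists_approx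
  obtain ⟨T, hT, hTm, hTt⟩ := ht.exists_approx
  refine Eff.of_approx (fun n l => Option.casesOn (T 0 l) none fun b =>
    Nat.casesOn b (A n l) fun _ => B n l) ?_ ?_ ?_
  · refine Computable.option_casesOn (hT.comp (Computable.const 0) Computable.snd)
      (Computable.const none) ?_
    refine Computable.nat_casesOn Computable.snd ?_ ?_
    · exact hA.comp (Computable.fst.comp Computable.fst) (Computable.snd.comp Computable.fst)
    · exact hB.comp (Computable.fst.comp (Computable.fst.comp Computable.fst))
        (Computable.snd.comp (Computable.fst.comp Computable.fst))
  · intro n l l' m hl h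
    cases hb : T 0 l with
    | none => simp [hb] at h
    | some b =>
      simp only [hTm _ _ _ _ hl hb]
      simp only [hb] at h
      cases b with
      | zero => exact hAm _ _ _ _ hl h
      | succ b => exact hBm _ _ _ _ hl h
  · intro p v hv n
    obtain ⟨k, hk⟩ := hTt p _ (Part.mem_some _) 0
    have key : ∀ (C : ℕ → List ℕ → Option ℕ), MonoApprox C → Approximates C p v →
        ∃ K, C n (initSeg p K) = some (v n) ∧ T 0 (initSeg p K) = some (t p 0) := by
      intro C hC hCv
      obtain ⟨k', hk'⟩ := hCv n
      exact ⟨max k k', hC _ _ _ _ (initSeg_prefix (le_max_right k k')) hk',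
        hTm _ _ _ _ (initSeg_prefix (le_max_left k k')) hk⟩
    by_cases h0 : t p 0 = 0
    · rw [if_pos h0] at hv
      obtain ⟨K, h1, h2⟩ := key A hAm (hAF p v hv)
      refine ⟨K, ?_⟩
      simp only [h2, h0]
      exact h1
    · rw [if_neg h0] at hv
      obtain ⟨K, h1, h2⟩ := key B hBm (hBG p v hv)
      refine ⟨K, ?_⟩
      obtain ⟨b, hb⟩ := Nat.exists_eq_succ_of_ne_zero h0
      simpa only [h2, hb] using h1

/-- The test at stage `k` for the value at `n` of the application of `fst p` to `snd p`, when
`l` is an initial segment of `p`. -/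
def appTest (n : ℕ) (l : List ℕ) (k : ℕ) : ℕ :=
  -- Stage `k` needs the first `k` entries of `snd p`, the last of which is entry `2 * k` of `p`. If
  -- `l` is too short, the value `1` stops the search: passing on to later stages could miss the
  -- least successful one.
  bif decide (2 * k < l.length) then
    Option.casesOn l[2 * Encodable.encode (n :: (List.range k).map fun i => l.getD (2 * i + 2) 0) + 1]?
      1 fun r => Nat.casesOn r 0 fun r => r + 2
  else 1

theorem appTest_initSeg {n : ℕ} {p : Baire} {k K : ℕ} (hk : 2 * k < K)
    (hK : 2 * prefixCode n (snd p) k + 1 < K) :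
    appTest n (initSeg p K) k = Nat.casesOn (fst p (prefixCode n (snd p) k)) 0 fun r => r + 2 := by
  have : ((List.range k).map fun i => (initSeg p K).getD (2 * i + 2) 0) =
      (List.range k).map (snd p) := by
    refine List.map_congr_left fun i hi => ?_
    rw [getD_initSeg (by have := List.mem_range.1 hi; omega), snd]
  have h2 : (initSeg p K)[2 * prefixCode n (snd p) k + 1]? =
    some (p (2 * prefixCode n (snd p) k + 1)) := getElem?_initSeg hK
  unfold appTest
  rw [this]
  unfold prefixCode at h2
  rw [h2]
  simp only [length_initSeg, hk, decide_true, cond_true]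
  rfl

theorem appTest_mono {n : ℕ} {l l' : List ℕ} (hl : l <+: l') {k : ℕ} (h : appTest n l k ≠ 1) :
    appTest n l' k = appTest n l k := by
  obtain ⟨r, rfl⟩ := hl
  by_cases hk : 2 * k < l.length
  · have hk' : 2 * k < (l ++ r).length := by simp; omega
    have hmap : ((List.range k).map fun i => (l ++ r).getD (2 * i + 2) 0) =
        (List.range k).map fun i => l.getD (2 * i + 2) 0 := by
      refine List.map_congr_left fun i hi => ?_
      have := List.mem_range.1 hi
      rw [List.getD_append _ _ _ _ (by omega)]
    unfold appTest at h ⊢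
    rw [hmap]
    simp only [hk, hk', decide_true, cond_true] at h ⊢
    generalize 2 * Encodable.encode
      (n :: (List.range k).map fun i => l.getD (2 * i + 2) 0) + 1 = e at h ⊢
    by_cases he : e < l.length
    · rw [List.getElem?_append_left he]
    · rw [List.getElem?_eq_none (by omega)] at h
      exact absurd rfl h
  · simp [appTest, hk] at h

theorem computable_appTest : Computable fun x : (ℕ × List ℕ) × ℕ => appTest x.1.1 x.1.2 x.2 := by
  have hk : Primrec fun x : (ℕ × List ℕ) × ℕ => x.2 := Primrec.snd
  have hl : Primrec fun x : (ℕ × List ℕ) × ℕ => x.1.2 := Primrec.snd.comp Primrec.fst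
  have hn : Primrec fun x : (ℕ × List ℕ) × ℕ => x.1.1 := Primrec.fst.comp Primrec.fst
  refine Computable.cond (Primrec.to_comp ?_) ?_ (Computable.const 1)
  · exact Primrec.nat_lt.decide.comp (Primrec.nat_mul.comp (Primrec.const 2) hk)
      (Primrec.list_length.comp hl)
  · refine Computable.option_casesOn (Primrec.to_comp ?_) (Computable.const 1) ?_
    · refine Primrec.list_getElem?.comp hl ((primrec_double_add 1).comp (Primrec.encode.comp ?_))
      refine Primrec.list_cons.comp hn (Primrec.list_map (Primrec.list_range.comp hk) ?_)
      exact (Primrec.list_getD 0).comp (hl.comp Primrec.fst)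
        ((primrec_double_add 2).comp Primrec.snd)
    · exact Computable.nat_casesOn Computable.snd (Computable.const 0)
        (Computable.succ.comp (Computable.succ.comp Computable.snd))

theorem Eff.app_id : Eff fun p => Weih.app (Weih.fst p) (Weih.snd p) := by
  refine Eff.of_approx (fun n l => found (search (appTest n l) (l.length + 1))) ?_ ?_ ?_
  · refine computable_found.comp (computable_search
      (T := fun x : ℕ × List ℕ => appTest x.1 x.2) computable_appTest ?_)
    exact Computable.succ.comp (Computable.list_length.comp Computable.snd)
  · intro n l l' m hl h
    rw [found_eq_some, search_eq_succ_iff] at h ⊢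
    obtain ⟨k, hk, h1, h2⟩ := h
    refine ⟨k, hk.trans_le (Nat.succ_le_succ hl.length_le), ?_, fun j hj => ?_⟩
    · rw [appTest_mono hl (by omega), h1]
    · rw [appTest_mono hl (by rw [h2 j hj]; omega), h2 j hj]
  · intro p v hv n
    obtain ⟨k, h1, h2⟩ := mem_app_iff.1 hv n
    -- `K` entries of `p` suffice to decide all stages up to `k`; a sum serves as a common bound.
    obtain ⟨K, hK⟩ : ∃ K, ∀ j ≤ k, 2 * j < K ∧ 2 * prefixCode n (Weih.snd p) j + 1 < K := by
      refine ⟨∑ j ∈ Finset.range (k + 1), (2 * j + (2 * prefixCode n (Weih.snd p) j + 1)) + 1,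
        fun j hj => ?_⟩
      have := Finset.single_le_sum
        (f := fun j => 2 * j + (2 * prefixCode n (Weih.snd p) j + 1)) (fun _ _ => Nat.zero_le _)
        (show j ∈ Finset.range (k + 1) from Finset.mem_range.2 (Nat.lt_succ_of_le hj))
      omega
    refine ⟨K, ?_⟩
    rw [found_eq_some, search_eq_succ_iff]
    refine ⟨k, ?_, ?_, fun j hj => ?_⟩
    · have := (hK k le_rfl).1
      rw [length_initSeg]
      omega
    · rw [appTest_initSeg (hK k le_rfl).1 (hK k le_rfl).2, h1]
    · rw [appTest_initSeg (hK j hj.le).1 (hK j hj.le).2, h2 j hj]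
      rfl

theorem Eff.app {f g : Baire → Baire} (hf : EffFun f) (hg : EffFun g) :
    Eff fun p => app (f p) (g p) :=
  (Eff.app_id.comp_fun (hf.pair hg)).mono fun p v hv => by simpa using hv

/-- The initial segment of a pair given by initial segments of the components. -/
def pairPrefix (a b : List ℕ) : List ℕ :=
  (List.range (2 * b.length + 1)).map fun i =>
    Nat.casesOn i 2 fun j => bif j % 2 == 0 then a.getD (j / 2) 0 else b.getD (j / 2) 0

theorem pairPrefix_initSeg (x y : Baire) (k : ℕ) :
    pairPrefix (initSeg x k) (initSeg y k) = initSeg (pair x y) (2 * k + 1) := by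
  rw [pairPrefix, length_initSeg]
  refine List.map_congr_left fun i hi => ?_
  have := List.mem_range.1 hi
  rcases i with _ | j
  · rfl
  · by_cases hj : j % 2 = 0
    · simp only [hj, beq_self_eq_true, cond_true, pair, cons, if_true]
      rw [getD_initSeg (by omega)]
    · have h0 : (j % 2 == 0) = false := by simpa using hj
      simp only [h0, cond_false, pair, cons, if_neg hj]
      rw [getD_initSeg (by omega)]

theorem eq_initSeg_of_prefix {l l' : List ℕ} (h : l <+: l') :
    l = initSeg (fun i => l'.getD i 0) l.length := by
  obtain ⟨r, rfl⟩ := h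
  apply List.ext_getElem (by simp)
  intro i h1 h2
  simp [initSeg, List.getElem?_append_left h1, List.getElem?_eq_getElem h1]

theorem primrec_pairPrefix : Primrec₂ pairPrefix := by
  refine Primrec.list_map (Primrec.list_range.comp
    ((primrec_double_add 1).comp (Primrec.list_length.comp Primrec.snd))) ?_
  refine Primrec.nat_casesOn Primrec.snd (Primrec.const 2) ?_
  have hdiv : Primrec fun a : ((List ℕ × List ℕ) × ℕ) × ℕ => a.2 / 2 :=
    Primrec.nat_div.comp Primrec.snd (Primrec.const 2)
  refine Primrec.cond ?_ ?_ ?_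
  · exact Primrec.beq.comp (Primrec.nat_mod.comp Primrec.snd (Primrec.const 2)) (Primrec.const 0)
  · exact (Primrec.list_getD 0).comp
      (Primrec.fst.comp (Primrec.fst.comp Primrec.fst)) hdiv
  · exact (Primrec.list_getD 0).comp
      (Primrec.snd.comp (Primrec.fst.comp Primrec.fst)) hdiv

/-- Currying. -/
theorem Eff.lam {F : Baire → Part Baire} (hF : Eff F) :
    ∃ h : Baire → Baire, EffFun h ∧ ∀ p y, ∀ v ∈ F (Weih.pair p y), v ∈ Weih.app (h p) y := by
  obtain ⟨A, hA, hAm, hAF⟩ := hF.exists_approx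
  -- The code built from `x` answers a query with argument prefix `l` by looking at equally many
  -- entries of `x`. Hence each entry of the code depends on finitely many entries of `x`, with a
  -- computable modulus.
  refine ⟨fun x => codeOf fun n l => A n (pairPrefix (initSeg x l.length) l), ?_, ?_⟩
  · let h : ℕ → ℕ := fun i =>
      Option.casesOn (Encodable.decode i : Option (List ℕ)) 0 List.length
    refine Eff.of_modulus (h := h) (g := fun i l₀ =>
      codeOf (fun n l => A n (pairPrefix (l₀.take l.length) l)) i) ?_ ?_ ?_
    · exact Computable.option_casesOn Computable.decode (Computable.const 0)
        (Computable.list_length.comp Computable.snd)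
    · refine computable_codeOf_of (A := fun (x : ℕ × List ℕ) n l =>
        A n (pairPrefix (x.2.take l.length) l)) ?_ Computable.fst
      have hl : Primrec fun x : (ℕ × List ℕ) × ℕ × List ℕ => x.2.2 :=
        Primrec.snd.comp Primrec.snd
      refine hA.comp (Computable.fst.comp Computable.snd) (Primrec.to_comp ?_)
      exact primrec_pairPrefix.comp (Primrec.list_take.comp (Primrec.list_length.comp hl)
        (Primrec.snd.comp Primrec.fst)) hl
    · intro p i
      unfold codeOf
      simp only [h]
      rcases (Encodable.decode i : Option (List ℕ)) with _ | (_ | ⟨n, l⟩)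
      · rfl
      · rfl
      · simp only
        rw [take_initSeg (by simp)]
  · intro p y v hv
    apply mem_app_codeOf
    · intro n l l' m hl hm
      refine hAm _ _ _ _ ?_ hm
      have h1 := eq_initSeg_of_prefix hl
      have h2 := eq_initSeg_of_prefix (List.prefix_refl l')
      set q : Baire := fun i => l'.getD i 0
      have e1 := pairPrefix_initSeg p q l.length
      have e2 := pairPrefix_initSeg p q l'.length
      rw [← h1] at e1
      rw [← h2] at e2
      rw [e1, e2]
      exact initSeg_prefix (by have := hl.length_le; omega)
    · intro n
      obtain ⟨k, hk⟩ := hAF _ v hv n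
      refine ⟨k, hAm _ _ _ _ ?_ hk⟩
      rw [length_initSeg, pairPrefix_initSeg]
      exact initSeg_prefix (by omega)

/-- The application of a computable code to a computable point is computable. -/
theorem computable_of_mem_app {c p v : Baire} (hc : Computable c) (hp : Computable p)
    (hv : v ∈ app c p) : Computable v := by
  have hseg : Computable fun x : ℕ × ℕ => initSeg p x.2 := by
    have : Computable fun x : ℕ × ℕ =>
        (Nat.rec [] (fun k s => s ++ [p k]) x.2 : List ℕ) := by
      refine Computable.nat_rec (h := fun (_ : ℕ × ℕ) (ks : ℕ × List ℕ) => ks.2 ++ [p ks.1])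
        Computable.snd (Computable.const []) ?_
      exact Computable.list_concat.comp (Computable.snd.comp Computable.snd)
        (hp.comp (Computable.fst.comp Computable.snd))
    refine this.of_eq fun x => ?_
    generalize x.2 = k
    induction k with
    | zero => rfl
    | succ k ih => simp only [ih]; simp [initSeg, List.range_succ]
  have hf : Computable₂ fun n k => codeApprox c n (initSeg p k) :=
    (computable_codeApprox hc).comp Computable.fst hseg
  have hmono : ∀ n m {k k'}, k ≤ k' → codeApprox c n (initSeg p k) = some m →
      codeApprox c n (initSeg p k') = some m := fun n m k k' hk h =>
    monoApprox_code c _ _ _ _ (initSeg_prefix hk) h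
  refine Partrec.of_eq_tot (Partrec.rfindOpt hf) fun n => ?_
  obtain ⟨k, hk⟩ := mem_app_iff_approximates.1 hv n
  exact (Nat.rfindOpt_mono fun {a m n} => hmono _ a).2 ⟨k, hk⟩

/-- The recursion theorem. -/
theorem Eff.exists_fixpoint {F : Baire → Part Baire} (hF : Eff F) :
    ∃ r : Baire, Computable r ∧ ∀ p, ∀ v ∈ F (Weih.pair r p), v ∈ Weih.app r p := by
  -- Here `h s` is a code of `p ↦ F ⟨s · s, p⟩`. If `c` is a code of `h`, then `c · c = h c`, so `h
  -- c` is the fixpoint.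
  obtain ⟨h, hh, hlam⟩ := Eff.lam (F := fun q => (Weih.app (Weih.fst q) (Weih.fst q)).bind fun s =>
    F (Weih.pair s (Weih.snd q)))
    (Eff.bind (G := fun q s => F (Weih.pair s (Weih.snd q)))
      (Eff.app (EffFun.id.fst) (EffFun.id.fst))
      (hF.comp_fun (EffFun.id.snd.pair EffFun.id.fst.snd)))
  obtain ⟨c, hc, hch⟩ := hh
  refine ⟨h c, computable_of_mem_app hc hc (hch c _ (Part.mem_some _)), fun p v hv => ?_⟩
  apply hlam
  refine Part.mem_bind_iff.2 ⟨h c, ?_, ?_⟩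
  · simpa using hch c _ (Part.mem_some _)
  · simpa using hv

end Weih

namespace Weih

/-! ## Weihrauch reducibility satisfies the axioms -/

namespace Problem

theorem pair_mem_inf_dom {P Q : Problem} {u v : Baire} :
    pair u v ∈ (inf P Q).dom ↔ u ∈ P.dom ∧ v ∈ Q.dom := by
  simp [inf, pair_inj]

theorem mem_inf_sol {P Q : Problem} {u v z : Baire} : z ∈ (inf P Q).sol (pair u v) ↔
    u ∈ P.dom ∧ v ∈ Q.dom ∧ ((∃ x ∈ P.sol u, z = in₁ x) ∨ ∃ y ∈ Q.sol v, z = in₂ y) := by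
  simp only [inf, pair_inj, Set.mem_ofPred_eq]
  constructor
  · rintro ⟨u, hu, v, hv, ⟨rfl, rfl⟩, h⟩
    exact ⟨hu, hv, h⟩
  · rintro ⟨hu, hv, h⟩
    exact ⟨u, hu, v, hv, ⟨rfl, rfl⟩, h⟩

theorem pair_mem_comp_dom {P Q : Problem} {u c : Baire} : pair u c ∈ (comp P Q).dom ↔
    u ∈ Q.dom ∧ ∀ x ∈ Q.sol u, ∃ v ∈ app c x, v ∈ P.dom := by
  simp only [comp, pair_inj, Set.mem_ofPred_eq]
  constructor
  · rintro ⟨u, hu, c, ⟨rfl, rfl⟩, h⟩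
    exact ⟨hu, h⟩
  · rintro ⟨hu, h⟩
    exact ⟨u, hu, c, ⟨rfl, rfl⟩, h⟩

theorem mem_comp_sol {P Q : Problem} {u c z : Baire} : z ∈ (comp P Q).sol (pair u c) ↔
    u ∈ Q.dom ∧ ∃ x ∈ Q.sol u, ∃ v ∈ app c x, ∃ y ∈ P.sol v, z = pair x y := by
  simp only [comp, pair_inj, Set.mem_ofPred_eq]
  constructor
  · rintro ⟨u, hu, c, ⟨rfl, rfl⟩, h⟩
    exact ⟨hu, h⟩
  · rintro ⟨hu, h⟩
    exact ⟨u, hu, c, ⟨rfl, rfl⟩, h⟩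

theorem in₁_mem_sup_dom {P Q : Problem} {u : Baire} : in₁ u ∈ (sup P Q).dom ↔ u ∈ P.dom := by
  simp [sup, in₁_inj, in₁_ne_in₂]

theorem in₂_mem_sup_dom {P Q : Problem} {u : Baire} : in₂ u ∈ (sup P Q).dom ↔ u ∈ Q.dom := by
  simp [sup, in₂_inj, in₁_ne_in₂.symm]

theorem mem_sup_sol_in₁ {P Q : Problem} {u z : Baire} :
    z ∈ (sup P Q).sol (in₁ u) ↔ u ∈ P.dom ∧ z ∈ P.sol u := by
  simp [sup, in₁_inj, in₁_ne_in₂]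

theorem mem_sup_sol_in₂ {P Q : Problem} {u z : Baire} :
    z ∈ (sup P Q).sol (in₂ u) ↔ u ∈ Q.dom ∧ z ∈ Q.sol u := by
  simp [sup, in₂_inj, in₁_ne_in₂.symm]

theorem mem_diamond_sol_unit {P : Problem} {z : Baire} :
    z ∈ (diamond P).sol unitElt ↔ z = unitElt := by
  constructor
  · intro h
    change DiamondSol P unitElt z at h
    generalize hu : unitElt = u at h
    cases h with
    | unit => rfl
    | step => exact absurd hu.symm pair_ne_unitElt
  · rintro rfl
    exact DiamondSol.unit

theorem mem_diamond_sol_pair {P : Problem} {u c z : Baire} :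
    z ∈ (diamond P).sol (pair u c) ↔
      u ∈ P.dom ∧ ∃ x ∈ P.sol u, ∃ v ∈ app c x, ∃ y ∈ (diamond P).sol v, z = pair x y := by
  constructor
  · intro h
    change DiamondSol P (pair u c) z at h
    generalize hu : pair u c = w at h
    cases h with
    | unit => exact absurd hu pair_ne_unitElt
    | step u' c' x v y h1 h2 h3 h4 =>
      obtain ⟨rfl, rfl⟩ := pair_inj.1 hu
      exact ⟨h1, x, h2, v, h3, y, h4, rfl⟩
  · rintro ⟨hu, x, hx, v, hv, y, hy, rfl⟩
    exact DiamondSol.step u c x v y hu hx hv hy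

end Problem

open Problem

/-- `φ` and `ψ` are codes of the forward and the backward map of a reduction. -/
def Realizes (φ ψ : Baire) (P Q : Problem) : Prop :=
  ∀ u ∈ P.dom, ∃ v ∈ app φ u, v ∈ Q.dom ∧ ∀ y ∈ Q.sol v, ∃ z ∈ app ψ (pair u y), z ∈ P.sol u

/-- A family of problems. -/
abbrev Family (ι : Type*) := ι → Problem

namespace Family

variable {ι : Type*}

abbrev zero : Family ι := fun _ => Problem.zero

abbrev one : Family ι := fun _ => Problem.one

abbrev top : Family ι := fun _ => Problem.top

abbrev sup (P Q : Family ι) : Family ι := fun i => Problem.sup (P i) (Q i)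

abbrev inf (P Q : Family ι) : Family ι := fun i => Problem.inf (P i) (Q i)

abbrev comp (P Q : Family ι) : Family ι := fun i => Problem.comp (P i) (Q i)

abbrev diamond (P : Family ι) : Family ι := fun i => Problem.diamond (P i)

/-- Reducibility of families of problems, uniformly in the parameter. -/
def Reduces (P Q : Family ι) : Prop :=
  ∃ φ ψ : Baire, Computable φ ∧ Computable ψ ∧ ∀ i, Realizes φ ψ (P i) (Q i)

theorem Reduces.of_eff {P Q : Family ι} {F G : Baire → Part Baire} (hF : Eff F) (hG : Eff G)
    (h : ∀ i, ∀ u ∈ (P i).dom, ∃ v ∈ F u, v ∈ (Q i).dom ∧ ∀ y ∈ (Q i).sol v, ∃ z ∈ G (pair u y), z ∈ (P i).sol u) :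
    Reduces P Q := by
  obtain ⟨φ, hφ, hφF⟩ := hF
  obtain ⟨ψ, hψ, hψG⟩ := hG
  refine ⟨φ, ψ, hφ, hψ, fun i u hu => ?_⟩
  obtain ⟨v, hv, hvQ, h⟩ := h i u hu
  refine ⟨v, hφF u v hv, hvQ, fun y hy => ?_⟩
  obtain ⟨z, hz, hzP⟩ := h y hy
  exact ⟨z, hψG _ z hz, hzP⟩

theorem Reduces.of_fun {P Q : Family ι} {f g : Baire → Baire} (hf : EffFun f) (hg : EffFun g)
    (h : ∀ i, ∀ u ∈ (P i).dom, f u ∈ (Q i).dom ∧ ∀ y ∈ (Q i).sol (f u), g (pair u y) ∈ (P i).sol u) :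
    Reduces P Q :=
  .of_eff hf hg fun i u hu => ⟨_, Part.mem_some _, (h i u hu).1, fun y hy =>
    ⟨_, Part.mem_some _, (h i u hu).2 y hy⟩⟩

theorem Reduces.trans {P Q R : Family ι} (h₁ : Reduces P Q) (h₂ : Reduces Q R) : Reduces P R := by
  obtain ⟨φ, ψ, hφ, hψ, h₁⟩ := h₁
  obtain ⟨φ', ψ', hφ', hψ', h₂⟩ := h₂
  have I := EffFun.id
  refine Reduces.of_eff (F := fun u => (app φ u).bind fun v => app φ' v)
    (G := fun p => (app φ (fst p)).bind fun v => (app ψ' (pair v (snd p))).bind fun y =>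
      app ψ (pair (fst p) y)) ?_ ?_ ?_
  · exact Eff.bind (G := fun _ v => app φ' v) (.of_code hφ) ((Eff.of_code hφ').comp_fun I.snd)
  · refine Eff.bind (G := fun p v => (app ψ' (pair v (snd p))).bind fun y =>
      app ψ (pair (fst p) y)) ((Eff.of_code hφ).comp_fun I.fst) ?_
    refine Eff.bind (G := fun q y => app ψ (pair (fst (fst q)) y))
      ((Eff.of_code hψ').comp_fun (I.snd.pair I.fst.snd)) ?_
    exact (Eff.of_code hψ).comp_fun (I.fst.fst.fst.pair I.snd)
  · intro i u hu
    obtain ⟨v, hv, hvQ, h₁⟩ := h₁ i u hu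
    obtain ⟨w, hw, hwR, h₂⟩ := h₂ i v hvQ
    refine ⟨w, Part.mem_bind_iff.2 ⟨v, hv, hw⟩, hwR, fun y hy => ?_⟩
    obtain ⟨x, hx, hxQ⟩ := h₂ y hy
    obtain ⟨z, hz, hzP⟩ := h₁ x hxQ
    simp only [fst_pair, snd_pair]
    exact ⟨z, Part.mem_bind_iff.2 ⟨v, hv, Part.mem_bind_iff.2 ⟨x, hx, hz⟩⟩, hzP⟩

theorem Reduces.zero_le (P : Family ι) : Reduces zero P :=
  .of_fun .id .id fun _ _ h => h.elim

theorem Reduces.le_top (P : Family ι) : Reduces P top :=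
  .of_fun .unitElt .id fun _ _ _ => ⟨rfl, fun _ h => h.elim⟩

theorem Reduces.le_sup_left (P Q : Family ι) : Reduces P (sup P Q) :=
  .of_fun EffFun.id.in₁ EffFun.id.snd fun _ _ hu => ⟨in₁_mem_sup_dom.2 hu, fun y hy => by
    simpa using (mem_sup_sol_in₁.1 hy).2⟩

theorem Reduces.le_sup_right (P Q : Family ι) : Reduces Q (sup P Q) :=
  .of_fun EffFun.id.in₂ EffFun.id.snd fun _ _ hu => ⟨in₂_mem_sup_dom.2 hu, fun y hy => by
    simpa using (mem_sup_sol_in₂.1 hy).2⟩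

theorem Reduces.sup_le {P Q R : Family ι} (h₁ : Reduces Q P) (h₂ : Reduces R P) :
    Reduces (sup Q R) P := by
  obtain ⟨φ, ψ, hφ, hψ, h₁⟩ := h₁
  obtain ⟨φ', ψ', hφ', hψ', h₂⟩ := h₂
  have I := EffFun.id
  refine Reduces.of_eff (F := fun u => if u 0 = 0 then app φ (tail u) else app φ' (tail u))
    (G := fun p => if fst p 0 = 0 then app ψ (pair (tail (fst p)) (snd p))
      else app ψ' (pair (tail (fst p)) (snd p))) ?_ ?_ ?_
  · exact Eff.ite I ((Eff.of_code hφ).comp_fun I.tail) ((Eff.of_code hφ').comp_fun I.tail)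
  · exact Eff.ite I.fst ((Eff.of_code hψ).comp_fun (I.fst.tail.pair I.snd))
      ((Eff.of_code hψ').comp_fun (I.fst.tail.pair I.snd))
  · rintro i _ (⟨u, hu, rfl⟩ | ⟨u, hu, rfl⟩)
    · obtain ⟨v, hv, hvP, h⟩ := h₁ i u hu
      refine ⟨v, by simpa using hv, hvP, fun y hy => ?_⟩
      obtain ⟨z, hz, hzQ⟩ := h y hy
      exact ⟨z, by simpa using hz, mem_sup_sol_in₁.2 ⟨hu, hzQ⟩⟩
    · obtain ⟨v, hv, hvP, h⟩ := h₂ i u hu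
      refine ⟨v, by simpa using hv, hvP, fun y hy => ?_⟩
      obtain ⟨z, hz, hzQ⟩ := h y hy
      exact ⟨z, by simpa using hz, mem_sup_sol_in₂.2 ⟨hu, hzQ⟩⟩

theorem Reduces.inf_le_left (P Q : Family ι) : Reduces (inf P Q) P := by
  refine .of_fun EffFun.id.fst EffFun.id.snd.in₁ ?_
  rintro i _ ⟨u, hu, v, hv, rfl⟩
  refine ⟨by simpa using hu, fun y hy => ?_⟩
  rw [fst_pair] at hy
  exact mem_inf_sol.2 ⟨hu, hv, .inl ⟨y, hy, by simp⟩⟩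

theorem Reduces.inf_le_right (P Q : Family ι) : Reduces (inf P Q) Q := by
  refine .of_fun EffFun.id.snd EffFun.id.snd.in₂ ?_
  rintro i _ ⟨u, hu, v, hv, rfl⟩
  refine ⟨by simpa using hv, fun y hy => ?_⟩
  rw [snd_pair] at hy
  exact mem_inf_sol.2 ⟨hu, hv, .inr ⟨y, hy, by simp⟩⟩

theorem Reduces.le_inf {P Q R : Family ι} (h₁ : Reduces P Q) (h₂ : Reduces P R) :
    Reduces P (inf Q R) := by
  obtain ⟨φ, ψ, hφ, hψ, h₁⟩ := h₁
  obtain ⟨φ', ψ', hφ', hψ', h₂⟩ := h₂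
  have I := EffFun.id
  refine Reduces.of_eff (F := fun u => (app φ u).bind fun x => (app φ' u).map (pair x))
    (G := fun p => if snd p 0 = 0 then app ψ (pair (fst p) (tail (snd p)))
      else app ψ' (pair (fst p) (tail (snd p)))) ?_ ?_ ?_
  · exact Eff.pairing (.of_code hφ) (.of_code hφ')
  · exact Eff.ite I.snd ((Eff.of_code hψ).comp_fun (I.fst.pair I.snd.tail))
      ((Eff.of_code hψ').comp_fun (I.fst.pair I.snd.tail))
  · intro i u hu
    obtain ⟨v, hv, hvQ, h₁⟩ := h₁ i u hu
    obtain ⟨w, hw, hwR, h₂⟩ := h₂ i u hu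
    refine ⟨pair v w, Part.mem_bind_iff.2 ⟨v, hv, Part.mem_map _ hw⟩,
      pair_mem_inf_dom.2 ⟨hvQ, hwR⟩, fun y hy => ?_⟩
    rcases (mem_inf_sol.1 hy).2.2 with ⟨x, hx, rfl⟩ | ⟨x, hx, rfl⟩
    · obtain ⟨z, hz, hzP⟩ := h₁ x hx
      exact ⟨z, by simpa using hz, hzP⟩
    · obtain ⟨z, hz, hzP⟩ := h₂ x hx
      exact ⟨z, by simpa using hz, hzP⟩

/-- Case distinction for total functionals. -/
theorem EffFun.ite {f g t : Baire → Baire} (ht : EffFun t) (hf : EffFun f) (hg : EffFun g) :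
    EffFun fun p => if t p 0 = 0 then f p else g p :=
  .of_eff (Eff.ite ht hf hg) fun p => by split_ifs <;> simp

theorem Reduces.inf_sup_distrib (P Q R : Family ι) :
    Reduces (inf P (sup Q R))
      (sup (inf P Q) (inf P R)) := by
  have I := EffFun.id
  refine .of_fun (f := fun p => if snd p 0 = 0 then in₁ (pair (fst p) (tail (snd p)))
      else in₂ (pair (fst p) (tail (snd p)))) (g := snd)
    (EffFun.ite I.snd (I.fst.pair I.snd.tail).in₁ (I.fst.pair I.snd.tail).in₂) I.snd ?_
  rintro i _ ⟨u, hu, _, ⟨v, hv, rfl⟩ | ⟨v, hv, rfl⟩, rfl⟩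
  · simp only [fst_pair, snd_pair, in₁_zero, if_true, tail_in₁]
    refine ⟨in₁_mem_sup_dom.2 (pair_mem_inf_dom.2 ⟨hu, hv⟩), fun y hy => ?_⟩
    refine mem_inf_sol.2 ⟨hu, in₁_mem_sup_dom.2 hv, ?_⟩
    rcases (mem_inf_sol.1 (mem_sup_sol_in₁.1 hy).2).2.2 with h | ⟨x, hx, rfl⟩
    · exact .inl h
    · exact .inr ⟨x, mem_sup_sol_in₁.2 ⟨hv, hx⟩, rfl⟩
  · simp only [fst_pair, snd_pair, in₂_zero, one_ne_zero, if_false, tail_in₂]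
    refine ⟨in₂_mem_sup_dom.2 (pair_mem_inf_dom.2 ⟨hu, hv⟩), fun y hy => ?_⟩
    refine mem_inf_sol.2 ⟨hu, in₂_mem_sup_dom.2 hv, ?_⟩
    rcases (mem_inf_sol.1 (mem_sup_sol_in₂.1 hy).2).2.2 with h | ⟨x, hx, rfl⟩
    · exact .inl h
    · exact .inr ⟨x, mem_sup_sol_in₂.2 ⟨hv, hx⟩, rfl⟩

theorem Reduces.comp_one_le (P : Family ι) : Reduces (comp P one) P := by
  have I := EffFun.id
  refine .of_eff (F := fun p => app (snd p) unitElt)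
    (G := fun p => Part.some (pair unitElt (snd p)))
    (Eff.app I.snd .unitElt) (EffFun.unitElt.pair I.snd) ?_
  rintro i _ ⟨u, rfl, c, rfl, h⟩
  obtain ⟨v, hv, hvP⟩ := h unitElt rfl
  refine ⟨v, by simpa using hv, hvP, fun y hy => ⟨_, Part.mem_some _, ?_⟩⟩
  exact mem_comp_sol.2 ⟨rfl, unitElt, rfl, v, hv, y, hy, by simp⟩

theorem Reduces.le_comp_one (P : Family ι) : Reduces P (comp P one) := by
  have I := EffFun.id
  obtain ⟨k, hk, hk'⟩ := Eff.lam (F := fun q => Part.some (fst q)) I.fst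
  have hk'' : ∀ p y, p ∈ app (k p) y := fun p y => hk' p y p (by simp)
  refine .of_fun (EffFun.unitElt.pair hk) I.snd.snd fun i u hu => ⟨?_, fun y₀ hy₀ => ?_⟩
  · exact pair_mem_comp_dom.2 ⟨rfl, fun x _ => ⟨u, hk'' u x, hu⟩⟩
  · obtain ⟨-, x, -, v, hv, y, hy, rfl⟩ := mem_comp_sol.1 hy₀
    rw [Part.mem_unique hv (hk'' u x)] at hy
    simpa using hy

theorem Reduces.one_comp_le (P : Family ι) : Reduces (comp one P) P := by
  have I := EffFun.id
  refine .of_fun (f := fst) (g := fun p => pair (snd p) unitElt) I.fst (I.snd.pair .unitElt) ?_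
  rintro i _ ⟨u, hu, c, rfl, h⟩
  simp only [fst_pair, snd_pair]
  refine ⟨hu, fun y hy => ?_⟩
  obtain ⟨v, hv, rfl⟩ := h y hy
  exact mem_comp_sol.2 ⟨hu, y, hy, _, hv, unitElt, rfl, rfl⟩

theorem Reduces.le_one_comp (P : Family ι) : Reduces P (comp one P) := by
  have I := EffFun.id
  obtain ⟨k, hk, hk'⟩ := Eff.lam (F := fun _ => Part.some unitElt) EffFun.unitElt
  refine .of_fun (I.pair hk) I.snd.fst fun i u hu => ⟨?_, fun y hy => ?_⟩
  · exact pair_mem_comp_dom.2 ⟨hu, fun x _ => ⟨unitElt, hk' u x _ (by simp), rfl⟩⟩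
  · obtain ⟨-, x, hx, v, hv, y, hy, rfl⟩ := mem_comp_sol.1 hy
    simpa using hx

theorem Reduces.assoc_le (P Q R : Family ι) : Reduces (comp P (comp Q R))
    (comp (comp P Q) R) := by
  have I := EffFun.id
  -- `k ⟨x, d⟩` is a code of `y ↦ d · ⟨x, y⟩`, and `m ⟨c, d⟩` is a code of `x ↦ ⟨c · x, k ⟨x, d⟩⟩`.
  obtain ⟨k, hk, hk'⟩ := Eff.lam
    (F := fun q => app (snd (fst q)) (pair (fst (fst q)) (snd q)))
    (Eff.app I.fst.snd (I.fst.fst.pair I.snd))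
  obtain ⟨m, hm, hm'⟩ := Eff.lam
    (F := fun q => (app (fst (fst q)) (snd q)).bind fun v => Part.some
      (pair v (k (pair (snd q) (snd (fst q))))))
    (Eff.bind (G := fun q v => Part.some (pair v (k (pair (snd q) (snd (fst q))))))
      (Eff.app I.fst.fst I.snd)
      (I.snd.pair (hk.comp (I.fst.snd.pair I.fst.fst.snd))))
  have hm'' : ∀ {c d x v}, v ∈ app c x → pair v (k (pair x d)) ∈ app (m (pair c d)) x :=
    fun h => hm' _ _ _ (Part.mem_bind_iff.2 ⟨_, by simpa using h, by simp⟩)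
  have hk'' : ∀ {x d y v}, v ∈ app d (pair x y) → v ∈ app (k (pair x d)) y :=
    fun h => hk' _ _ _ (by simpa using h)
  refine .of_fun (f := fun p => pair (fst (fst p)) (m (pair (snd (fst p)) (snd p))))
    (g := fun p => pair (pair (fst (snd p)) (fst (snd (snd p)))) (snd (snd (snd p))))
    (I.fst.fst.pair (hm.comp (I.fst.snd.pair I.snd)))
    ((I.snd.fst.pair I.snd.snd.fst).pair I.snd.snd.snd) ?_
  rintro i _ ⟨_, ⟨u, hu, c, rfl, hc⟩, d, rfl, hd⟩
  simp only [fst_pair, snd_pair]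
  have hd' : ∀ x ∈ (R i).sol u, ∀ v ∈ app c x, ∀ y ∈ (Q i).sol v, ∃ w ∈ app d (pair x y), w ∈ (P i).dom :=
    fun x hx v hv y hy => hd _ (mem_comp_sol.2 ⟨hu, x, hx, v, hv, y, hy, rfl⟩)
  refine ⟨pair_mem_comp_dom.2 ⟨hu, fun x hx => ?_⟩, fun z₀ hz₀ => ?_⟩
  · obtain ⟨v, hv, hvQ⟩ := hc x hx
    refine ⟨_, hm'' hv, pair_mem_comp_dom.2 ⟨hvQ, fun y hy => ?_⟩⟩
    obtain ⟨w, hw, hwP⟩ := hd' x hx v hv y hy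
    exact ⟨w, hk'' hw, hwP⟩
  · obtain ⟨-, x, hx, v', hv', yz, hyz, rfl⟩ := mem_comp_sol.1 hz₀
    obtain ⟨v, hv, hvQ⟩ := hc x hx
    obtain rfl := Part.mem_unique hv' (hm'' hv)
    obtain ⟨-, y, hy, w', hw', z, hz, rfl⟩ := mem_comp_sol.1 hyz
    obtain ⟨w, hw, hwP⟩ := hd' x hx v hv y hy
    obtain rfl := Part.mem_unique hw' (hk'' hw)
    simp only [fst_pair, snd_pair]
    exact mem_comp_sol.2 ⟨pair_mem_comp_dom.2 ⟨hu, hc⟩, pair x y,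
      mem_comp_sol.2 ⟨hu, x, hx, v, hv, y, hy, rfl⟩, w', hw, z, hz, rfl⟩

theorem Reduces.le_assoc (P Q R : Family ι) : Reduces (comp (comp P Q) R)
    (comp P (comp Q R)) := by
  have I := EffFun.id
  -- `k c` is a code of `x ↦ fst (c · x)`, and `m c` is a code of `⟨x, y⟩ ↦ snd (c · x) · y`.
  obtain ⟨k, hk, hk'⟩ := Eff.lam (F := fun q => (app (fst q) (snd q)).map fst)
    (Eff.map I.fst (Eff.app I.fst I.snd))
  obtain ⟨m, hm, hm'⟩ := Eff.lam
    (F := fun q => (app (fst q) (fst (snd q))).bind fun v => app (snd v) (snd (snd q)))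
    (Eff.bind (G := fun q v => app (snd v) (snd (snd q))) (Eff.app I.fst I.snd.fst)
      (Eff.app I.snd.snd I.fst.snd.snd))
  have hk'' : ∀ {c x v d}, pair v d ∈ app c x → v ∈ app (k c) x := fun h =>
    hk' _ _ _ ((Part.mem_map_iff _).2 ⟨_, by simpa using h, by simp⟩)
  have hm'' : ∀ {c x v d y w}, pair v d ∈ app c x → w ∈ app d y → w ∈ app (m c) (pair x y) :=
    fun h h' => hm' _ _ _ (Part.mem_bind_iff.2 ⟨_, by simpa using h, by simpa using h'⟩)
  refine .of_fun (f := fun p => pair (pair (fst p) (k (snd p))) (m (snd p)))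
    (g := fun p => pair (fst (fst (snd p))) (pair (snd (fst (snd p))) (snd (snd p))))
    ((I.fst.pair (hk.comp I.snd)).pair (hm.comp I.snd))
    (I.snd.fst.fst.pair (I.snd.fst.snd.pair I.snd.snd)) ?_
  rintro i _ ⟨u, hu, c, rfl, hc⟩
  simp only [fst_pair, snd_pair]
  have hc' : ∀ x ∈ (R i).sol u, ∃ v d, pair v d ∈ app c x ∧ v ∈ (Q i).dom ∧
      ∀ y ∈ (Q i).sol v, ∃ w ∈ app d y, w ∈ (P i).dom := by
    intro x hx
    obtain ⟨_, h, v, hv, d, rfl, hd⟩ := hc x hx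
    exact ⟨v, d, h, hv, hd⟩
  have hdom : pair u (k c) ∈ (comp Q R i).dom := by
    refine pair_mem_comp_dom.2 ⟨hu, fun x hx => ?_⟩
    obtain ⟨v, d, h, hv, -⟩ := hc' x hx
    exact ⟨v, hk'' h, hv⟩
  refine ⟨pair_mem_comp_dom.2 ⟨hdom, fun xy hxy => ?_⟩, fun z₀ hz₀ => ?_⟩
  · obtain ⟨-, x, hx, v', hv', y, hy, rfl⟩ := mem_comp_sol.1 hxy
    obtain ⟨v, d, h, hv, hd⟩ := hc' x hx
    obtain rfl := Part.mem_unique hv' (hk'' h)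
    obtain ⟨w, hw, hwP⟩ := hd y hy
    exact ⟨w, hm'' h hw, hwP⟩
  · obtain ⟨-, xy, hxy, w', hw', z, hz, rfl⟩ := mem_comp_sol.1 hz₀
    obtain ⟨-, x, hx, v', hv', y, hy, rfl⟩ := mem_comp_sol.1 hxy
    obtain ⟨v, d, h, hv, hd⟩ := hc' x hx
    obtain rfl := Part.mem_unique hv' (hk'' h)
    obtain ⟨w, hw, hwP⟩ := hd y hy
    obtain rfl := Part.mem_unique hw' (hm'' h hw)
    simp only [fst_pair, snd_pair]
    exact mem_comp_sol.2 ⟨hu, x, hx, _, h, pair y z,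
      mem_comp_sol.2 ⟨hv, y, hy, w', hw, z, hz, rfl⟩, rfl⟩

theorem Reduces.comp_mono {P P' Q Q' : Family ι} (hP : Reduces P P') (hQ : Reduces Q Q') :
    Reduces (comp P Q) (comp P' Q') := by
  obtain ⟨φ, ψ, hφ, hψ, hP⟩ := hP
  obtain ⟨φ', ψ', hφ', hψ', hQ⟩ := hQ
  have I := EffFun.id
  -- `m ⟨u, c⟩` is a code that sends an answer `y` for `Q'` back to an answer for `Q`, applies `c`,
  -- and translates the resulting instance of `P` by `φ`.
  obtain ⟨m, hm, hm'⟩ := Eff.lam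
    (F := fun q => (app ψ' (pair (fst (fst q)) (snd q))).bind fun x =>
      (app (snd (fst q)) x).bind fun v => app φ v)
    (Eff.bind (G := fun q x => (app (snd (fst q)) x).bind fun v => app φ v)
      ((Eff.of_code hψ').comp_fun (I.fst.fst.pair I.snd))
      (Eff.bind (G := fun _ v => app φ v) (Eff.app I.fst.fst.snd I.snd)
        ((Eff.of_code hφ).comp_fun I.snd)))
  have hm'' : ∀ {u c y x v w}, x ∈ app ψ' (pair u y) → v ∈ app c x → w ∈ app φ v →
      w ∈ app (m (pair u c)) y := fun h1 h2 h3 =>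
    hm' _ _ _ (Part.mem_bind_iff.2 ⟨_, by simpa using h1,
      Part.mem_bind_iff.2 ⟨_, by simpa using h2, h3⟩⟩)
  refine .of_eff (F := fun p => (app φ' (fst p)).bind fun w => Part.some (pair w (m p)))
    (G := fun p => (app ψ' (pair (fst (fst p)) (fst (snd p)))).bind fun x =>
      (app (snd (fst p)) x).bind fun v => (app ψ (pair v (snd (snd p)))).map (pair x)) ?_ ?_ ?_
  · exact Eff.bind (G := fun p w => Part.some (pair w (m p)))
      ((Eff.of_code hφ').comp_fun I.fst) (I.snd.pair (hm.comp I.fst))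
  · refine Eff.bind (G := fun p x => (app (snd (fst p)) x).bind fun v =>
      (app ψ (pair v (snd (snd p)))).map (pair x))
      ((Eff.of_code hψ').comp_fun (I.fst.fst.pair I.snd.fst)) ?_
    refine Eff.bind (G := fun q v => (app ψ (pair v (snd (snd (fst q))))).map (pair (snd q)))
      (Eff.app I.fst.fst.snd I.snd) ?_
    exact (Eff.pairing I.fst.snd
      ((Eff.of_code hψ).comp_fun (I.snd.pair I.fst.fst.snd.snd))).mono fun p v hv => by
        simpa using hv
  · rintro i _ ⟨u, hu, c, rfl, hc⟩
    obtain ⟨v, hv, hvQ, hQ⟩ := hQ i u hu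
    refine ⟨pair v (m (pair u c)), Part.mem_bind_iff.2 ⟨v, by simpa using hv, by simp⟩,
      pair_mem_comp_dom.2 ⟨hvQ, fun y hy => ?_⟩, fun z₀ hz₀ => ?_⟩
    · obtain ⟨x, hx, hxQ⟩ := hQ y hy
      obtain ⟨w, hw, hwP⟩ := hc x hxQ
      obtain ⟨w', hw', hwP', -⟩ := hP i w hwP
      exact ⟨w', hm'' hx hw hw', hwP'⟩
    · obtain ⟨-, y, hy, w₀, hw₀, z, hz, rfl⟩ := mem_comp_sol.1 hz₀
      obtain ⟨x, hx, hxQ⟩ := hQ y hy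
      obtain ⟨w, hw, hwP⟩ := hc x hxQ
      obtain ⟨w', hw', hwP', h⟩ := hP i w hwP
      obtain rfl := Part.mem_unique hw₀ (hm'' hx hw hw')
      obtain ⟨z', hz', hzP⟩ := h z hz
      simp only [fst_pair, snd_pair]
      exact ⟨pair x z', Part.mem_bind_iff.2 ⟨x, hx, Part.mem_bind_iff.2 ⟨w, hw,
        Part.mem_map _ hz'⟩⟩, mem_comp_sol.2 ⟨hu, x, hxQ, w, hw, z', hzP, rfl⟩⟩

theorem Reduces.comp_zero_le (P : Family ι) : Reduces (comp P zero) zero :=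
  .of_fun .id .id fun _ _ ⟨_, h, _⟩ => h.elim

theorem Reduces.top_le_comp_top (P : Family ι) :
    Reduces top (comp P top) := by
  refine .of_fun (EffFun.unitElt.pair .unitElt) .id ?_
  rintro i _ rfl
  refine ⟨pair_mem_comp_dom.2 ⟨rfl, fun x hx => hx.elim⟩, fun y hy => ?_⟩
  obtain ⟨-, x, hx, -⟩ := mem_comp_sol.1 hy
  exact hx.elim

theorem Reduces.comp_sup_distrib (P Q R : Family ι) :
    Reduces (comp P (sup Q R))
      (sup (comp P Q) (comp P R)) := by
  have I := EffFun.id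
  refine .of_fun (f := fun p => if fst p 0 = 0 then in₁ (pair (tail (fst p)) (snd p))
      else in₂ (pair (tail (fst p)) (snd p))) (g := snd)
    (EffFun.ite I.fst (I.fst.tail.pair I.snd).in₁ (I.fst.tail.pair I.snd).in₂) I.snd ?_
  rintro i _ ⟨_, ⟨u, hu, rfl⟩ | ⟨u, hu, rfl⟩, c, rfl, hc⟩
  · simp only [fst_pair, snd_pair, in₁_zero, if_true, tail_in₁]
    refine ⟨in₁_mem_sup_dom.2 (pair_mem_comp_dom.2 ⟨hu, fun x hx =>
      hc x (mem_sup_sol_in₁.2 ⟨hu, hx⟩)⟩), fun y₀ hy₀ => ?_⟩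
    obtain ⟨-, x, hx, v, hv, y, hy, rfl⟩ := mem_comp_sol.1 (mem_sup_sol_in₁.1 hy₀).2
    exact mem_comp_sol.2 ⟨in₁_mem_sup_dom.2 hu, x, mem_sup_sol_in₁.2 ⟨hu, hx⟩, v, hv, y, hy, rfl⟩
  · simp only [fst_pair, snd_pair, in₂_zero, one_ne_zero, if_false, tail_in₂]
    refine ⟨in₂_mem_sup_dom.2 (pair_mem_comp_dom.2 ⟨hu, fun x hx =>
      hc x (mem_sup_sol_in₂.2 ⟨hu, hx⟩)⟩), fun y₀ hy₀ => ?_⟩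
    obtain ⟨-, x, hx, v, hv, y, hy, rfl⟩ := mem_comp_sol.1 (mem_sup_sol_in₂.1 hy₀).2
    exact mem_comp_sol.2 ⟨in₂_mem_sup_dom.2 hu, x, mem_sup_sol_in₂.2 ⟨hu, hx⟩, v, hv, y, hy, rfl⟩

theorem Reduces.comp_inf_distrib (P Q R : Family ι) :
    Reduces (inf (comp P Q) (comp P R))
      (comp P (inf Q R)) := by
  have I := EffFun.id
  obtain ⟨m, hm, hm'⟩ := Eff.lam
    (F := fun q => if snd q 0 = 0 then app (fst (fst q)) (tail (snd q))
      else app (snd (fst q)) (tail (snd q)))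
    (Eff.ite I.snd (Eff.app I.fst.fst I.snd.tail) (Eff.app I.fst.snd I.snd.tail))
  have hm₁ : ∀ {c d x v}, v ∈ app c x → v ∈ app (m (pair c d)) (in₁ x) := fun h =>
    hm' _ _ _ (by simpa using h)
  have hm₂ : ∀ {c d x v}, v ∈ app d x → v ∈ app (m (pair c d)) (in₂ x) := fun h =>
    hm' _ _ _ (by simpa using h)
  refine .of_fun (f := fun p => pair (pair (fst (fst p)) (fst (snd p)))
      (m (pair (snd (fst p)) (snd (snd p)))))
    (g := fun p => if fst (snd p) 0 = 0 then in₁ (pair (tail (fst (snd p))) (snd (snd p)))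
      else in₂ (pair (tail (fst (snd p))) (snd (snd p))))
    ((I.fst.fst.pair I.snd.fst).pair (hm.comp (I.fst.snd.pair I.snd.snd)))
    (EffFun.ite I.snd.fst (I.snd.fst.tail.pair I.snd.snd).in₁
      (I.snd.fst.tail.pair I.snd.snd).in₂) ?_
  rintro i _ ⟨_, ⟨u, hu, c, rfl, hc⟩, _, ⟨v, hv, d, rfl, hd⟩, rfl⟩
  simp only [fst_pair, snd_pair]
  refine ⟨pair_mem_comp_dom.2 ⟨pair_mem_inf_dom.2 ⟨hu, hv⟩, fun x₀ hx₀ => ?_⟩, fun y₀ hy₀ => ?_⟩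
  · rcases (mem_inf_sol.1 hx₀).2.2 with ⟨x, hx, rfl⟩ | ⟨x, hx, rfl⟩
    · obtain ⟨w, hw, hwP⟩ := hc x hx
      exact ⟨w, hm₁ hw, hwP⟩
    · obtain ⟨w, hw, hwP⟩ := hd x hx
      exact ⟨w, hm₂ hw, hwP⟩
  · refine mem_inf_sol.2 ⟨pair_mem_comp_dom.2 ⟨hu, hc⟩, pair_mem_comp_dom.2 ⟨hv, hd⟩, ?_⟩
    obtain ⟨-, _, hx₀, w', hw', y, hy, rfl⟩ := mem_comp_sol.1 hy₀
    rcases (mem_inf_sol.1 hx₀).2.2 with ⟨x, hx, rfl⟩ | ⟨x, hx, rfl⟩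
    · obtain ⟨w, hw, hwP⟩ := hc x hx
      obtain rfl := Part.mem_unique hw' (hm₁ hw)
      exact .inl ⟨_, mem_comp_sol.2 ⟨hu, x, hx, _, hw, y, hy, rfl⟩, by simp⟩
    · obtain ⟨w, hw, hwP⟩ := hd x hx
      obtain rfl := Part.mem_unique hw' (hm₂ hw)
      exact .inr ⟨_, mem_comp_sol.2 ⟨hv, x, hx, _, hw, y, hy, rfl⟩, by simp⟩

/-- The instance of `R` is kept until `Q` has been answered and is then offered next to the instance
of `P`. If `R` is the one that answers, the answer of `Q` is discarded. -/
theorem Reduces.half_distrib (P Q R : Family ι) :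
    Reduces (inf (comp P Q) R) (comp (inf P R) Q) := by
  have I := EffFun.id
  obtain ⟨m, hm, hm'⟩ := Eff.lam
    (F := fun q => (app (fst (fst q)) (snd q)).bind fun v => Part.some (pair v (snd (fst q))))
    (Eff.bind (G := fun q v => Part.some (pair v (snd (fst q)))) (Eff.app I.fst.fst I.snd)
      (I.snd.pair I.fst.fst.snd))
  have hm'' : ∀ {d v x w}, w ∈ app d x → pair w v ∈ app (m (pair d v)) x := fun h =>
    hm' _ _ _ (Part.mem_bind_iff.2 ⟨_, by simpa using h, by simp⟩)
  refine .of_fun (f := fun p => pair (fst (fst p)) (m (pair (snd (fst p)) (snd p))))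
    (g := fun p => if snd (snd p) 0 = 0 then in₁ (pair (fst (snd p)) (tail (snd (snd p))))
      else in₂ (tail (snd (snd p))))
    (I.fst.fst.pair (hm.comp (I.fst.snd.pair I.snd)))
    (EffFun.ite I.snd.snd (I.snd.fst.pair I.snd.snd.tail).in₁ I.snd.snd.tail.in₂) ?_
  rintro i _ ⟨_, ⟨u, hu, d, rfl, hd⟩, v, hv, rfl⟩
  simp only [fst_pair, snd_pair]
  refine ⟨pair_mem_comp_dom.2 ⟨hu, fun x hx => ?_⟩, fun y₀ hy₀ => ?_⟩
  · obtain ⟨w, hw, hwP⟩ := hd x hx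
    exact ⟨_, hm'' hw, pair_mem_inf_dom.2 ⟨hwP, hv⟩⟩
  · refine mem_inf_sol.2 ⟨pair_mem_comp_dom.2 ⟨hu, hd⟩, hv, ?_⟩
    obtain ⟨-, x, hx, w', hw', y₁, hy₁, rfl⟩ := mem_comp_sol.1 hy₀
    obtain ⟨w, hw, hwP⟩ := hd x hx
    obtain rfl := Part.mem_unique hw' (hm'' hw)
    rcases (mem_inf_sol.1 hy₁).2.2 with ⟨y, hy, rfl⟩ | ⟨y, hy, rfl⟩
    · exact .inl ⟨_, mem_comp_sol.2 ⟨hu, x, hx, w, hw, y, hy, rfl⟩, by simp⟩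
    · exact .inr ⟨y, hy, by simp⟩

theorem Reduces.one_le_diamond (P : Family ι) : Reduces one (diamond P) := by
  refine .of_fun EffFun.id EffFun.id.snd ?_
  rintro i _ rfl
  refine ⟨DiamondDom.unit, fun y hy => ?_⟩
  rw [mem_diamond_sol_unit.1 hy, snd_pair]
  rfl

theorem Reduces.diamond_comp_le (P : Family ι) :
    Reduces (comp (diamond P) P) (diamond P) := by
  refine .of_fun EffFun.id EffFun.id.snd ?_
  rintro i _ ⟨u, hu, c, rfl, hc⟩
  refine ⟨DiamondDom.step u c hu (fun x hx => ?_) fun x hx v hv => ?_, fun y hy => ?_⟩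
  · obtain ⟨v, hv, -⟩ := hc x hx
    exact Part.dom_iff_mem.2 ⟨v, hv⟩
  · obtain ⟨v', hv', h⟩ := hc x hx
    rwa [Part.mem_unique hv hv']
  · rw [snd_pair]
    exact mem_comp_sol.2 (mem_diamond_sol_pair.1 hy)

/-- Both maps recurse through the instance of `R^⋄`: at `⟨⟩` the continuation is run, at `⟨u, c⟩`
the hypothesis is applied once and the recursive calls sit inside the continuation it is given. The
recursion theorem supplies the codes, and well-foundedness of `DiamondDom` gives correctness. -/
theorem Reduces.diamond_induction {P Q R : Family ι}
    (h : Reduces (inf P (comp Q R)) Q) :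
    Reduces (inf P (comp Q (diamond R))) Q := by
  obtain ⟨φ, ψ, hφ, hψ, h⟩ := h
  have I := EffFun.id
  -- `k (pair x d)` is the code of `y ↦ d · ⟨x, y⟩`
  obtain ⟨k, hk, hk'⟩ := Eff.lam
    (F := fun q => app (snd (fst q)) (pair (fst (fst q)) (snd q)))
    (Eff.app I.fst.snd (I.fst.fst.pair I.snd))
  have hk'' : ∀ {x d y v}, v ∈ app d (pair x y) → v ∈ app (k (pair x d)) y :=
    fun h => hk' _ _ _ (by simpa using h)
  -- `m (pair r (pair p (pair c d)))` is the code of `x ↦ r · ⟨p, ⟨c · x, k ⟨x, d⟩⟩⟩`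
  obtain ⟨m, hm, hm'⟩ := Eff.lam
    (F := fun q => (app (fst (snd (snd (fst q)))) (snd q)).bind fun v =>
      app (fst (fst q)) (pair (fst (snd (fst q)))
        (pair v (k (pair (snd q) (snd (snd (snd (fst q)))))))))
    (Eff.bind (G := fun q v => app (fst (fst q)) (pair (fst (snd (fst q)))
        (pair v (k (pair (snd q) (snd (snd (snd (fst q)))))))))
      (Eff.app I.fst.snd.snd.fst I.snd)
      (Eff.app I.fst.fst.fst (I.fst.fst.snd.fst.pair (I.snd.pair
        (hk.comp (I.fst.snd.pair I.fst.fst.snd.snd.snd))))))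
  have hm'' : ∀ {r p c d x v w}, v ∈ app c x → w ∈ app r (pair p (pair v (k (pair x d)))) →
      w ∈ app (m (pair r (pair p (pair c d)))) x := fun h1 h2 =>
    hm' _ _ _ (Part.mem_bind_iff.2 ⟨_, by simpa using h1, by simpa using h2⟩)
  -- `inst (pair r (pair p (pair q d)))` is the instance for the hypothesis
  let inst : Baire → Baire := fun a => pair (fst (snd a)) (pair (fst (fst (snd (snd a))))
    (m (pair (fst a) (pair (fst (snd a)) (pair (snd (fst (snd (snd a)))) (snd (snd (snd a))))))))
  have hinst : EffFun inst := I.snd.fst.pair (I.snd.snd.fst.fst.pair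
    (hm.comp (I.fst.pair (I.snd.fst.pair (I.snd.snd.fst.snd.pair I.snd.snd.snd)))))
  have inst_eq : ∀ {r p u c d}, inst (pair r (pair p (pair (pair u c) d))) =
      pair p (pair u (m (pair r (pair p (pair c d))))) := by
    intro r p u c d
    simp [inst]
  -- The forward map on `⟨p, ⟨q, d⟩⟩`. The first entry of `q` separates `⟨⟩`, where it is `0`, from
  -- pairs, where it is `2`.
  obtain ⟨r, hr, hr'⟩ := Eff.exists_fixpoint
    (F := fun a => if fst (snd (snd a)) 0 = 0 then app (snd (snd (snd a))) unitElt
      else app φ (inst a))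
    (Eff.ite I.snd.snd.fst (Eff.app I.snd.snd.snd .unitElt) ((Eff.of_code hφ).comp_fun hinst))
  -- the final answer of the backward functional
  let out : Baire → Baire → Baire := fun x w =>
    if w 0 = 0 then w else in₂ (pair (pair x (fst (tail w))) (snd (tail w)))
  have hout : EffFun fun a => out (fst a) (snd a) :=
    EffFun.ite I.snd I.snd ((I.fst.pair I.snd.tail.fst).pair I.snd.tail.snd).in₂
  -- The backward map. `ψ` returns either an answer of `P`, which is final, or `⟨x, z'⟩` with `x` an
  -- answer of `R`. In the latter case the map calls itself on the instance `c · x` with the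
  -- continuation `k ⟨x, d⟩` and the answer `z'`.
  obtain ⟨t, ht, ht'⟩ := Eff.exists_fixpoint
    (F := fun a => if fst (snd (fst (snd a))) 0 = 0 then
        Part.some (in₂ (pair unitElt (snd (snd a))))
      else (app ψ (pair (inst (pair r (fst (snd a)))) (snd (snd a)))).bind fun w =>
        if w 0 = 0 then Part.some w else
          (app (snd (fst (snd (fst (snd a))))) (fst (tail w))).bind fun v =>
            (app (fst a) (pair (pair (fst (fst (snd a)))
              (pair v (k (pair (fst (tail w)) (snd (snd (fst (snd a)))))))) (snd (tail w)))).map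
            (out (fst (tail w)))) (by
    refine Eff.ite I.snd.fst.snd.fst (EffFun.unitElt.pair I.snd.snd).in₂ ?_
    refine Eff.bind (G := fun a w => if w 0 = 0 then Part.some w else
          (app (snd (fst (snd (fst (snd a))))) (fst (tail w))).bind fun v =>
            (app (fst a) (pair (pair (fst (fst (snd a)))
              (pair v (k (pair (fst (tail w)) (snd (snd (fst (snd a)))))))) (snd (tail w)))).map
            (out (fst (tail w)))) ((Eff.of_code hψ).comp_fun
              ((hinst.comp ((EffFun.const hr).pair I.snd.fst)).pair I.snd.snd)) ?_
    refine Eff.ite I.snd I.snd ?_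
    refine Eff.bind (G := fun q v => (app (fst (fst q)) (pair (pair (fst (fst (snd (fst q))))
              (pair v (k (pair (fst (tail (snd q))) (snd (snd (fst (snd (fst q))))))))) (snd (tail (snd q))))).map
            (out (fst (tail (snd q))))) (Eff.app I.fst.snd.fst.snd.fst.snd I.snd.tail.fst) ?_
    refine (Eff.map hout (Eff.pairing (F := fun q => Part.some (fst (tail (snd (fst q)))))
      I.fst.snd.tail.fst (Eff.app I.fst.fst.fst ((I.fst.fst.snd.fst.fst.pair (I.snd.pair
        (hk.comp (I.fst.snd.tail.fst.pair I.fst.fst.snd.fst.snd.snd)))).pair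
          I.fst.snd.tail.snd)))).mono fun q v hv => ?_
    simpa [Part.map_map, Function.comp_def] using hv)
  have key : ∀ i q, DiamondDom (R i) q → ∀ p ∈ (P i).dom, ∀ d,
      (∀ x ∈ (diamond R i).sol q, ∃ v ∈ app d x, v ∈ (Q i).dom) →
      ∃ v ∈ app r (pair p (pair q d)), v ∈ (Q i).dom ∧ ∀ z ∈ (Q i).sol v,
        ∃ s ∈ app t (pair (pair p (pair q d)) z),
          (∃ x ∈ (P i).sol p, s = in₁ x) ∨
          ∃ x ∈ (diamond R i).sol q, ∃ v ∈ app d x, ∃ y ∈ (Q i).sol v, s = in₂ (pair x y) := by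
    intro i q hq
    induction hq with
    | unit =>
      intro p hp d hd
      obtain ⟨v, hv, hvQ⟩ := hd unitElt DiamondSol.unit
      refine ⟨v, hr' _ _ (by simpa [unitElt] using hv), hvQ, fun z hz => ?_⟩
      refine ⟨in₂ (pair unitElt z), ht' _ _ (by simp [unitElt]), .inr ?_⟩
      exact ⟨unitElt, DiamondSol.unit, v, hv, z, hz, rfl⟩
    | step u c hu hc hcd ih =>
      intro p hp d hd
      have hd' : ∀ x ∈ (R i).sol u, ∀ v ∈ app c x, ∀ y ∈ (diamond R i).sol v,
          ∃ w ∈ app d (pair x y), w ∈ (Q i).dom := fun x hx v hv y hy =>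
        hd _ (DiamondSol.step u c x v y hu hx hv hy)
      have ih' : ∀ x ∈ (R i).sol u, ∀ v ∈ app c x, _ := fun x hx v hv =>
        ih x hx v hv p hp (k (pair x d)) fun y hy => by
          obtain ⟨w, hw, hwQ⟩ := hd' x hx v hv y hy
          exact ⟨w, hk'' hw, hwQ⟩
      obtain ⟨v, hv, hvQ, hback⟩ := h i (pair p (pair u (m (pair r (pair p (pair c d)))))) (by
        refine pair_mem_inf_dom.2 ⟨hp, pair_mem_comp_dom.2 ⟨hu, fun x hx => ?_⟩⟩
        obtain ⟨v₀, hv₀⟩ := Part.dom_iff_mem.1 (hc x hx)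
        obtain ⟨v, hv, hvQ, -⟩ := ih' x hx v₀ hv₀
        exact ⟨v, hm'' hv₀ hv, hvQ⟩)
      refine ⟨v, hr' _ _ ?_, hvQ, fun z hz => ?_⟩
      · simpa [inst_eq] using hv
      obtain ⟨w, hw, hwsol⟩ := hback z hz
      have hunfold : ∀ s, s ∈ (if w 0 = 0 then Part.some w else
          (app c (fst (tail w))).bind fun v =>
            (app t (pair (pair p (pair v (k (pair (fst (tail w)) d)))) (snd (tail w)))).map
            (out (fst (tail w)))) → s ∈ app t (pair (pair p (pair (pair u c) d)) z) := by
        intro s hs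
        refine ht' _ _ ?_
        simp only [snd_pair, fst_pair, pair_zero, OfNat.ofNat_ne_zero, if_false, inst_eq]
        exact Part.mem_bind_iff.2 ⟨w, hw, hs⟩
      rcases (mem_inf_sol.1 hwsol).2.2 with ⟨x, hx, rfl⟩ | ⟨w, hwsol₁, rfl⟩
      · exact ⟨in₁ x, hunfold _ (by simp), .inl ⟨x, hx, rfl⟩⟩
      obtain ⟨-, x, hx, v₁, hv₁, z', hz', rfl⟩ := mem_comp_sol.1 hwsol₁
      obtain ⟨v₀, hv₀⟩ := Part.dom_iff_mem.1 (hc x hx)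
      obtain ⟨v₂, hv₂, hvQ₂, hback₂⟩ := ih' x hx v₀ hv₀
      obtain rfl := Part.mem_unique hv₁ (hm'' hv₀ hv₂)
      obtain ⟨s, hs, hs'⟩ := hback₂ z' hz'
      refine ⟨out x s, hunfold _ ?_, ?_⟩
      · simp only [in₂_zero, one_ne_zero, if_false, tail_in₂, fst_pair, snd_pair]
        exact Part.mem_bind_iff.2 ⟨v₀, hv₀, Part.mem_map _ hs⟩
      · rcases hs' with ⟨a, ha, rfl⟩ | ⟨y, hy, v₃, hv₃, b, hb, rfl⟩
        · exact .inl ⟨a, ha, by simp [out]⟩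
        · obtain ⟨w', hw', -⟩ := hd' x hx v₀ hv₀ y hy
          obtain rfl := Part.mem_unique hv₃ (hk'' hw')
          exact .inr ⟨pair x y, DiamondSol.step u c x v₀ y hu hx hv₀ hy, v₃, hw', b, hb,
            by simp [out]⟩
  refine Reduces.of_eff (.of_code hr) (.of_code ht) ?_
  rintro i _ ⟨p, hp, _, ⟨q, hq, d, rfl, hd⟩, rfl⟩
  obtain ⟨v, hv, hvQ, hback⟩ := key i q hq p hp d hd
  refine ⟨v, hv, hvQ, fun z hz => ?_⟩
  obtain ⟨s, hs, hs'⟩ := hback z hz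
  refine ⟨s, hs, mem_inf_sol.2 ⟨hp, pair_mem_comp_dom.2 ⟨hq, hd⟩, ?_⟩⟩
  rcases hs' with h | ⟨x, hx, v, hv, y, hy, rfl⟩
  · exact .inl h
  · exact .inr ⟨_, mem_comp_sol.2 ⟨hq, x, hx, v, hv, y, hy, rfl⟩, rfl⟩

end Family

/-- Soundness of the axioms, uniformly in the interpretation of the letters. -/
theorem Derives.reduces {α : Type*} {e f : Term α} (h : Derives e f) :
    Family.Reduces (fun ρ : α → Problem => e.interp ρ) fun ρ => f.interp ρ := by
  induction h with
  | trans _ _ h₁ h₂ => exact h₁.trans h₂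
  | zero_le => exact Family.Reduces.zero_le _
  | le_top => exact Family.Reduces.le_top _
  | le_sup_left => exact Family.Reduces.le_sup_left _ _
  | le_sup_right => exact Family.Reduces.le_sup_right _ _
  | sup_le _ _ h₁ h₂ => exact h₁.sup_le h₂
  | inf_le_left => exact Family.Reduces.inf_le_left _ _
  | inf_le_right => exact Family.Reduces.inf_le_right _ _
  | le_inf _ _ h₁ h₂ => exact h₁.le_inf h₂
  | inf_sup_distrib => exact Family.Reduces.inf_sup_distrib _ _ _
  | comp_one_le => exact Family.Reduces.comp_one_le _
  | le_comp_one => exact Family.Reduces.le_comp_one _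
  | one_comp_le => exact Family.Reduces.one_comp_le _
  | le_one_comp => exact Family.Reduces.le_one_comp _
  | assoc_le => exact Family.Reduces.assoc_le _ _ _
  | le_assoc => exact Family.Reduces.le_assoc _ _ _
  | comp_mono _ _ h₁ h₂ => exact h₁.comp_mono h₂
  | comp_zero_le => exact Family.Reduces.comp_zero_le _
  | top_le_comp_top => exact Family.Reduces.top_le_comp_top _
  | comp_sup_distrib => exact Family.Reduces.comp_sup_distrib _ _ _
  | comp_inf_distrib => exact Family.Reduces.comp_inf_distrib _ _ _
  | half_distrib => exact Family.Reduces.half_distrib _ _ _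
  | one_le_diamond => exact Family.Reduces.one_le_diamond _
  | diamond_comp_le => exact Family.Reduces.diamond_comp_le _
  | diamond_induction _ h => exact h.diamond_induction

theorem Derives.valid {α : Type*} {e f : Term α} (h : Derives e f) : Valid e f := fun ρ => by
  obtain ⟨φ, ψ, hφ, hψ, h⟩ := h.reduces
  exact ⟨φ, ψ, hφ, hψ, h ρ⟩

end Weih

namespace Weih

/-! ## Mutually generic points of Baire space -/

/-- The join of finitely many points. -/
def join : List Baire → Baire
  | [] => unitElt
  | p :: l => pair p (join l)

theorem join_congr {ι : Type*} {W W' : ι → Baire} {L : List ι} {k : ℕ}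
    (h : ∀ j ∈ L, ∀ n < k, W j n = W' j n) :
    ∀ n < k, join (L.map W) n = join (L.map W') n := by
  induction L with
  | nil => exact fun _ _ => rfl
  | cons j L ih =>
    rintro (_ | n) hn
    · rfl
    · have h1 := h j (by simp) (n / 2) (by omega)
      have h2 := ih (fun j hj => h j (by simp [hj])) (n / 2) (by omega)
      simp only [List.map_cons, join, pair, cons, h1, h2]

/-- The two families agree on their first `N` values at the first `N` indices. -/
def AgreeUpTo (N : ℕ) (W W' : ℕ → Baire) : Prop := ∀ j < N, ∀ n < N, W j n = W' j n

/-- Finite extension: the point at `i` can be forced not to be computed by `c` from the points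
in `L`. -/
theorem exists_extension (c : Baire) {L : List ℕ} {i : ℕ} (hi : i ∉ L) (W₀ : ℕ → Baire) (N : ℕ) :
    ∃ W₁ N₁, N < N₁ ∧ AgreeUpTo N W₀ W₁ ∧
      ∀ W, AgreeUpTo N₁ W₁ W → W i ∉ app c (join (L.map W)) := by
  -- If some extension makes the output at `N` defined, the still undetermined entry `N` of the
  -- point at `i` is made different from it. Otherwise no extension yields a total output and
  -- nothing has to be done.
  by_cases h : ∃ W, AgreeUpTo N W₀ W ∧ ∃ k m, codeApprox c N (initSeg (join (L.map W)) k) = some m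
  · obtain ⟨W, hW, k, m, hm⟩ := h
    -- The new bound covers the index `i`, the entry `N`, the part `k` of the input that was read,
    -- and every index in `L`, since each is at most `L.sum`.
    refine ⟨Function.update W i (Function.update (W i) N (m + 1)), N + i + k + L.sum + 1,
      by omega, fun j hj n hn => ?_, fun W' hW' hmem => ?_⟩
    · rw [hW j hj n hn]
      rcases eq_or_ne j i with rfl | hji
      · rw [Function.update_self, Function.update_of_ne (by omega)]
      · rw [Function.update_of_ne hji]
    · obtain ⟨k', hk'⟩ := mem_app_iff_approximates.1 hmem N
      have heq : initSeg (join (L.map W')) k = initSeg (join (L.map W)) k := by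
        refine initSeg_congr (join_congr fun j hj n hn => ?_)
        have := List.le_sum_of_mem hj
        rw [← hW' j (by omega) n (by omega), Function.update_of_ne]
        rintro rfl
        exact hi hj
      rw [← heq] at hm
      have h1 := monoApprox_code c _ _ _ _ (initSeg_prefix (le_max_left k k')) hm
      have h2 := monoApprox_code c _ _ _ _ (initSeg_prefix (le_max_right k k')) hk'
      rw [h1, ← hW' i (by omega) N (by omega), Function.update_self, Function.update_self] at h2
      simp at h2
  · refine ⟨W₀, N + 1, by omega, fun _ _ _ _ => rfl, fun W hW hmem => h ⟨W, fun j hj n hn =>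
      hW j (by omega) n (by omega), ?_⟩⟩
    obtain ⟨k, hk⟩ := mem_app_iff_approximates.1 hmem N
    exact ⟨k, _, hk⟩

theorem exists_generic_nat : ∃ W : ℕ → Baire, ∀ c : Baire, Computable c → ∀ (L : List ℕ) (i : ℕ),
    i ∉ L → W i ∉ app c (join (L.map W)) := by
  let Req := {r : {c : ℕ → ℕ // Computable c} × List ℕ × ℕ // r.2.2 ∉ r.2.1}
  have : Nonempty Req := ⟨⟨(⟨fun _ => 0, Computable.const 0⟩, [], 0), by simp⟩⟩
  obtain ⟨req, hreq⟩ := exists_surjective_nat Req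
  choose next bound hlt hagree hforce using fun (r : Req) (W : ℕ → Baire) (N : ℕ) =>
    exists_extension r.1.1.1 r.2 W N
  -- There are countably many requirements; stage `s` meets the `s`-th one and freezes a larger
  -- finite part of the family.
  let st : ℕ → (ℕ → Baire) × ℕ := fun s => Nat.rec (fun _ => unitElt, 0)
    (fun s x => (next (req s) x.1 x.2, bound (req s) x.1 x.2)) s
  have hN : ∀ s, s ≤ (st s).2 := by
    intro s
    induction s with
    | zero => exact Nat.zero_le _
    | succ s ih => exact Nat.succ_le_of_lt (ih.trans_lt (hlt _ _ _))
  have hmono : ∀ s t, s ≤ t → (st s).2 ≤ (st t).2 ∧ AgreeUpTo (st s).2 (st s).1 (st t).1 := by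
    intro s t hst
    induction hst with
    | refl => exact ⟨le_rfl, fun _ _ _ _ => rfl⟩
    | step _ ih =>
      refine ⟨ih.1.trans (hlt _ _ _).le, fun j hj n hn => ?_⟩
      rw [ih.2 j hj n hn]
      exact hagree _ _ _ j (hj.trans_le ih.1) n (hn.trans_le ih.1)
  let W : ℕ → Baire := fun j n => (st (j + n + 1)).1 j n
  have hW : ∀ s, AgreeUpTo (st s).2 (st s).1 W := by
    intro s j hj n hn
    rcases le_total s (j + n + 1) with h | h
    · exact (hmono _ _ h).2 j hj n hn
    · have := hN (j + n + 1)
      exact ((hmono _ _ h).2 j (by omega) n (by omega)).symm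
  refine ⟨W, fun c hc L i hi => ?_⟩
  obtain ⟨s, hs⟩ := hreq ⟨(⟨c, hc⟩, L, i), hi⟩
  have := hforce (req s) (st s).1 (st s).2 W (hW (s + 1))
  rwa [hs] at this

/-- A family of points is generic if none of them is computable from finitely many others. -/
def Generic {ι : Type*} (w : ι → Baire) : Prop :=
  ∀ c : Baire, Computable c → ∀ (L : List ι) (i : ι), i ∉ L → w i ∉ app c (join (L.map w))

theorem exists_generic (ι : Type*) [Countable ι] : ∃ w : ι → Baire, Generic w := by
  obtain ⟨W, hW⟩ := exists_generic_nat
  obtain ⟨g, hg⟩ := exists_injective_nat ι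
  refine ⟨W ∘ g, fun c hc L i hi => ?_⟩
  rw [← List.map_map]
  refine hW c hc (L.map g) (g i) fun h => hi ?_
  obtain ⟨j, hj, hji⟩ := List.mem_map.1 h
  rwa [← hg hji]

/-- The points computable from finitely many points of the family `w` with index in `S`. -/
def Gen {ι : Type*} (w : ι → Baire) (S : Set ι) : Set Baire :=
  {x | ∃ L : List ι, (∀ i ∈ L, i ∈ S) ∧ ∃ c, Computable c ∧ x ∈ app c (join (L.map w))}

section Gen

variable {ι : Type*} {w : ι → Baire} {S T : Set ι}

theorem Gen.mono (h : S ⊆ T) : Gen w S ⊆ Gen w T := fun _ ⟨L, hL, hx⟩ =>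
  ⟨L, fun i hi => h (hL i hi), hx⟩

theorem Gen.of_eff {F : Baire → Part Baire} (hF : Eff F) {x y : Baire} (hx : x ∈ Gen w S)
    (hy : y ∈ F x) : y ∈ Gen w S := by
  obtain ⟨L, hL, c, hc, hx⟩ := hx
  obtain ⟨d, hd, h⟩ := Eff.comp hF (.of_code hc)
  exact ⟨L, hL, d, hd, h _ _ (Part.mem_bind_iff.2 ⟨x, hx, hy⟩)⟩

theorem Gen.of_effFun {f : Baire → Baire} (hf : EffFun f) {x : Baire} (hx : x ∈ Gen w S) :
    f x ∈ Gen w S :=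
  Gen.of_eff hf hx (Part.mem_some _)

theorem Gen.of_computable {x : Baire} (hx : Computable x) : x ∈ Gen w S := by
  obtain ⟨c, hc, h⟩ := EffFun.const hx
  exact ⟨[], by simp, c, hc, h _ _ (Part.mem_some _)⟩

theorem exists_split (w : ι → Baire) (L : List ι) : ∃ f g : Baire → Baire, EffFun f ∧ EffFun g ∧
    ∀ L', f (join ((L ++ L').map w)) = join (L.map w) ∧
      g (join ((L ++ L').map w)) = join (L'.map w) := by
  induction L with
  | nil => exact ⟨fun _ => unitElt, fun p => p, .unitElt, .id, fun L' => ⟨rfl, rfl⟩⟩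
  | cons i L ih =>
    obtain ⟨f, g, hf, hg, h⟩ := ih
    refine ⟨fun p => pair (fst p) (f (snd p)), fun p => g (snd p),
      EffFun.id.fst.pair (hf.comp EffFun.id.snd), hg.comp EffFun.id.snd, fun L' => ?_⟩
    simp [join, -List.map_append, h L']

theorem Gen.pair {x y : Baire} (hx : x ∈ Gen w S) (hy : y ∈ Gen w S) : pair x y ∈ Gen w S := by
  obtain ⟨L, hL, c, hc, hx⟩ := hx
  obtain ⟨L', hL', c', hc', hy⟩ := hy
  obtain ⟨f, g, hf, hg, h⟩ := exists_split w L
  obtain ⟨d, hd, hdF⟩ := Eff.pairing ((Eff.of_code hc).comp_fun hf) ((Eff.of_code hc').comp_fun hg)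
  refine ⟨L ++ L', ?_, d, hd, hdF _ _ ?_⟩
  · intro i hi
    exact (List.mem_append.1 hi).elim (hL i) (hL' i)
  · simp only [(h L').1, (h L').2]
    exact Part.mem_bind_iff.2 ⟨x, hx, Part.mem_map _ hy⟩

theorem Gen.fst {x : Baire} (hx : x ∈ Gen w S) : fst x ∈ Gen w S := Gen.of_effFun EffFun.id.fst hx

theorem Gen.snd {x : Baire} (hx : x ∈ Gen w S) : snd x ∈ Gen w S := Gen.of_effFun EffFun.id.snd hx

theorem Gen.app {c x y : Baire} (hc : c ∈ Gen w S) (hx : x ∈ Gen w S) (hy : y ∈ app c x) :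
    y ∈ Gen w S :=
  Gen.of_eff (x := Weih.pair c x) (Eff.app EffFun.id.fst EffFun.id.snd) (Gen.pair hc hx)
    (by simpa using hy)

theorem Gen.app_code {c x y : Baire} (hc : Computable c) (hx : x ∈ Gen w S) (hy : y ∈ Weih.app c x) :
    y ∈ Gen w S :=
  Gen.of_eff (.of_code hc) hx hy

theorem Gen.of_mem {i : ι} (hi : i ∈ S) : w i ∈ Gen w S := by
  obtain ⟨c, hc, h⟩ := EffFun.id.fst
  exact ⟨[i], by simpa using hi, c, hc, h _ _ (by simp [join])⟩

/-- This is how genericity is used: a point of the family can only be computed from a set of tokens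
that already contains its index. -/
theorem Generic.mem_of_gen (hw : Generic w) {i : ι} (h : w i ∈ Gen w S) : i ∈ S := by
  obtain ⟨L, hL, c, hc, h⟩ := h
  by_contra hi
  exact hw c hc L i (fun hiL => hi (hL i hiL)) h

theorem Generic.injective (hw : Generic w) : Function.Injective w := fun i j hij => by
  have : w i ∈ Gen w {j} := by
    rw [hij]
    exact Gen.of_mem (Set.mem_singleton j)
  exact Set.mem_singleton_iff.1 (hw.mem_of_gen this)

end Gen

/-- An injective coding of terms. -/
def Term.code {α : Type*} (g : α → ℕ) : Term α → ℕ
  | .letter a => Nat.pair 0 (g a)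
  | .zero => Nat.pair 1 0
  | .one => Nat.pair 2 0
  | .top => Nat.pair 3 0
  | .sup e f => Nat.pair 4 (Nat.pair (e.code g) (f.code g))
  | .inf e f => Nat.pair 5 (Nat.pair (e.code g) (f.code g))
  | .comp e f => Nat.pair 6 (Nat.pair (e.code g) (f.code g))
  | .diamond e => Nat.pair 7 (e.code g)

theorem Term.code_injective {α : Type*} {g : α → ℕ} (hg : Function.Injective g) :
    Function.Injective (Term.code g) := by
  intro e
  induction e with
  | letter a => rintro (_ | _) h <;> simp_all [Term.code, Nat.pair_eq_pair, hg.eq_iff]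
  | zero => rintro (_ | _) h <;> simp_all [Term.code, Nat.pair_eq_pair]
  | one => rintro (_ | _) h <;> simp_all [Term.code, Nat.pair_eq_pair]
  | top => rintro (_ | _) h <;> simp_all [Term.code, Nat.pair_eq_pair]
  | sup e f ihe ihf =>
    rintro (_ | _) h <;> simp [Term.code, Nat.pair_eq_pair] at h ⊢
    exact ⟨ihe h.1, ihf h.2⟩
  | inf e f ihe ihf =>
    rintro (_ | _) h <;> simp [Term.code, Nat.pair_eq_pair] at h ⊢
    exact ⟨ihe h.1, ihf h.2⟩
  | comp e f ihe ihf =>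
    rintro (_ | _) h <;> simp [Term.code, Nat.pair_eq_pair] at h ⊢
    exact ⟨ihe h.1, ihf h.2⟩
  | diamond e ih =>
    rintro (_ | _) h <;> simp [Term.code, Nat.pair_eq_pair] at h ⊢
    exact ih h

instance {α : Type*} [Countable α] : Countable (Term α) := by
  obtain ⟨g, hg⟩ := exists_injective_nat α
  exact (Term.code_injective hg).countable

end Weih

namespace Weih

variable {α : Type*}

/-! ## Losing positions of the simulation game -/

/-- Terms that Spoiler cannot decompose. -/
def Resting (t : Term α) : Prop := t.Active → t = .one

theorem alea_of_stuck {Γ : Set α} {X : Finset (Term α)} {e : Term α} {q : Position α}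
    (hX : Stuck X) (hpol : Position.pol ⟨Γ, X, e⟩ = .spoiler) (h : SimMove ⟨Γ, X, e⟩ q) :
    AleaMove ⟨Γ, X, e⟩ q := by
  cases h with
  | explore ht hex hs =>
    have := hX _ ht (.inl hex)
    subst this
    exact (step_one hs).elim
  | fork ht hall _ =>
    have := hX _ ht (.inr hall)
    subst this
    cases hall
  | alea h => exact h
  | choose h => rw [h] at hpol; cases hpol
  | junk h => rw [h] at hpol; cases hpol
  | fill h => rw [h] at hpol; cases hpol

/-- Only visits lower the stage index, so a lost position of Duplicator remains lost at the same
stage after any move. The next lemma does the same for a suitable alea move. -/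
theorem notMem_stage_of_duplicator {p q : Position α} {k : ℕ}
    (hp : p ∉ (simArena α).Stage k) (hpol : p.pol = .duplicator) (h : SimMove p q) :
    q ∉ (simArena α).Stage k := by
  intro hq
  cases k with
  | zero => exact hp trivial
  | succ j => exact hp (.duplicator hpol h hq)

theorem exists_alea_of_notMem_stage {Γ : Set α} {X : Finset (Term α)} {e : Term α} {k : ℕ}
    (hp : (⟨Γ, X, e⟩ : Position α) ∉ (simArena α).Stage k) (hX : Stuck X) (he : e.pol = .all) :
    ∃ e', Step e e' ∧ (⟨Γ, X, e'⟩ : Position α) ∉ (simArena α).Stage k := by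
  by_contra! hall
  have hpol : Position.pol ⟨Γ, X, e⟩ = .spoiler := pol_eq_spoiler_iff.2 (.inr (.inr he))
  cases k with
  | zero => exact hp trivial
  | succ j =>
    by_cases hs : ∃ e', Step e e'
    · obtain ⟨e', hs⟩ := hs
      have halea := AleaMove.intro (Γ := Γ) he hX hs
      refine hp (.spoiler hpol (fun h => h.2 ⟨_, halea⟩) ⟨_, .alea halea⟩ fun q hq => ?_)
      cases alea_of_stuck hX hpol hq with
      | intro _ _ hs => exact hall _ hs
    · have hno : ∀ q, ¬ AleaMove ⟨Γ, X, e⟩ q := by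
        rintro q ⟨-, -, hs'⟩
        exact hs ⟨_, hs'⟩
      exact hp (.visit hpol ⟨hpol, fun ⟨q, hq⟩ => hno q hq⟩ fun q hq =>
        (hno q (alea_of_stuck hX hpol hq)).elim)

theorem one_notMem_of_notMem_stage {Γ : Set α} {X : Finset (Term α)} {k : ℕ}
    (hp : (⟨Γ, X, .one⟩ : Position α) ∉ (simArena α).Stage k) (hX : Stuck X) : .one ∉ X := by
  intro h1
  have hpol : Position.pol ⟨Γ, X, .one⟩ = .spoiler := pol_eq_spoiler_iff.2 (.inr (.inl ⟨rfl, h1⟩))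
  have hno : ∀ q, ¬ AleaMove ⟨Γ, X, .one⟩ q := by
    rintro q ⟨h, -, -⟩
    cases h
  cases k with
  | zero => exact hp trivial
  | succ j =>
    exact hp (.visit hpol ⟨hpol, fun ⟨q, hq⟩ => hno q hq⟩ fun q hq =>
        (hno q (alea_of_stuck hX hpol hq)).elim)

open Classical in
/-- Spoiler decomposes the goals `D` until none of them can be decomposed. -/
theorem exists_resting_of_notMem_stage {Γ : Set α} {O : Finset (Term α)} (hO : Stuck O)
    {s : Term α} (k : ℕ) (D : List (Term α))
    (hp : (⟨Γ, O ∪ D.toFinset, s⟩ : Position α) ∉ (simArena α).Stage k) :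
    ∃ D' : List (Term α), ∃ k' ≤ k, (∀ y ∈ D', Resting y) ∧
      (⟨Γ, O ∪ D'.toFinset, s⟩ : Position α) ∉ (simArena α).Stage k' ∧
      Derives (meet D') (meet D) ∧ ((∀ y ∈ D, Resting y) ∨ k' < k) := by
  induction k generalizing D with
  | zero => exact (hp trivial).elim
  | succ j ih =>
    by_cases hD : ∀ y ∈ D, Resting y
    · exact ⟨D, j + 1, le_rfl, hD, hp, .refl _, .inl hD⟩
    have hmain : ∃ D₁ : List (Term α), Derives (meet D₁) (meet D) ∧
        (⟨Γ, O ∪ D₁.toFinset, s⟩ : Position α) ∉ (simArena α).Stage j := by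
      have hstuck : ¬ Stuck (O ∪ D.toFinset) := fun h => hD fun y hy =>
        h y (by simp [hy])
      have hwin := win_of_not_stuck (Γ := Γ) (e := s) hstuck
      have hpol := win_spoiler _ hwin
      by_contra! hno
      -- The position is a visit, so some successor is already lost at stage `j`. The explored or
      -- forked goals derive the old one, because a term of polarity `∃` lies above each of its
      -- successors and one of polarity `∀` is their meet.
      refine hp (.visit hpol hwin fun q hq => ?_)
      have herase : ∀ t ∉ O, (O ∪ D.toFinset).erase t = O ∪ (D.filter (· ≠ t)).toFinset := by
        intro t ht
        ext x
        simp only [Finset.mem_erase, Finset.mem_union, List.mem_toFinset, List.mem_filter,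
          decide_eq_true_eq]
        constructor
        · rintro ⟨h1, h2 | h2⟩
          · exact .inl h2
          · exact .inr ⟨h2, h1⟩
        · rintro (h | ⟨h, h'⟩)
          · exact ⟨fun hx => ht (hx ▸ h), .inl h⟩
          · exact ⟨h', .inr h⟩
      cases hq with
      | @explore _ _ _ t t' ht hex hs =>
        have htO : t ∉ O := fun h => by
          obtain rfl := hO t h (.inl hex)
          exact step_one hs
        rw [herase t htO]
        have := hno (t' :: D.filter (· ≠ t)) (le_meet fun x hx => ?_)
        · convert this using 2
          ext x
          simp
        · by_cases hxt : x = t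
          · rw [hxt]
            exact (meet_le (by simp)).trans (hs.le_of_ex hex)
          · exact meet_le (by simp [hx, hxt])
      | @fork _ _ X' _ t ht hall hX' =>
        have htO : t ∉ O := fun h => by
          obtain rfl := hO t h (.inr hall)
          cases hall
        rw [herase t htO] at hX'
        have := hno (D.filter (· ≠ t) ++ (X'.filter (Step t ·)).toList) (le_meet fun x hx => ?_)
        · convert this using 2
          ext x
          have := hX' x
          simp at this ⊢
          tauto
        · by_cases hxt : x = t
          · rw [hxt]
            refine le_of_forall_step hall fun t' ht' => meet_le ?_
            simp [(hX' t').2 (.inr ht'), ht']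
          · exact meet_le (by simp [hx, hxt])
      | alea h =>
        cases h with
        | intro _ h _ => exact (hstuck h).elim
      | choose h => exact absurd (h.symm.trans hpol) (by simp)
      | junk h => exact absurd (h.symm.trans hpol) (by simp)
      | fill h => exact absurd (h.symm.trans hpol) (by simp)
    obtain ⟨D₁, hD₁, hp₁⟩ := hmain
    obtain ⟨D', k', hk', hrest, hp', hle, -⟩ := ih D₁ hp₁
    exact ⟨D', k', by omega, hrest, hp', hle.trans hD₁, .inr (by omega)⟩

/-! ## The generic interpretation -/

theorem Term.pol_residual {t : Term α} {a : α} (h : t.pol = .oracle a) : t.residual.pol = .ex := by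
  induction t with
  | letter => rfl
  | comp g f _ ih => exact ih h
  | _ => cases h

/-- The canonical term below a resting one: a question followed by the residual. -/
def canon (y : Term α) : Term α :=
  match y.pol with
  | .oracle a => .comp y.residual (.letter a)
  | _ => .one

theorem canon_le {y : Term α} (hy : Resting y) : Derives (canon y) y := by
  unfold canon
  by_cases h : y.Active
  · obtain rfl := hy h
    exact .refl _
  · obtain ⟨a, ha⟩ := Term.exists_oracle h
    simp only [ha]
    exact residual_comp_le ha

theorem meet_canon_le {Y : List (Term α)} (hY : ∀ y ∈ Y, Resting y) :
    Derives (meet (Y.map canon)) (meet Y) :=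
  le_meet fun y hy => (meet_le (List.mem_map_of_mem hy)).trans (canon_le (hY y hy))

theorem exists_sndCode : ∃ π : Baire, Computable π ∧ ∀ p, snd p ∈ app π p := by
  obtain ⟨π, hπ, h⟩ := Eff.snd_id
  exact ⟨π, hπ, fun p => h p _ (Part.mem_some _)⟩

/-- A code of the second projection. -/
noncomputable def sndCode : Baire := exists_sndCode.choose

theorem computable_sndCode : Computable sndCode := exists_sndCode.choose_spec.1

theorem snd_mem_app (p : Baire) : snd p ∈ app sndCode p := exists_sndCode.choose_spec.2 p

/-- Questions about a term, with a budget, and answers to them, given by a list of terms with a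
smaller budget. -/
abbrev Token (α : Type*) := (Term α × ℕ) ⊕ (Term α × ℕ × List (Term α) × ℕ)

/-- The canonical instance of `canon y`. -/
noncomputable def canonInst (w : Token α → Baire) (m : ℕ) (y : Term α) : Baire :=
  match y.pol with
  | .oracle _ => pair (w (.inl (y, m))) sndCode
  | _ => unitElt

/-- The canonical instance of a meet of canonical terms. -/
noncomputable def meetInst (w : Token α → Baire) (m : ℕ) : List (Term α) → Baire
  | [] => unitElt
  | y :: Y => pair (canonInst w m y) (meetInst w m Y)

/-- `κ` is the instance of the residual of `t` obtained from the canonical instance for `Y` with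
budget `m`. -/
structure IsAnswer (w : Token α → Baire) (t : Term α) (n : ℕ) (Y : List (Term α)) (m : ℕ)
    (φ ψ κ : Baire) : Prop where
  lt : m < n
  resting : ∀ y ∈ Y, Resting y
  computable_backward : Computable ψ
  -- Requiring the codes to work under every interpretation avoids circularity: the interpretation
  -- by tokens is defined from these answers. `Derives.reduces` provides such uniform codes.
  realizes : ∀ ρ : α → Problem,
    Realizes φ ψ ((meet (Y.map canon)).interp ρ) (t.residual.interp ρ)
  mem_app : κ ∈ app φ (meetInst w m Y)

/-- The interpretation of the letters by a family of points. -/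
def tokenProblem (w : Token α → Baire) (a : α) : Problem where
  dom := {x | ∃ t n, t.pol = .oracle a ∧ x = w (.inl (t, n))}
  sol x := {s | ∃ t n Y m φ ψ κ, x = w (.inl (t, n)) ∧ IsAnswer w t n Y m φ ψ κ ∧
    s = pair (w (.inr (t, n, Y, m))) κ}

theorem mem_tokenProblem_sol {w : Token α → Baire} (hw : Function.Injective w) {a : α}
    {t : Term α} {n : ℕ} {s : Baire} : s ∈ (tokenProblem w a).sol (w (.inl (t, n))) ↔
      ∃ Y m φ ψ κ, IsAnswer w t n Y m φ ψ κ ∧ s = pair (w (.inr (t, n, Y, m))) κ := by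
  constructor
  · rintro ⟨t', n', Y, m, φ, ψ, κ, h, hans, rfl⟩
    have := hw h
    simp only [Sum.inl.injEq, Prod.mk.injEq] at this
    obtain ⟨rfl, rfl⟩ := this
    exact ⟨Y, m, φ, ψ, κ, hans, rfl⟩
  · rintro ⟨Y, m, φ, ψ, κ, hans, rfl⟩
    exact ⟨t, n, Y, m, φ, ψ, κ, rfl, hans, rfl⟩

/-- Induction on the budget. An answer carries as second component an instance of the residual,
obtained by a reduction from a canonical instance of smaller budget, and `sndCode` passes it on. -/
theorem meetInst_mem_dom {w : Token α → Baire} (hw : Function.Injective w) (m : ℕ) :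
    ∀ Y : List (Term α), (∀ y ∈ Y, Resting y) →
      meetInst w m Y ∈ ((meet (Y.map canon)).interp (tokenProblem w)).dom := by
  induction m using Nat.strong_induction_on with
  | _ m ihm =>
    intro Y
    induction Y with
    | nil => exact fun _ => rfl
    | cons y Y ih =>
      intro hY
      refine Problem.pair_mem_inf_dom.2 ⟨?_, ih fun y hy => hY y (List.mem_cons_of_mem _ hy)⟩
      unfold canonInst canon
      cases hpol : y.pol with
      | ex => rfl
      | all => rfl
      | oracle a =>
        refine Problem.pair_mem_comp_dom.2 ⟨⟨y, m, hpol, rfl⟩, fun s hs => ?_⟩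
        obtain ⟨Y', m', φ, ψ, κ, hans, rfl⟩ := (mem_tokenProblem_sol hw).1 hs
        obtain ⟨v, hv, hdom, -⟩ := hans.realizes _ _ (ihm m' hans.lt Y' hans.resting)
        obtain rfl := Part.mem_unique hv hans.mem_app
        refine ⟨v, ?_, hdom⟩
        simpa using snd_mem_app (pair (w (.inr (y, m, Y', m'))) v)

theorem meetInst_mem_gen {w : Token α → Baire} {S : Set (Token α)} {m : ℕ} {Y : List (Term α)}
    (h : ∀ y ∈ Y, y ≠ .one → .inl (y, m) ∈ S) : meetInst w m Y ∈ Gen w S := by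
  induction Y with
  | nil => exact Gen.of_computable computable_unitElt
  | cons y Y ih =>
    refine Gen.pair ?_ (ih fun y hy => h y (List.mem_cons_of_mem _ hy))
    unfold canonInst
    cases hpol : y.pol with
    | ex => exact Gen.of_computable computable_unitElt
    | all => exact Gen.of_computable computable_unitElt
    | oracle a =>
      refine Gen.pair (Gen.of_mem (h y (by simp) ?_)) (Gen.of_computable computable_sndCode)
      rintro rfl
      cases hpol

/-- Canonical instances have no solution computable from answers in which the goal `1` has not
been reached. -/
theorem notMem_sol_meetInst {w : Token α → Baire} (hw : Generic w) {S : Set (Token α)}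
    (hS : ∀ t n Y m, .inr (t, n, Y, m) ∈ S → .one ∉ Y ∧ ∀ y ∈ Y, y ≠ .one → .inl (y, m) ∈ S)
    (m : ℕ) : ∀ Y : List (Term α), (∀ y ∈ Y, Resting y) → .one ∉ Y → ∀ z ∈ Gen w S,
      z ∉ ((meet (Y.map canon)).interp (tokenProblem w)).sol (meetInst w m Y) := by
  induction m using Nat.strong_induction_on with
  | _ m ihm =>
    intro Y
    induction Y with
    | nil => exact fun _ _ _ _ h => h
    | cons y Y ih =>
      intro hY h1 z hz hsol
      rcases (Problem.mem_inf_sol.1 hsol).2.2 with ⟨x, hx, rfl⟩ | ⟨x, hx, rfl⟩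
      · have hxG : x ∈ Gen w S := Gen.of_effFun EffFun.id.tail hz
        obtain ⟨a, hpol⟩ : ∃ a, y.pol = .oracle a := Term.exists_oracle fun hact =>
          h1 (by rw [hY y (by simp) hact]; simp)
        simp only [canonInst, canon, hpol] at hx
        obtain ⟨-, s, hs, v, hv, z₁, hz₁, rfl⟩ := Problem.mem_comp_sol.1 hx
        obtain ⟨Y', m', φ, ψ, κ, hans, rfl⟩ := (mem_tokenProblem_sol hw.injective).1 hs
        obtain rfl : v = κ := by
          simpa using Part.mem_unique hv (snd_mem_app _)
        -- A solution reveals the token of the answer received, so that answer was given in `S`. The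
        -- rest of the solution is pulled back along `ψ` to the canonical instance of `Y'`, which
        -- has a smaller budget.
        have htok : .inr (y, m, Y', m') ∈ S := hw.mem_of_gen (by
          simpa using Gen.of_effFun EffFun.id.fst.fst hxG)
        obtain ⟨h1', hY'⟩ := hS _ _ _ _ htok
        obtain ⟨v', hv', -, hback⟩ := hans.realizes (tokenProblem w) _
          (meetInst_mem_dom hw.injective m' Y' hans.resting)
        obtain rfl := Part.mem_unique hv' hans.mem_app
        obtain ⟨z', hz', hz'sol⟩ := hback z₁ hz₁
        refine ihm m' hans.lt Y' hans.resting h1' z' ?_ hz'sol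
        refine Gen.app_code hans.computable_backward (Gen.pair (meetInst_mem_gen hY') ?_) hz'
        simpa using Gen.of_effFun EffFun.id.snd hxG
      · refine ih (fun y hy => hY y (List.mem_cons_of_mem _ hy)) (fun h => h1 (by simp [h])) x ?_ hx
        exact Gen.of_effFun EffFun.id.tail hz

/-! ## Following a valid simulation -/

/-- The questions and answers in `S` are consistent with the position `(Γ ∣ X ⊣ _)`, in which `k`
further visits to winning positions are not possible. -/
structure Consistent (w : Token α → Baire) (Γ : Set α) (X : Finset (Term α)) (k : ℕ)
    (S : Set (Token α)) : Prop where
  asked : ∀ t n, .inl (t, n) ∈ S → (t ∈ X ∧ k < n) ∨ ∃ a ∈ Γ, t.pol = .oracle a ∧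
    ∃ s ∈ (tokenProblem w a).sol (w (.inl (t, n))), s ∈ Gen w S
  answered : ∀ t n Y m, .inr (t, n, Y, m) ∈ S →
    (.one ∈ Y → .one ∈ X) ∧ ∀ y ∈ Y, y ≠ .one → .inl (y, m) ∈ S

/-- A position lost by Duplicator, together with consistent questions and answers. -/
structure Losing (w : Token α → Baire) (Γ : Set α) (X : Finset (Term α)) (k : ℕ)
    (S : Set (Token α)) (e : Term α) : Prop where
  stuck : Stuck X
  notMem_stage : (⟨Γ, X, e⟩ : Position α) ∉ (simArena α).Stage k
  consistent : Consistent w Γ X k S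

/-- The simulation can be continued to a position with simulator `e`, with an element of `Q`. -/
def Continues (w : Token α → Baire) (S : Set (Token α)) (e : Term α) (Q : Set Baire) : Prop :=
  ∃ y ∈ Q, ∃ Γ X k S', S ⊆ S' ∧ y ∈ Gen w S' ∧ Losing w Γ X k S' e

theorem Losing.step_of_ex {w : Token α → Baire} {Γ : Set α} {X : Finset (Term α)} {k : ℕ}
    {S : Set (Token α)} {e e' : Term α} (h : Losing w Γ X k S e) (he : e.pol = .ex)
    (hs : Step e e') : Losing w Γ X k S e' := by
  have hpol : Position.pol ⟨Γ, X, e⟩ = .duplicator := by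
    refine pol_eq_duplicator_iff.2 ⟨h.stuck, ?_, by simp [he]⟩
    rintro ⟨rfl, -⟩
    exact step_one hs
  exact ⟨h.stuck, notMem_stage_of_duplicator h.notMem_stage hpol (.choose hpol he hs),
    h.consistent⟩

-- An oracle call on a point computed so far can be answered so that the play stays lost: by a fill
-- move if the question is still a goal, and by a junk move with the old answer otherwise.
open Classical in
theorem Losing.oracle {w : Token α → Baire} (hw : Generic w) {Γ : Set α} {X : Finset (Term α)}
    {k : ℕ} {S : Set (Token α)} {e e' : Term α} (h : Losing w Γ X k S e) {a : α}
    (he : e.pol = .oracle a) (hs : Step e e') {v : Baire} (hv : v ∈ (tokenProblem w a).dom)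
    (hvG : v ∈ Gen w S) : Continues w S e' ((tokenProblem w a).sol v) := by
  obtain ⟨t, n, ht, rfl⟩ := hv
  have hpol : Position.pol ⟨Γ, X, e⟩ = .duplicator := by
    refine pol_eq_duplicator_iff.2 ⟨h.stuck, ?_, by simp [he]⟩
    rintro ⟨rfl, -⟩
    exact step_one hs
  have h1t : Term.one ≠ t := by
    rintro rfl
    cases ht
  -- By genericity the question is one of those recorded in `S`.
  rcases h.consistent.asked t n (hw.mem_of_gen hvG) with ⟨htX, hkn⟩ | ⟨b, hb, htb, s, hsol, hsG⟩
  · have hfill := notMem_stage_of_duplicator h.notMem_stage hpol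
      (.fill hpol htX he ht hs ((step_iff_residual ht).2 rfl))
    have hO : Stuck (X.erase t) := fun y hy => h.stuck y (Finset.mem_of_mem_erase hy)
    obtain ⟨D, k', m, hrest, hD, hle, hk', hm, hlt⟩ : ∃ (D : List (Term α)) (k' m : ℕ),
        (∀ y ∈ D, Resting y) ∧
        (⟨insert a Γ, X.erase t ∪ D.toFinset, e'⟩ : Position α) ∉ (simArena α).Stage k' ∧
        Derives (meet D) t.residual ∧ k' ≤ k ∧ m ≤ k ∧ ∀ y ∈ D, y ≠ .one → k' < m := by
      have heq : insert t.residual (X.erase t) = X.erase t ∪ [t.residual].toFinset := by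
        ext x
        simp
      rw [heq] at hfill
      -- If the residual is `1`, nothing is decomposed and no new question arises, so budget `0`
      -- will do. Otherwise Spoiler's decomposition uses up a visit, hence `k' < k`, and the budget
      -- `k' + 1` lies above the remaining visits and below the budget of the question.
      by_cases hr : t.residual = .one
      · refine ⟨[t.residual], k, 0, ?_, hfill, meet_le (by simp), le_rfl, Nat.zero_le _, ?_⟩
        · simp [Resting, hr]
        · simp [hr]
      · obtain ⟨D, k', hk', hrest, hD, hle, hlt⟩ :=
          exists_resting_of_notMem_stage hO k [t.residual] hfill
        have hlt : k' < k := hlt.resolve_left fun hrest =>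
          hr (hrest t.residual (by simp) (.inl (Term.pol_residual ht)))
        exact ⟨D, k', k' + 1, hrest, hD, hle.trans (meet_le (by simp)), hk', hlt, fun _ _ _ => by
          omega⟩
    obtain ⟨φ, ψ, hφ, hψ, hred⟩ := ((meet_canon_le hrest).trans hle).reduces
    obtain ⟨κ, hκ, -⟩ := hred _ _ (meetInst_mem_dom hw.injective m D hrest)
    have hans : ∀ n', k < n' → IsAnswer w t n' D m φ ψ κ := fun n' hn' =>
      ⟨by omega, hrest, hψ, hred, hκ⟩
    -- Since `t` leaves the goals, its questions are answered for all budgets at once; the same term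
    -- may have been asked about with several budgets.
    let S' : Set (Token α) := S ∪ ({i | ∃ n', i = .inr (t, n', D, m)} ∪
      {i | ∃ y ∈ D, y ≠ .one ∧ i = .inl (y, m)})
    have hSS' : S ⊆ S' := Set.subset_union_left
    have hq : ∀ y ∈ D, y ≠ .one → .inl (y, m) ∈ S' := fun y hy h1 =>
      .inr (.inr ⟨y, hy, h1, rfl⟩)
    have hsG : ∀ n', pair (w (.inr (t, n', D, m))) κ ∈ Gen w S' := fun n' =>
      Gen.pair (Gen.of_mem (.inr (.inl ⟨n', rfl⟩))) (Gen.app_code hφ (meetInst_mem_gen hq) hκ)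
    refine ⟨_, (mem_tokenProblem_sol hw.injective).2 ⟨D, m, φ, ψ, κ, hans n hkn, rfl⟩,
      insert a Γ, X.erase t ∪ D.toFinset, k', S', hSS', hsG n, ?_, hD, ?_, ?_⟩
    · intro y hy
      rcases Finset.mem_union.1 hy with hy | hy
      · exact hO y hy
      · exact hrest y (by simpa using hy)
    · rintro t' n' (hi | ⟨_, hi⟩ | ⟨y, hy, h1, hi⟩)
      · rcases h.consistent.asked t' n' hi with ⟨ht', hk⟩ | ⟨b, hb, htb, s, hsol, hs⟩
        · by_cases htt : t' = t
          · subst htt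
            exact .inr ⟨a, Set.mem_insert _ _, ht, _,
              (mem_tokenProblem_sol hw.injective).2 ⟨D, m, φ, ψ, κ, hans n' hk, rfl⟩, hsG n'⟩
          · exact .inl ⟨by simp [ht', htt], by omega⟩
        · exact .inr ⟨b, Set.mem_insert_of_mem _ hb, htb, s, hsol, Gen.mono hSS' hs⟩
      · cases hi
      · simp only [Sum.inl.injEq, Prod.mk.injEq] at hi
        obtain ⟨rfl, rfl⟩ := hi
        exact .inl ⟨by simp [hy], hlt _ hy h1⟩
    · rintro t' n' Y' m' (hi | ⟨_, hi⟩ | ⟨y, hy, h1, hi⟩)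
      · obtain ⟨h1, h2⟩ := h.consistent.answered _ _ _ _ hi
        exact ⟨fun h => by simp [h1t, h1 h], fun y hy hy1 => hSS' (h2 y hy hy1)⟩
      · simp only [Sum.inr.injEq, Prod.mk.injEq] at hi
        obtain ⟨-, -, rfl, rfl⟩ := hi
        exact ⟨fun h => by simp [h], hq⟩
      · cases hi
  · obtain rfl : b = a := by
      rw [ht] at htb
      cases htb
      rfl
    exact ⟨s, hsol, Γ, X, k, S, subset_rfl, hsG, h.stuck,
      notMem_stage_of_duplicator h.notMem_stage hpol (.junk hpol he hb hs), h.consistent⟩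

/-- The instance `v` dictates Duplicator's moves: the side of a join, whether to unfold an
iteration, the question to ask. Spoiler's moves are taken from the lost game and determine which
solution is produced. The stack `E` records the rest of the simulator. -/
theorem Losing.continues {w : Token α → Baire} (hw : Generic w) (d : Term α) :
    ∀ (E : List (Frame α Unit)) {Γ : Set α} {X : Finset (Term α)} {k : ℕ} {S : Set (Token α)},
      Losing w Γ X k S (plug E d) → ∀ v ∈ (d.interp (tokenProblem w)).dom, v ∈ Gen w S →
        Continues w S (plug E .one) ((d.interp (tokenProblem w)).sol v) := by
  induction d with
  | letter a =>
    intro E Γ X k S h v hv hvG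
    exact h.oracle hw (by rw [pol_plug]; rfl) (Step.plug E (.letter a)) hv hvG
  | zero => exact fun E Γ X k S h v hv => hv.elim
  | one =>
    intro E Γ X k S h v hv hvG
    exact ⟨unitElt, rfl, Γ, X, k, S, subset_rfl, Gen.of_computable computable_unitElt, h⟩
  | top =>
    intro E Γ X k S h v hv hvG
    obtain ⟨e', hs, -⟩ := exists_alea_of_notMem_stage h.notMem_stage h.stuck
      (by rw [pol_plug]; rfl)
    obtain ⟨d', hs, -⟩ := (step_plug_iff (by simp)).1 hs
    cases hs
  | sup d₁ d₂ ih₁ ih₂ =>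
    intro E Γ X k S h v hv hvG
    have hpol : (plug E (d₁.sup d₂)).pol = .ex := by rw [pol_plug]; rfl
    rcases hv with ⟨u, hu, rfl⟩ | ⟨u, hu, rfl⟩
    · obtain ⟨y, hy, h⟩ := ih₁ E (h.step_of_ex hpol (Step.plug E (.sup_left _ _))) u hu
        (Gen.of_effFun EffFun.id.tail hvG)
      exact ⟨y, Problem.mem_sup_sol_in₁.2 ⟨hu, hy⟩, h⟩
    · obtain ⟨y, hy, h⟩ := ih₂ E (h.step_of_ex hpol (Step.plug E (.sup_right _ _))) u hu
        (Gen.of_effFun EffFun.id.tail hvG)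
      exact ⟨y, Problem.mem_sup_sol_in₂.2 ⟨hu, hy⟩, h⟩
  | inf d₁ d₂ ih₁ ih₂ =>
    intro E Γ X k S h v hv hvG
    obtain ⟨u₁, hu₁, u₂, hu₂, rfl⟩ := hv
    obtain ⟨e', hs, hstage⟩ := exists_alea_of_notMem_stage h.notMem_stage h.stuck
      (by rw [pol_plug]; rfl)
    obtain ⟨d', hs', rfl⟩ := (step_plug_iff (by simp)).1 hs
    cases hs' with
    | inf_left =>
      obtain ⟨y, hy, Γ', X', k', S', hSS', hyG, h⟩ := ih₁ E ⟨h.stuck, hstage, h.consistent⟩ u₁ hu₁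
        (by simpa using Gen.fst hvG)
      exact ⟨in₁ y, Problem.mem_inf_sol.2 ⟨hu₁, hu₂, .inl ⟨y, hy, rfl⟩⟩, Γ', X', k', S', hSS',
        Gen.of_effFun EffFun.id.in₁ hyG, h⟩
    | inf_right =>
      obtain ⟨y, hy, Γ', X', k', S', hSS', hyG, h⟩ := ih₂ E ⟨h.stuck, hstage, h.consistent⟩ u₂ hu₂
        (by simpa using Gen.snd hvG)
      exact ⟨in₂ y, Problem.mem_inf_sol.2 ⟨hu₁, hu₂, .inr ⟨y, hy, rfl⟩⟩, Γ', X', k', S', hSS',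
        Gen.of_effFun EffFun.id.in₂ hyG, h⟩
  | comp g d ihg ihd =>
    intro E Γ X k S h v hv hvG
    obtain ⟨u, hu, c, rfl, hc⟩ := hv
    obtain ⟨x, hx, Γ', X', k', S', hSS', hxG, h⟩ := ihd (.plain g :: E) h u hu
      (by simpa using Gen.fst hvG)
    obtain ⟨v, hv, hvdom⟩ := hc x hx
    have hcG : c ∈ Gen w S' := Gen.mono hSS' (by simpa using Gen.snd hvG)
    obtain ⟨y, hy, Γ'', X'', k'', S'', hSS'', hyG, h⟩ := ihg E
      (h.step_of_ex (by rw [pol_plug]; rfl) (Step.plug E (.comp_one g))) v hvdom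
      (Gen.app hcG hxG hv)
    exact ⟨pair x y, Problem.mem_comp_sol.2 ⟨hu, x, hx, v, hv, y, hy, rfl⟩, Γ'', X'', k'', S'',
      hSS'.trans hSS'', Gen.pair (Gen.mono hSS'' hxG) hyG, h⟩
  | diamond d ih =>
    intro E Γ X k S h v hv
    have hpol : (plug E d.diamond).pol = .ex := by rw [pol_plug]; rfl
    induction hv generalizing Γ X k S with
    | unit =>
      intro hvG
      exact ⟨unitElt, Problem.mem_diamond_sol_unit.2 rfl, Γ, X, k, S, subset_rfl,
        Gen.of_computable computable_unitElt, h.step_of_ex hpol (Step.plug E (.diamond_one d))⟩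
    | step u c hu hc hcd ihc =>
      intro hvG
      obtain ⟨x, hx, Γ', X', k', S', hSS', hxG, h⟩ := ih (.plain d.diamond :: E)
        (h.step_of_ex hpol (Step.plug E (.diamond_unfold d))) u hu (by simpa using Gen.fst hvG)
      obtain ⟨v, hv⟩ := Part.dom_iff_mem.1 (hc x hx)
      have hcG : c ∈ Gen w S' := Gen.mono hSS' (by simpa using Gen.snd hvG)
      obtain ⟨y, hy, Γ'', X'', k'', S'', hSS'', hyG, h⟩ := ihc x hx v hv
        (h.step_of_ex (by rw [pol_plug]; rfl) (Step.plug E (.comp_one d.diamond)))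
        (Gen.app hcG hxG hv)
      exact ⟨pair x y, Problem.mem_diamond_sol_pair.2 ⟨hu, x, hx, v, hv, y, hy, rfl⟩, Γ'', X'',
        k'', S'', hSS'.trans hSS'', Gen.pair (Gen.mono hSS'' hxG) hyG, h⟩

-- If the position were lost at stage `k`, the canonical instance for Spoiler's decomposition of `e`
-- would be sent to `f` by the reductions, answered along a lost play, and sent back to a solution
-- that cannot be computed.
open Classical in
theorem Valid.mem_stage [Countable α] {e f : Term α} (h : Valid e f) (k : ℕ) :
    (⟨∅, {e}, f⟩ : Position α) ∈ (simArena α).Stage k := by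
  by_contra hp
  obtain ⟨w, hw⟩ := exists_generic (Token α)
  obtain ⟨D, k', -, hrest, hD, hle, -⟩ := exists_resting_of_notMem_stage (O := ∅)
    (fun y hy => by simp at hy) k [e] (by simpa using hp)
  rw [Finset.empty_union] at hD
  obtain ⟨φ, ψ, hφ, hψ, hred⟩ :=
    ((meet_canon_le hrest).trans (hle.trans (meet_le (List.mem_singleton_self e)))).reduces
  obtain ⟨u, hu, hudom, huback⟩ := hred _ _ (meetInst_mem_dom hw.injective (k' + 1) D hrest)
  obtain ⟨φ', ψ', hφ', hψ', hred'⟩ := h (tokenProblem w)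
  obtain ⟨v, hv, hvdom, hvback⟩ := hred' u hudom
  -- The answer token of budget `0` answers no actual question, as budgets must decrease. It is
  -- bookkeeping: consistency then records for `D` itself that `1 ∈ D` would force `1` into the
  -- goals.
  let S : Set (Token α) := {i | i = .inr (e, 0, D, k' + 1)} ∪
    {i | ∃ y ∈ D, y ≠ .one ∧ i = .inl (y, k' + 1)}
  have hq : ∀ y ∈ D, y ≠ .one → .inl (y, k' + 1) ∈ S := fun y hy h1 => .inr ⟨y, hy, h1, rfl⟩
  have hmG : meetInst w (k' + 1) D ∈ Gen w S := meetInst_mem_gen hq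
  have huG : u ∈ Gen w S := Gen.app_code hφ hmG hu
  have hlose : Losing w ∅ D.toFinset k' S f := by
    refine ⟨fun y hy => hrest y (by simpa using hy), hD, ?_, ?_⟩
    · rintro t n (hi | ⟨y, hy, h1, hi⟩)
      · cases hi
      · simp only [Sum.inl.injEq, Prod.mk.injEq] at hi
        obtain ⟨rfl, rfl⟩ := hi
        exact .inl ⟨by simpa using hy, Nat.lt_succ_self k'⟩
    · rintro t n Y m (hi | ⟨y, hy, h1, hi⟩)
      · simp only [Set.mem_ofPred_eq, Sum.inr.injEq, Prod.mk.injEq] at hi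
        obtain ⟨-, -, rfl, rfl⟩ := hi
        exact ⟨fun h => by simpa using h, hq⟩
      · cases hi
  obtain ⟨y, hy, Γ', X', k'', S', hSS', hyG, hlose'⟩ := hlose.continues hw f [] v hvdom
    (Gen.app_code hφ' huG hv)
  have h1 : .one ∉ X' := one_notMem_of_notMem_stage hlose'.notMem_stage hlose'.stuck
  obtain ⟨z, hz, hzsol⟩ := hvback y hy
  obtain ⟨z', hz', hzsol'⟩ := huback z hzsol
  refine notMem_sol_meetInst hw (S := S') (fun t n Y m hi => ?_) (k' + 1) D hrest ?_ z' ?_ hzsol'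
  · obtain ⟨h2, h3⟩ := hlose'.consistent.answered t n Y m hi
    exact ⟨fun h => h1 (h2 h), h3⟩
  · exact fun h => h1 ((hlose'.consistent.answered _ _ _ _ (hSS' (.inl rfl))).1 h)
  · exact Gen.app_code hψ (Gen.pair (Gen.mono hSS' hmG)
      (Gen.app_code hψ' (Gen.pair (Gen.mono hSS' huG) hyG) hz)) hz'

/-- Lying in every stage suffices because only finitely many positions are reachable. -/
theorem Valid.duplicatorWins [Finite α] {e f : Term α} (h : Valid e f) :
    (simArena α).DuplicatorWins ⟨∅, {e}, f⟩ := by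
  have hv : (⟨∅, {e}, f⟩ : Position α) ∈ reachPos e f :=
    ⟨by simp [Term.mem_reach_self], Term.mem_reach_self f⟩
  have hcl : ∀ p ∈ reachPos e f, ∀ q, (simArena α).Move p q → q ∈ reachPos e f :=
    fun p hp q hq => reachPos_move hp hq
  by_contra hno
  obtain ⟨k, hk⟩ := BuchiArena.exists_notMem_stage (reachPos_finite e f) hcl hv fun hwin =>
    hno (BuchiArena.Winning.duplicatorWins (reachPos_finite e f) hcl hv hwin)
  exact hk (h.mem_stage k)

end Weih

theorem theorem1p1 {α : Type*} [Finite α] (e f : Weih.Term α) :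
    List.TFAE [Weih.Derives e f, Weih.Valid e f,
      (Weih.simArena α).DuplicatorWins ⟨∅, {e}, f⟩] := by
  tfae_have 1 → 2 := fun h => h.valid
  tfae_have 2 → 3 := fun h => h.duplicatorWins
  tfae_have 3 → 1 := fun h => .of_winning (h.winning Weih.win_spoiler)
  tfae_finish
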